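/- Let $n\ge 1$ and let $\psi$ be an integrable (real- or complex-valued) function on $\mathbb R^n$ with $\int_{\mathbb R^n}\psi=0$ such that, for some $0<\varepsilon\le 1$ and some constant $c$, $$|\psi(x)|\le \frac{c}{(1+|x|)^{n+\varepsilon}}\quad (x\in\mathbb R^n),\qquad \int_{\mathbb R^n}|\psi(x+h)-\psi(x)|\,dx\le c|h|^{\varepsilon}\quad (h\in\mathbb R^n).$$ Put $\psi_t(x)=t^{-n}\psi(x/t)$. Let $\Phi$ be a Schwartz function on $\mathbb R^n$ with $\chi_{B(0,1)}\le\Phi\le\chi_{B(0,2)}$, and for $\alpha\ge 1$ define, with values in $[0,\infty]$, $$\widetilde S_{\alpha,\psi}(f)(x)=\left(\int_0^\infty\!\!\int_{\mathbb R^n}\Phi\Big(\frac{x-y}{t\alpha}\Big)|f*\psi_t(y)|^2\,\frac{dy\,dt}{t^{n+1}}\right)^{1/2}.$$ For a function $h$ on $\mathbb R^n$ let $h^*(t)=\inf\{a>0:|\{x:|h(x)|>a\}|<t\}$, and for a cube $Q$ and $0<\lambda<1$ let $$\omega_\lambda(g;Q)=\inf_{c\in\mathbb R}\big((g-c)\chi_Q\big)^*(\lambda|Q|).$$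 Let $\delta=\varepsilon$ if $\varepsilon<1$, and let $\delta<1$ be arbitrary if $\varepsilon=1$; let $0<\lambda<1$. Then there is a constant $C>0$, depending only on $n,\lambda,\psi,\varepsilon,\delta,\Phi$, such that for every $\alpha\ge 1$, every cube $Q\subset\mathbb R^n$ with sides parallel to the axes, and every locally integrable $f$ for which $\widetilde S_{\alpha,\psi}(f)$ is finite at at least one point of $Q$ (this need not be assumed if $f\in L^1(\mathbb R^n)$), $$\omega_\lambda\big(\widetilde S_{\alpha,\psi}(f)^2;Q\big)\le C\,\alpha^{2n}\sum_{k=0}^\infty \frac1{2^{k\delta}}\left(\frac1{|2^kQ|}\int_{2^kQ}|f|\right)^2,$$ where $2^kQ$ is the cube with the same centre as $Q$ and side length $2^k$ times as large (the right-hand side may be $+\infty$, in which case nothing is claimed). -/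

import Mathlib

open MeasureTheory Set
open scoped ENNReal SchwartzMap Convolution

noncomputable section

/-- The closed axis-parallel cube in `ℝⁿ` with centre `z` and side length `ℓ`. -/
def cube {n : ℕ} (z : EuclideanSpace ℝ (Fin n)) (ℓ : ℝ) : Set (EuclideanSpace ℝ (Fin n)) :=
  {x | ∀ i, |x i - z i| ≤ ℓ / 2}

/-- Standard kernels: `ψ` is integrable with mean zero, and for some constant `c` one has
`|ψ(x)| ≤ c / (1 + |x|)^(n + ε)` and `∫ |ψ(x + h) - ψ(x)| dx ≤ c |h|^ε`. -/
structure IsStandardKernel {n : ℕ} {𝕜 : Type*} [RCLike 𝕜]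
    (ψ : EuclideanSpace ℝ (Fin n) → 𝕜) (ε : ℝ) : Prop where
  eps_pos : 0 < ε
  integrable : Integrable ψ volume
  integral_eq_zero : ∫ x, ψ x = 0
  bounds : ∃ c : ℝ, (∀ x, ‖ψ x‖ ≤ c / (1 + ‖x‖) ^ ((n : ℝ) + ε)) ∧
    ∀ h : EuclideanSpace ℝ (Fin n), ∫ x, ‖ψ (x + h) - ψ x‖ ≤ c * ‖h‖ ^ ε

/-- A smooth cut-off: a Schwartz function with `χ_{B(0,1)} ≤ Φ ≤ χ_{B(0,2)}`. -/
def IsCutoff {n : ℕ} (Φ : 𝓢(EuclideanSpace ℝ (Fin n), ℝ)) : Prop :=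
  ∀ x, (Metric.ball (0 : EuclideanSpace ℝ (Fin n)) 1).indicator (fun _ => (1 : ℝ)) x ≤ Φ x ∧
    Φ x ≤ (Metric.ball (0 : EuclideanSpace ℝ (Fin n)) 2).indicator (fun _ => (1 : ℝ)) x

/-- The dilation `ψ_t(x) = t⁻ⁿ ψ(x / t)`. -/
def dilate {n : ℕ} {𝕜 : Type*} [RCLike 𝕜]
    (ψ : EuclideanSpace ℝ (Fin n) → 𝕜) (t : ℝ) (x : EuclideanSpace ℝ (Fin n)) : 𝕜 :=
  (t ^ n)⁻¹ • ψ (t⁻¹ • x)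

/-- The smooth square function of aperture `α`,
`(∬_{y ∈ ℝⁿ, t > 0} Φ((x - y) / (t α)) |f * ψ_t (y)|² dy dt / t^(n+1))^(1/2)`,
with values in `[0, ∞]`. -/
def smoothSquareFunction {n : ℕ} {𝕜 : Type*} [RCLike 𝕜]
    (Φ : 𝓢(EuclideanSpace ℝ (Fin n), ℝ)) (α : ℝ) (ψ f : EuclideanSpace ℝ (Fin n) → 𝕜)
    (x : EuclideanSpace ℝ (Fin n)) : ℝ≥0∞ :=
  (∫⁻ p : EuclideanSpace ℝ (Fin n) × ℝ in univ ×ˢ Ioi (0 : ℝ),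
    ENNReal.ofReal (Φ ((p.2 * α)⁻¹ • (x - p.1))) *
      ‖(f ⋆[ContinuousLinearMap.mul 𝕜 𝕜, volume] dilate ψ p.2) p.1‖ₑ ^ 2 /
        ENNReal.ofReal (p.2 ^ (n + 1))) ^ (1 / 2 : ℝ)

/-- The non-increasing rearrangement `h^*(t) = inf {a > 0 : |{x : |h(x)| > a}| < t}`
of an extended-real-valued function on `ℝⁿ`. -/
def rearrangement {n : ℕ} (h : EuclideanSpace ℝ (Fin n) → EReal) (t : ℝ) : ℝ≥0∞ :=
  sInf {a : ℝ≥0∞ | 0 < a ∧ volume {x | a < (h x).abs} < ENNReal.ofReal t}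

/-- The local mean oscillation `inf_{c ∈ ℝ} ((g - c) χ_Q)^* (lam |Q|)`. -/
def localMeanOscillation {n : ℕ} (lam : ℝ) (g : EuclideanSpace ℝ (Fin n) → EReal)
    (Q : Set (EuclideanSpace ℝ (Fin n))) : ℝ≥0∞ :=
  ⨅ c : ℝ, rearrangement (Q.indicator fun x => g x - (c : EReal)) (lam * volume.real Q)

end

/-!
The argument splits the squared square function, for `x ∈ Q`, into the integral over the box
`localBox` above `2Q` and the integral over the complement of that box.

The local part is compared with the square function of `f` restricted to `4Q`; the rest of `f` is
harmless because of the decay of `ψ` (`IsRegularKernel.absConv_compl_cube_le`). For the restricted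
function one needs the weak type bound `|{S_α u > τ}| ≤ C αⁿ ‖u‖₁ / τ`
(`IsRegularKernel.exists_volume_squareInt_gt_le`), whose growth in `α` is what gives the factor
`α^(2n)` in the end. It is obtained from a Calderón–Zygmund decomposition at height `τ`
(`exists_calderonZygmund`). The good part is handled on `L²`, where Fubini reduces every aperture
to the vertical square function, which is bounded by Plancherel's theorem
(`IsRegularKernel.exists_lintegral_dilConv_sq_le`). Each bad atom is handled in a weighted `L²`
space outside a ball whose radius is proportional to `α` times the side of its cube, and the
Cauchy–Schwarz inequality turns this into an `L¹` bound.

The non-local part hardly oscillates on `Q`: the cut-offs centred at two points of `Q` differ by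
`O(2^(-m))` on the shell of points at scale `2^m ℓ` (`IsCutoff.exists_abs_sub_le`), while the
integral of `|f * ψ_t|²` over that shell is `O(α^(2n) s² 2^(mδ))` when the averages of `|f|` over
`2^j Q` are at most `s 2^(jδ/2)` (`IsRegularKernel.lintegral_scaleShell_le`). Since `δ < 1` the
series converges. The value of the non-local part at one point of `Q` serves as the constant in
the oscillation, and the growth condition holds with `s²` essentially the sum on the right-hand
side.

Throughout, `ψ` is replaced by an almost everywhere equal measurable kernel (`IsRegularKernel`), and
integrals of non-negative functions are lower Lebesgue integrals, so that no integrability is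
implicit.
-/

/-! ### Power integrals, balls and cubes -/

theorem lintegral_Ioi_rpow_eq {a s : ℝ} (ha : 0 < a) (hs : 0 < s) :
    ∫⁻ t in Ioi a, ENNReal.ofReal (t ^ (-s - 1)) = ENNReal.ofReal (a ^ (-s) / s) := by
  rw [← ofReal_integral_eq_lintegral_ofReal
    (integrableOn_Ioi_rpow_of_lt (by linarith) ha)
    ((ae_restrict_iff' measurableSet_Ioi).2 (ae_of_all _ fun t ht =>
      Real.rpow_nonneg (ha.trans ht).le _)), integral_Ioi_rpow_of_lt (by linarith) ha]
  congr 1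
  rw [show -s - 1 + 1 = -s by ring, neg_div_neg_eq]

theorem lintegral_Ioc_rpow_eq {a s : ℝ} (ha : 0 < a) (hs : 0 < s) :
    ∫⁻ t in Ioc 0 a, ENNReal.ofReal (t ^ (s - 1)) = ENNReal.ofReal (a ^ s / s) := by
  have h1 : IntervalIntegrable (fun t : ℝ => t ^ (s - 1)) volume 0 a :=
    intervalIntegral.intervalIntegrable_rpow' (by linarith)
  rw [← ofReal_integral_eq_lintegral_ofReal
    ((intervalIntegrable_iff_integrableOn_Ioc_of_le ha.le).1 h1)
    ((ae_restrict_iff' measurableSet_Ioc).2 (ae_of_all _ fun t ht =>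
      Real.rpow_nonneg ht.1.le _)), ← intervalIntegral.integral_of_le ha.le,
      integral_rpow (Or.inl (by linarith))]
  congr 1
  rw [show s - 1 + 1 = s by ring, Real.zero_rpow hs.ne', sub_zero]

/-- The two-sided scale integral `∫₀^∞ min(τ^a, τ^(-b)) dτ/τ` with the breaking point at `τ`. -/
theorem lintegral_Ioi_le_of_le_rpow {a b τ A B : ℝ} (ha : 0 < a) (hb : 0 < b) (hτ : 0 < τ)
    (hA : 0 ≤ A) (hB : 0 ≤ B) {φ : ℝ → ℝ≥0∞}
    (h1 : ∀ t, 0 < t → φ t ≤ ENNReal.ofReal (A * t ^ (a - 1)))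
    (h2 : ∀ t, 0 < t → φ t ≤ ENNReal.ofReal (B * t ^ (-b - 1))) :
    ∫⁻ t in Ioi 0, φ t ≤ ENNReal.ofReal (A * (τ ^ a / a) + B * (τ ^ (-b) / b)) := by
  rw [← Ioc_union_Ioi_eq_Ioi hτ.le, lintegral_union measurableSet_Ioi
    (Set.disjoint_left.2 fun x hx hx' => absurd hx.2 (not_le.2 hx')),
    ENNReal.ofReal_add (by positivity) (by positivity)]
  gcongr
  · calc ∫⁻ t in Ioc 0 τ, φ t ≤ ∫⁻ t in Ioc 0 τ, ENNReal.ofReal A * ENNReal.ofReal (t ^ (a - 1)) :=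
          setLIntegral_mono' measurableSet_Ioc fun t ht => by
            rw [← ENNReal.ofReal_mul hA]; exact h1 t ht.1
      _ = _ := by
          rw [lintegral_const_mul _ (by fun_prop), lintegral_Ioc_rpow_eq hτ ha,
            ← ENNReal.ofReal_mul hA]
  · calc ∫⁻ t in Ioi τ, φ t ≤ ∫⁻ t in Ioi τ, ENNReal.ofReal B * ENNReal.ofReal (t ^ (-b - 1)) :=
          setLIntegral_mono' measurableSet_Ioi fun t ht => by
            rw [← ENNReal.ofReal_mul hB]; exact h2 t (hτ.trans ht)
      _ = _ := by
          rw [lintegral_const_mul _ (by fun_prop), lintegral_Ioi_rpow_eq hτ hb,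
            ← ENNReal.ofReal_mul hB]

section Preliminaries

variable {n : ℕ}

theorem volume_ball_eq (x : EuclideanSpace ℝ (Fin n)) {r : ℝ} (hr : 0 < r) :
    volume (Metric.ball x r) =
      ENNReal.ofReal (r ^ n) * volume (Metric.ball (0 : EuclideanSpace ℝ (Fin n)) 1) := by
  simpa using Measure.addHaar_ball_of_pos volume x hr

theorem lintegral_inv_smul (g : EuclideanSpace ℝ (Fin n) → ℝ≥0∞) {t : ℝ} (ht : 0 < t) :
    ∫⁻ x, g (t⁻¹ • x) = ENNReal.ofReal (t ^ n) * ∫⁻ x, g x := by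
  have h := (Homeomorph.smulOfNeZero (α := EuclideanSpace ℝ (Fin n)) (t⁻¹)
    (inv_ne_zero ht.ne')).measurableEmbedding.lintegral_map (μ := volume) g
  have h2 := Measure.map_addHaar_smul (volume : Measure (EuclideanSpace ℝ (Fin n)))
    (inv_ne_zero ht.ne')
  change ∫⁻ a, g a ∂(volume.map (t⁻¹ • ·)) = ∫⁻ a, g (t⁻¹ • a) at h
  rw [← h, h2, lintegral_smul_measure]
  simp [abs_of_pos ht]

theorem lintegral_indicator_norm_rpow_le {η : ℝ} (hη : 0 < η) :
    ∃ C : ℝ, 0 < C ∧ ∀ (x₀ : EuclideanSpace ℝ (Fin n)) (R : ℝ), 0 < R →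
      ∫⁻ x in {x | R < ‖x - x₀‖}, ENNReal.ofReal (‖x - x₀‖ ^ (-(n + η))) ≤
        ENNReal.ofReal (C * R ^ (-η)) := by
  set I := ∫⁻ x : EuclideanSpace ℝ (Fin n), ENNReal.ofReal ((1 + ‖x‖) ^ (-(n + η)))
  have hI : I < ∞ := finite_integral_one_add_norm (by simpa using hη)
  refine ⟨2 ^ (n + η) * (I.toReal + 1), by positivity, fun x₀ R hR => ?_⟩
  have key : ∀ x : EuclideanSpace ℝ (Fin n), R < ‖x - x₀‖ →
      ENNReal.ofReal (‖x - x₀‖ ^ (-(n + η))) ≤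
        ENNReal.ofReal (2 ^ (n + η) * R ^ (-(n + η))) *
          ENNReal.ofReal ((1 + ‖R⁻¹ • (x - x₀)‖) ^ (-(n + η))) := fun x hx => by
    rw [← ENNReal.ofReal_mul (by positivity), norm_smul, Real.norm_of_nonneg (by positivity)]
    apply ENNReal.ofReal_le_ofReal
    have h1 : ‖x - x₀‖ = R * (R⁻¹ * ‖x - x₀‖) := by field_simp
    have h2 : 1 < R⁻¹ * ‖x - x₀‖ := by
      rw [inv_mul_eq_div, lt_div_iff₀ hR]; linarith
    generalize R⁻¹ * ‖x - x₀‖ = w at h1 h2 ⊢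
    rw [h1, Real.mul_rpow hR.le (by linarith), mul_comm (2 ^ _ : ℝ), mul_assoc]
    gcongr
    calc w ^ (-(n + η)) = (2 : ℝ) ^ (n + η) * (2 * w) ^ (-(n + η)) := by
          rw [Real.mul_rpow (x := 2) (by norm_num) (by linarith), ← mul_assoc,
            ← Real.rpow_add (by norm_num)]
          simp
      _ ≤ _ := by
          gcongr ?_ * ?_
          exact Real.rpow_le_rpow_of_nonpos (by linarith) (by linarith)
            (by have : (0 : ℝ) ≤ n := by positivity
                linarith)
  calc ∫⁻ x in {x | R < ‖x - x₀‖}, ENNReal.ofReal (‖x - x₀‖ ^ (-(n + η)))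
      ≤ ∫⁻ x in {x | R < ‖x - x₀‖}, ENNReal.ofReal (2 ^ (n + η) * R ^ (-(n + η))) *
          ENNReal.ofReal ((1 + ‖R⁻¹ • (x - x₀)‖) ^ (-(n + η))) :=
        setLIntegral_mono' (measurableSet_lt (by fun_prop) (by fun_prop)) key
    _ ≤ ∫⁻ x, ENNReal.ofReal (2 ^ (n + η) * R ^ (-(n + η))) *
          ENNReal.ofReal ((1 + ‖R⁻¹ • (x - x₀)‖) ^ (-(n + η))) := setLIntegral_le_lintegral _ _
    _ = ENNReal.ofReal (2 ^ (n + η) * R ^ (-(n + η))) * (ENNReal.ofReal (R ^ n) * I) := by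
        rw [lintegral_const_mul _ (by fun_prop), lintegral_sub_right_eq_self
          (fun x => ENNReal.ofReal ((1 + ‖R⁻¹ • x‖) ^ (-(n + η)))) x₀,
          lintegral_inv_smul (fun x => ENNReal.ofReal ((1 + ‖x‖) ^ (-(n + η)))) hR]
    _ ≤ _ := by
        nth_rewrite 1 [← ENNReal.ofReal_toReal hI.ne]
        rw [← ENNReal.ofReal_mul (by positivity),
          ← ENNReal.ofReal_mul (by positivity)]
        apply ENNReal.ofReal_le_ofReal
        have : R ^ (-(n + η)) * R ^ n = R ^ (-η) := by
          rw [← Real.rpow_natCast R n, ← Real.rpow_add hR]; congr 1; ring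
        calc 2 ^ (n + η) * R ^ (-(n + η)) * (R ^ n * I.toReal)
            = 2 ^ (n + η) * I.toReal * (R ^ (-(n + η)) * R ^ n) := by ring
          _ ≤ _ := by rw [this]; gcongr ?_ * _; gcongr; linarith

theorem cube_eq_preimage (z : EuclideanSpace ℝ (Fin n)) (ℓ : ℝ) :
    cube z ℓ = (WithLp.ofLp : EuclideanSpace ℝ (Fin n) → Fin n → ℝ) ⁻¹'
      Icc (fun i => z i - ℓ / 2) (fun i => z i + ℓ / 2) := by
  ext x
  simp only [cube, Set.mem_ofPred_eq, Set.mem_preimage, Set.mem_Icc, Pi.le_def, abs_le,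
    ← forall_and]
  refine forall_congr' fun i => ?_
  constructor <;> rintro ⟨h1, h2⟩ <;> constructor <;> linarith

theorem measurableSet_cube (z : EuclideanSpace ℝ (Fin n)) (ℓ : ℝ) : MeasurableSet (cube z ℓ) := by
  rw [cube_eq_preimage]
  exact (PiLp.volume_preserving_ofLp (Fin n)).measurable measurableSet_Icc

theorem volume_cube (z : EuclideanSpace ℝ (Fin n)) {ℓ : ℝ} (hℓ : 0 ≤ ℓ) :
    volume (cube z ℓ) = ENNReal.ofReal (ℓ ^ n) := by
  rw [cube_eq_preimage, (PiLp.volume_preserving_ofLp (Fin n)).measure_preimage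
    measurableSet_Icc.nullMeasurableSet, Real.volume_Icc_pi]
  simp [ENNReal.ofReal_pow hℓ]

theorem abs_apply_le_norm (x : EuclideanSpace ℝ (Fin n)) (i : Fin n) : |x i| ≤ ‖x‖ := by
  simpa using PiLp.norm_apply_le x i

theorem norm_le_sqrt_mul {x : EuclideanSpace ℝ (Fin n)} {r : ℝ} (hr : 0 ≤ r)
    (h : ∀ i, |x i| ≤ r) : ‖x‖ ≤ √n * r := by
  rw [EuclideanSpace.norm_eq, ← Real.sqrt_sq hr, ← Real.sqrt_mul (by positivity)]
  apply Real.sqrt_le_sqrt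
  calc ∑ i, ‖x i‖ ^ 2 ≤ ∑ _i : Fin n, r ^ 2 := by
        gcongr with i
        exact h i
    _ = _ := by simp

end Preliminaries

/-! ### Kernels and their dilates -/

section Kernels

variable {n : ℕ} {𝕜 : Type*} [RCLike 𝕜]

/-- A standard kernel with all its bounds collected in one constant `c`, for an exponent `δ < 1`.
Unlike in `IsStandardKernel`, the kernel is measurable (not only a.e. measurable) and the
integrals are lower Lebesgue integrals, so that no integrability is implicit. -/
structure IsRegularKernel (ψ : EuclideanSpace ℝ (Fin n) → 𝕜) (c δ : ℝ) : Prop where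
  measurable : Measurable ψ
  const_pos : 0 < c
  exponent_pos : 0 < δ
  exponent_lt_one : δ < 1
  size : ∀ x, ‖ψ x‖ ≤ c * (1 + ‖x‖) ^ (-(n + δ))
  lintegral_le : ∫⁻ x, ‖ψ x‖ₑ ≤ ENNReal.ofReal c
  modulus : ∀ h, ∫⁻ x, ‖ψ (x + h) - ψ x‖ₑ ≤ ENNReal.ofReal (c * ‖h‖ ^ δ)
  integral_eq_zero : ∫ x, ψ x = 0

/-- The convolution `f * ψ_t (y)`. -/
noncomputable def dilConv (ψ f : EuclideanSpace ℝ (Fin n) → 𝕜) (t : ℝ)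
    (y : EuclideanSpace ℝ (Fin n)) : 𝕜 :=
  (f ⋆[ContinuousLinearMap.mul 𝕜 𝕜, volume] dilate ψ t) y

/-- The convolution `|f| * |ψ_t| (y)`, with values in `[0, ∞]`. -/
noncomputable def absConv (ψ f : EuclideanSpace ℝ (Fin n) → 𝕜) (t : ℝ)
    (y : EuclideanSpace ℝ (Fin n)) : ℝ≥0∞ :=
  ∫⁻ z, ‖f z‖ₑ * ‖dilate ψ t (y - z)‖ₑ

theorem dilConv_apply (ψ f : EuclideanSpace ℝ (Fin n) → 𝕜) (t : ℝ)
    (y : EuclideanSpace ℝ (Fin n)) :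
    dilConv ψ f t y = ∫ z, f z * dilate ψ t (y - z) := rfl

theorem measurable_dilate_uncurry {ψ : EuclideanSpace ℝ (Fin n) → 𝕜} (hψ : Measurable ψ) :
    Measurable fun p : ℝ × EuclideanSpace ℝ (Fin n) => dilate ψ p.1 p.2 := by
  unfold dilate
  exact (by fun_prop : Measurable fun p : ℝ × EuclideanSpace ℝ (Fin n) => (p.1 ^ n)⁻¹).smul
    (hψ.comp (by fun_prop))

theorem measurable_dilate {ψ : EuclideanSpace ℝ (Fin n) → 𝕜} (hψ : Measurable ψ) (t : ℝ) :
    Measurable (dilate ψ t) :=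
  (measurable_dilate_uncurry hψ).comp (by fun_prop : Measurable fun x => (t, x))

theorem measurable_dilConv {ψ f : EuclideanSpace ℝ (Fin n) → 𝕜} (hψ : Measurable ψ)
    (hf : Measurable f) :
    Measurable fun p : EuclideanSpace ℝ (Fin n) × ℝ => dilConv ψ f p.2 p.1 := by
  simp_rw [dilConv_apply]
  have : Measurable fun q : (EuclideanSpace ℝ (Fin n) × ℝ) × EuclideanSpace ℝ (Fin n) =>
      f q.2 * dilate ψ q.1.2 (q.1.1 - q.2) :=
    (hf.comp measurable_snd).mul ((measurable_dilate_uncurry hψ).comp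
      (by fun_prop : Measurable
        fun q : (EuclideanSpace ℝ (Fin n) × ℝ) × EuclideanSpace ℝ (Fin n) => (q.1.2, q.1.1 - q.2)))
  exact this.stronglyMeasurable.integral_prod_right.measurable

theorem measurable_absConv {ψ f : EuclideanSpace ℝ (Fin n) → 𝕜} (hψ : Measurable ψ)
    (hf : Measurable f) :
    Measurable fun p : EuclideanSpace ℝ (Fin n) × ℝ => absConv ψ f p.2 p.1 := by
  unfold absConv
  have : Measurable fun q : (EuclideanSpace ℝ (Fin n) × ℝ) × EuclideanSpace ℝ (Fin n) =>
      ‖f q.2‖ₑ * ‖dilate ψ q.1.2 (q.1.1 - q.2)‖ₑ :=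
    (hf.comp measurable_snd).enorm.mul ((measurable_dilate_uncurry hψ).comp
      (by fun_prop : Measurable
        fun q : (EuclideanSpace ℝ (Fin n) × ℝ) × EuclideanSpace ℝ (Fin n) =>
          (q.1.2, q.1.1 - q.2))).enorm
  exact this.lintegral_prod_right'

theorem enorm_dilConv_le (ψ f : EuclideanSpace ℝ (Fin n) → 𝕜) (t : ℝ)
    (y : EuclideanSpace ℝ (Fin n)) : ‖dilConv ψ f t y‖ₑ ≤ absConv ψ f t y := by
  rw [dilConv_apply]
  refine (enorm_integral_le_lintegral_enorm _).trans (le_of_eq ?_)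
  simp [absConv, enorm_mul]

theorem lintegral_dilate (ψ : EuclideanSpace ℝ (Fin n) → 𝕜) {t : ℝ} (ht : 0 < t)
    (h : EuclideanSpace ℝ (Fin n)) :
    ∫⁻ x, ‖dilate ψ t (x + h) - dilate ψ t x‖ₑ = ∫⁻ x, ‖ψ (x + t⁻¹ • h) - ψ x‖ₑ := by
  have : ∀ x, ‖dilate ψ t (x + h) - dilate ψ t x‖ₑ =
      ENNReal.ofReal ((t ^ n)⁻¹) * ‖ψ (t⁻¹ • x + t⁻¹ • h) - ψ (t⁻¹ • x)‖ₑ := fun x => by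
    rw [dilate, dilate, ← smul_sub, enorm_smul, smul_add,
      Real.enorm_eq_ofReal (by positivity)]
  simp_rw [this]
  rw [lintegral_const_mul' _ _ ENNReal.ofReal_ne_top,
    lintegral_inv_smul (fun x => ‖ψ (x + t⁻¹ • h) - ψ x‖ₑ) ht, ← mul_assoc,
    ← ENNReal.ofReal_mul (by positivity), inv_mul_cancel₀ (by positivity)]
  simp

theorem lintegral_enorm_dilate (ψ : EuclideanSpace ℝ (Fin n) → 𝕜) {t : ℝ} (ht : 0 < t) :
    ∫⁻ x, ‖dilate ψ t x‖ₑ = ∫⁻ x, ‖ψ x‖ₑ := by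
  have : ∀ x, ‖dilate ψ t x‖ₑ = ENNReal.ofReal ((t ^ n)⁻¹) * ‖ψ (t⁻¹ • x)‖ₑ := fun x => by
    rw [dilate, enorm_smul, Real.enorm_eq_ofReal (by positivity)]
  simp_rw [this]
  rw [lintegral_const_mul' _ _ ENNReal.ofReal_ne_top,
    lintegral_inv_smul (fun x => ‖ψ x‖ₑ) ht, ← mul_assoc,
    ← ENNReal.ofReal_mul (by positivity), inv_mul_cancel₀ (by positivity)]
  simp

namespace IsRegularKernel

variable {ψ : EuclideanSpace ℝ (Fin n) → 𝕜} {c δ : ℝ} (hψ : IsRegularKernel ψ c δ)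
include hψ

theorem integrable : Integrable ψ :=
  ⟨hψ.measurable.aestronglyMeasurable, hψ.lintegral_le.trans_lt ENNReal.ofReal_lt_top⟩

theorem norm_dilate_le {t : ℝ} (ht : 0 < t) (x : EuclideanSpace ℝ (Fin n)) :
    ‖dilate ψ t x‖ ≤ c * (t ^ n)⁻¹ := by
  rw [dilate, norm_smul, Real.norm_of_nonneg (by positivity), mul_comm]
  gcongr
  refine (hψ.size _).trans (mul_le_of_le_one_right hψ.const_pos.le ?_)
  have := hψ.exponent_pos
  exact Real.rpow_le_one_of_one_le_of_nonpos (by linarith [norm_nonneg (t⁻¹ • x)])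
    (by have : (0 : ℝ) ≤ n := by positivity
        linarith)

theorem norm_dilate_le_of_le_norm {t r : ℝ} (ht : 0 < t) (hr : 0 < r)
    {x : EuclideanSpace ℝ (Fin n)} (hx : r ≤ ‖x‖) :
    ‖dilate ψ t x‖ ≤ c * t ^ δ * r ^ (-(n + δ)) := by
  rw [dilate, norm_smul, Real.norm_of_nonneg (by positivity)]
  have := hψ.exponent_pos
  have hc := hψ.const_pos
  calc (t ^ n)⁻¹ * ‖ψ (t⁻¹ • x)‖ ≤ (t ^ n)⁻¹ * (c * (t⁻¹ * r) ^ (-(n + δ))) := by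
        gcongr
        refine (hψ.size _).trans ?_
        gcongr ?_ * ?_
        refine Real.rpow_le_rpow_of_nonpos (by positivity) ?_
          (by have : (0 : ℝ) ≤ n := by positivity
              linarith)
        rw [norm_smul, Real.norm_of_nonneg (by positivity)]
        have : t⁻¹ * r ≤ t⁻¹ * ‖x‖ := by gcongr
        linarith
    _ = _ := by
        rw [Real.mul_rpow (by positivity) hr.le, Real.inv_rpow ht.le, Real.rpow_neg ht.le, inv_inv,
          Real.rpow_add ht, Real.rpow_natCast]
        field_simp

theorem lintegral_dilate_le {t : ℝ} (ht : 0 < t) :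
    ∫⁻ x, ‖dilate ψ t x‖ₑ ≤ ENNReal.ofReal c := by
  rw [lintegral_enorm_dilate ψ ht]; exact hψ.lintegral_le

theorem modulus_dilate {t : ℝ} (ht : 0 < t) (h : EuclideanSpace ℝ (Fin n)) :
    ∫⁻ x, ‖dilate ψ t (x + h) - dilate ψ t x‖ₑ ≤ ENNReal.ofReal (c * (‖h‖ / t) ^ δ) := by
  rw [lintegral_dilate ψ ht]
  refine (hψ.modulus _).trans (le_of_eq ?_)
  rw [norm_smul, Real.norm_of_nonneg (by positivity), inv_mul_eq_div]

theorem absConv_le {t : ℝ} (ht : 0 < t) (f : EuclideanSpace ℝ (Fin n) → 𝕜)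
    (y : EuclideanSpace ℝ (Fin n)) :
    absConv ψ f t y ≤ ENNReal.ofReal (c * (t ^ n)⁻¹) * ∫⁻ z, ‖f z‖ₑ := by
  rw [← lintegral_const_mul' _ _ ENNReal.ofReal_ne_top]
  refine lintegral_mono fun z => ?_
  rw [mul_comm]
  gcongr
  rw [← ofReal_norm]
  exact ENNReal.ofReal_le_ofReal (hψ.norm_dilate_le ht _)

theorem lintegral_absConv_le {t : ℝ} (ht : 0 < t) {f : EuclideanSpace ℝ (Fin n) → 𝕜}
    (hf : Measurable f) : ∫⁻ y, absConv ψ f t y ≤ ENNReal.ofReal c * ∫⁻ z, ‖f z‖ₑ := by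
  unfold absConv
  have hm := measurable_dilate hψ.measurable t
  rw [lintegral_lintegral_swap
    ((by fun_prop : Measurable fun p : EuclideanSpace ℝ (Fin n) × EuclideanSpace ℝ (Fin n) =>
      ‖f p.2‖ₑ * ‖dilate ψ t (p.1 - p.2)‖ₑ)).aemeasurable,
    ← lintegral_const_mul' _ _ ENNReal.ofReal_ne_top]
  refine lintegral_mono fun z => ?_
  simp only
  rw [lintegral_const_mul' _ _ enorm_ne_top, mul_comm,
    lintegral_sub_right_eq_self (fun y => ‖dilate ψ t y‖ₑ) z]
  gcongr
  exact hψ.lintegral_dilate_le ht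

theorem lintegral_absConv_sq_le {t : ℝ} (ht : 0 < t) {f : EuclideanSpace ℝ (Fin n) → 𝕜}
    (hf : Measurable f) :
    ∫⁻ y, absConv ψ f t y ^ 2 ≤ ENNReal.ofReal (c ^ 2 * (t ^ n)⁻¹) * (∫⁻ z, ‖f z‖ₑ) ^ 2 := by
  have hc := hψ.const_pos
  calc ∫⁻ y, absConv ψ f t y ^ 2
      ≤ ∫⁻ y, (ENNReal.ofReal (c * (t ^ n)⁻¹) * ∫⁻ z, ‖f z‖ₑ) * absConv ψ f t y := by
        refine lintegral_mono fun y => ?_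
        rw [sq]
        gcongr
        exact hψ.absConv_le ht f y
    _ = (ENNReal.ofReal (c * (t ^ n)⁻¹) * ∫⁻ z, ‖f z‖ₑ) * ∫⁻ y, absConv ψ f t y :=
        lintegral_const_mul _ ((measurable_absConv hψ.measurable hf).comp
          (by fun_prop : Measurable fun y => (y, t)))
    _ ≤ (ENNReal.ofReal (c * (t ^ n)⁻¹) * ∫⁻ z, ‖f z‖ₑ) *
          (ENNReal.ofReal c * ∫⁻ z, ‖f z‖ₑ) := by
        gcongr
        exact hψ.lintegral_absConv_le ht hf
    _ = _ := by
        rw [show c ^ 2 * (t ^ n)⁻¹ = (c * (t ^ n)⁻¹) * c by ring,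
          ENNReal.ofReal_mul (p := c * _) (by positivity)]
        ring

theorem integrable_mul_dilate {t : ℝ} (ht : 0 < t) {f : EuclideanSpace ℝ (Fin n) → 𝕜}
    (hf : Integrable f) (y : EuclideanSpace ℝ (Fin n)) :
    Integrable fun z => f z * dilate ψ t (y - z) :=
  hf.mul_bdd ((measurable_dilate hψ.measurable t).comp (by fun_prop)).aestronglyMeasurable
    (ae_of_all _ fun z => hψ.norm_dilate_le ht (y - z))

/-- If the second integral diverges the bound is trivial; otherwise both convolutions converge. -/
theorem enorm_dilConv_add_le {t : ℝ} (ht : 0 < t) {f g : EuclideanSpace ℝ (Fin n) → 𝕜}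
    (hf : Integrable f) (hg : Measurable g) (y : EuclideanSpace ℝ (Fin n)) :
    ‖dilConv ψ (f + g) t y‖ₑ ≤ ‖dilConv ψ f t y‖ₑ + absConv ψ g t y := by
  by_cases hfin : absConv ψ g t y = ∞
  · simp [hfin]
  have hgi : Integrable fun z => g z * dilate ψ t (y - z) := by
    refine ⟨(hg.mul ((measurable_dilate hψ.measurable t).comp
      (by fun_prop))).aestronglyMeasurable, ?_⟩
    simpa [HasFiniteIntegral, enorm_mul, absConv] using lt_top_iff_ne_top.2 hfin
  have : dilConv ψ (f + g) t y = dilConv ψ f t y + dilConv ψ g t y := by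
    simp only [dilConv_apply, Pi.add_apply, add_mul]
    exact integral_add (hψ.integrable_mul_dilate ht hf y) hgi
  rw [this]
  exact (enorm_add_le _ _).trans (by gcongr; exact enorm_dilConv_le ψ g t y)

end IsRegularKernel

/-! ### The square of the square function as a weighted integral -/

/-- The square `∬ Φ((x - y) / (t α)) F(y, t)² dy dt / t^(n+1)` of the square function with
`|f * ψ_t (y)|` replaced by an arbitrary `F ≥ 0`. -/
noncomputable def squareInt (Φ : 𝓢(EuclideanSpace ℝ (Fin n), ℝ)) (α : ℝ)
    (F : EuclideanSpace ℝ (Fin n) × ℝ → ℝ≥0∞) (x : EuclideanSpace ℝ (Fin n)) : ℝ≥0∞ :=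
  ∫⁻ p : EuclideanSpace ℝ (Fin n) × ℝ in univ ×ˢ Ioi (0 : ℝ),
    ENNReal.ofReal (Φ ((p.2 * α)⁻¹ • (x - p.1))) * F p ^ 2 / ENNReal.ofReal (p.2 ^ (n + 1))

theorem smoothSquareFunction_sq (Φ : 𝓢(EuclideanSpace ℝ (Fin n), ℝ)) (α : ℝ)
    (ψ f : EuclideanSpace ℝ (Fin n) → 𝕜) (x : EuclideanSpace ℝ (Fin n)) :
    smoothSquareFunction Φ α ψ f x ^ 2 = squareInt Φ α (fun p => ‖dilConv ψ f p.2 p.1‖ₑ) x := by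
  rw [smoothSquareFunction, ← ENNReal.rpow_natCast, ← ENNReal.rpow_mul]
  rw [show (1 / 2 : ℝ) * ((2 : ℕ) : ℝ) = 1 by norm_num, ENNReal.rpow_one]
  rfl

theorem setLIntegral_univ_prod_Ioi {G : EuclideanSpace ℝ (Fin n) × ℝ → ℝ≥0∞} (hG : Measurable G) :
    ∫⁻ p in univ ×ˢ Ioi (0 : ℝ), G p = ∫⁻ t in Ioi (0 : ℝ), ∫⁻ y, G (y, t) := by
  rw [Measure.volume_eq_prod, ← Measure.prod_restrict, Measure.restrict_univ,
    lintegral_prod_symm _ hG.aemeasurable]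

theorem measurable_cutoff (Φ : 𝓢(EuclideanSpace ℝ (Fin n), ℝ)) (α : ℝ) :
    Measurable fun q : EuclideanSpace ℝ (Fin n) × (EuclideanSpace ℝ (Fin n) × ℝ) =>
      ENNReal.ofReal (Φ ((q.2.2 * α)⁻¹ • (q.1 - q.2.1))) :=
  ENNReal.measurable_ofReal.comp (Φ.continuous.measurable.comp (by fun_prop))

theorem measurable_squareInt_integrand (Φ : 𝓢(EuclideanSpace ℝ (Fin n), ℝ)) (α : ℝ)
    {F : EuclideanSpace ℝ (Fin n) × ℝ → ℝ≥0∞} (hF : Measurable F) :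
    Measurable fun q : EuclideanSpace ℝ (Fin n) × (EuclideanSpace ℝ (Fin n) × ℝ) =>
      ENNReal.ofReal (Φ ((q.2.2 * α)⁻¹ • (q.1 - q.2.1))) * F q.2 ^ 2 /
        ENNReal.ofReal (q.2.2 ^ (n + 1)) := by
  have := measurable_cutoff Φ α
  fun_prop

theorem measurable_squareInt (Φ : 𝓢(EuclideanSpace ℝ (Fin n), ℝ)) (α : ℝ)
    {F : EuclideanSpace ℝ (Fin n) × ℝ → ℝ≥0∞} (hF : Measurable F) :
    Measurable (squareInt Φ α F) :=
  (measurable_squareInt_integrand Φ α hF).lintegral_prod_right'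

theorem squareInt_mono (Φ : 𝓢(EuclideanSpace ℝ (Fin n), ℝ)) (α : ℝ)
    {F G : EuclideanSpace ℝ (Fin n) × ℝ → ℝ≥0∞} (h : ∀ p, 0 < p.2 → F p ≤ G p)
    (x : EuclideanSpace ℝ (Fin n)) : squareInt Φ α F x ≤ squareInt Φ α G x := by
  refine setLIntegral_mono' (MeasurableSet.univ.prod measurableSet_Ioi) fun p hp => ?_
  have := h p hp.2
  gcongr

theorem ENNReal.add_sq_le (a b : ℝ≥0∞) : (a + b) ^ 2 ≤ 2 * a ^ 2 + 2 * b ^ 2 := by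
  have := ENNReal.rpow_add_le_mul_rpow_add_rpow a b (p := 2) (by norm_num)
  norm_num at this
  rwa [mul_add] at this

theorem squareInt_add_le (Φ : 𝓢(EuclideanSpace ℝ (Fin n), ℝ)) (α : ℝ)
    {F : EuclideanSpace ℝ (Fin n) × ℝ → ℝ≥0∞} (hF : Measurable F)
    (G : EuclideanSpace ℝ (Fin n) × ℝ → ℝ≥0∞)
    (x : EuclideanSpace ℝ (Fin n)) :
    squareInt Φ α (fun p => F p + G p) x ≤ 2 * squareInt Φ α F x + 2 * squareInt Φ α G x := by
  have hK : Measurable fun p : EuclideanSpace ℝ (Fin n) × ℝ =>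
      ENNReal.ofReal (Φ ((p.2 * α)⁻¹ • (x - p.1))) :=
    (measurable_cutoff Φ α).comp (measurable_prodMk_left (x := x))
  have hm : Measurable fun p : EuclideanSpace ℝ (Fin n) × ℝ =>
      ENNReal.ofReal (Φ ((p.2 * α)⁻¹ • (x - p.1))) * F p ^ 2 / ENNReal.ofReal (p.2 ^ (n + 1)) :=
    (hK.mul (hF.pow_const 2)).div (by fun_prop)
  have h2 : (2 : ℝ≥0∞) ≠ ∞ := by norm_num
  unfold squareInt
  rw [← lintegral_const_mul' 2 _ h2, ← lintegral_const_mul' 2 _ h2,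
    ← lintegral_add_left (hm.const_mul 2)]
  refine lintegral_mono fun p => ?_
  calc _ ≤ ENNReal.ofReal (Φ ((p.2 * α)⁻¹ • (x - p.1))) * (2 * F p ^ 2 + 2 * G p ^ 2) /
      ENNReal.ofReal (p.2 ^ (n + 1)) := by
        gcongr
        exact ENNReal.add_sq_le _ _
    _ = _ := by
        simp only [div_eq_mul_inv]
        ring

theorem lintegral_mul_lintegral_mul {X Y : Type*} [MeasurableSpace X] [MeasurableSpace Y]
    {μ : Measure X} {ν : Measure Y} [SFinite μ] [SFinite ν] {w : X → ℝ≥0∞} (hw : Measurable w)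
    {K : X → Y → ℝ≥0∞} (hK : Measurable fun q : X × Y => K q.1 q.2) {H : Y → ℝ≥0∞}
    (hH : Measurable H) :
    ∫⁻ x, w x * ∫⁻ y, K x y * H y ∂ν ∂μ = ∫⁻ y, (∫⁻ x, w x * K x y ∂μ) * H y ∂ν := by
  have hKx : ∀ x, Measurable (K x) := fun x => hK.comp measurable_prodMk_left
  have hKy : ∀ y, Measurable fun x => K x y := fun y => hK.comp measurable_prodMk_right
  calc ∫⁻ x, w x * ∫⁻ y, K x y * H y ∂ν ∂μ
      = ∫⁻ x, ∫⁻ y, w x * (K x y * H y) ∂ν ∂μ :=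
        lintegral_congr fun x => (lintegral_const_mul _ ((hKx x).mul hH)).symm
    _ = ∫⁻ y, ∫⁻ x, w x * (K x y * H y) ∂μ ∂ν := by
        refine lintegral_lintegral_swap (Measurable.aemeasurable ?_)
        exact (hw.comp measurable_fst).mul (hK.mul (hH.comp measurable_snd))
    _ = _ := by
        refine lintegral_congr fun y => ?_
        simp_rw [← mul_assoc]
        exact lintegral_mul_const _ (hw.mul (hKy y))

/-- Integrating the square function against a weight: Fubini's theorem. -/
theorem lintegral_mul_squareInt (Φ : 𝓢(EuclideanSpace ℝ (Fin n), ℝ)) (α : ℝ)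
    {F : EuclideanSpace ℝ (Fin n) × ℝ → ℝ≥0∞} (hF : Measurable F)
    {w : EuclideanSpace ℝ (Fin n) → ℝ≥0∞} (hw : Measurable w) :
    ∫⁻ x, w x * squareInt Φ α F x = ∫⁻ t in Ioi (0 : ℝ), ∫⁻ y,
      (∫⁻ x, w x * ENNReal.ofReal (Φ ((t * α)⁻¹ • (x - y)))) *
        (F (y, t) ^ 2 / ENNReal.ofReal (t ^ (n + 1))) := by
  have hK := measurable_cutoff Φ α
  have hH : Measurable fun p : EuclideanSpace ℝ (Fin n) × ℝ =>
      F p ^ 2 / ENNReal.ofReal (p.2 ^ (n + 1)) := by fun_prop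
  unfold squareInt
  simp_rw [mul_div_assoc]
  rw [lintegral_mul_lintegral_mul hw hK hH]
  refine setLIntegral_univ_prod_Ioi (Measurable.mul ?_ hH)
  exact ((hw.comp measurable_fst).mul hK).lintegral_prod_left'

namespace IsCutoff

variable {Φ : 𝓢(EuclideanSpace ℝ (Fin n), ℝ)} (hΦ : IsCutoff Φ)
include hΦ

theorem le_one (x : EuclideanSpace ℝ (Fin n)) : Φ x ≤ 1 :=
  (hΦ x).2.trans (indicator_le_self' (fun _ _ => zero_le_one) x)

theorem nonneg (x : EuclideanSpace ℝ (Fin n)) : 0 ≤ Φ x :=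
  (indicator_nonneg (fun _ _ => zero_le_one) x).trans (hΦ x).1

theorem eq_zero {x : EuclideanSpace ℝ (Fin n)} (hx : 2 ≤ ‖x‖) : Φ x = 0 := by
  refine le_antisymm ((hΦ x).2.trans (le_of_eq ?_)) (hΦ.nonneg x)
  exact indicator_of_notMem (by simpa using hx) _

theorem ofReal_le_indicator {r : ℝ} (hr : 0 < r) (x y : EuclideanSpace ℝ (Fin n)) :
    ENNReal.ofReal (Φ (r⁻¹ • (x - y))) ≤ (Metric.ball y (2 * r)).indicator 1 x := by
  by_cases hx : x ∈ Metric.ball y (2 * r)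
  · rw [indicator_of_mem hx]
    exact ENNReal.ofReal_le_one.2 (hΦ.le_one _)
  · rw [hΦ.eq_zero]
    · simp
    · rw [norm_smul, Real.norm_of_nonneg (by positivity), inv_mul_eq_div, le_div_iff₀ hr,
        ← dist_eq_norm]
      simpa using hx

theorem lintegral_le {r : ℝ} (hr : 0 < r) (y : EuclideanSpace ℝ (Fin n)) :
    ∫⁻ x, ENNReal.ofReal (Φ (r⁻¹ • (x - y))) ≤
      ENNReal.ofReal ((2 * r) ^ n) * volume (Metric.ball (0 : EuclideanSpace ℝ (Fin n)) 1) := by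
  rw [← volume_ball_eq y (by positivity)]
  refine (lintegral_mono fun x => hΦ.ofReal_le_indicator hr x y).trans (le_of_eq ?_)
  exact lintegral_indicator_one Metric.isOpen_ball.measurableSet

theorem lintegral_le' {r : ℝ} (hr : 0 < r) (x : EuclideanSpace ℝ (Fin n)) :
    ∫⁻ y, ENNReal.ofReal (Φ (r⁻¹ • (x - y))) ≤
      ENNReal.ofReal ((2 * r) ^ n) * volume (Metric.ball (0 : EuclideanSpace ℝ (Fin n)) 1) := by
  rw [← volume_ball_eq x (by positivity)]
  rw [← lintegral_indicator_one Metric.isOpen_ball.measurableSet]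
  refine lintegral_mono fun y => (hΦ.ofReal_le_indicator hr x y).trans (le_of_eq ?_)
  simp [indicator, dist_comm]

end IsCutoff

end Kernels

/-! ### The `L²` bound -/

section Fourier

open FourierTransform
open scoped RealInnerProductSpace

theorem eLpNorm_two_sq {X E : Type*} [MeasurableSpace X] [NormedAddCommGroup E] (μ : Measure X)
    (g : X → E) : eLpNorm g 2 μ ^ 2 = ∫⁻ x, ‖g x‖ₑ ^ 2 ∂μ := by
  rw [eLpNorm_eq_lintegral_rpow_enorm_toReal (by norm_num) (by norm_num),
    ← ENNReal.rpow_natCast, ← ENNReal.rpow_mul]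
  simp

/-- Plancherel's theorem for the Fourier integral of a function in `L¹ ∩ L²`: it agrees almost
everywhere with the Fourier transform on `L²`, as both have the same pairing with test functions. -/
theorem lintegral_enorm_fourier_sq {E : Type*} [NormedAddCommGroup E] [InnerProductSpace ℝ E]
    [FiniteDimensional ℝ E] [MeasurableSpace E] [BorelSpace E] {f : E → ℂ}
    (hf : Integrable f volume) (hf2 : MemLp f 2 volume) :
    ∫⁻ ξ, ‖𝓕 f ξ‖ₑ ^ 2 = ∫⁻ x, ‖f x‖ₑ ^ 2 := by
  have hae : ∀ᵐ ξ, (𝓕 (hf2.toLp f) : Lp (α := E) ℂ 2 volume) ξ = 𝓕 f ξ := by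
    refine ae_eq_of_integral_contDiff_smul_eq
      ((Lp.memLp _).locallyIntegrable (by norm_num)) ?_ fun g hg hgc => ?_
    · exact (VectorFourier.fourierIntegral_continuous Real.continuous_fourierChar
        (L := innerₗ E) continuous_inner hf).locallyIntegrable
    have hgc' : HasCompactSupport (fun x => (g x : ℂ)) := hgc.comp_left (g := Complex.ofReal) rfl
    have hg' : ContDiff ℝ ((⊤ : ℕ∞) : WithTop ℕ∞) (fun x => (g x : ℂ)) := Complex.ofRealCLM.contDiff.comp hg
    set φ := hgc'.toSchwartzMap hg' with hφ
    have hφg : ∀ x, φ x = (g x : ℂ) := fun x => rfl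
    have h1 := congrArg (fun T => T φ) (Lp.fourier_toTemperedDistribution_eq (hf2.toLp f))
    simp only [TemperedDistribution.fourier_apply, Lp.toTemperedDistribution_apply] at h1
    have h2 : ∫ x, g x • (𝓕 (hf2.toLp f) : Lp (α := E) ℂ 2 volume) x =
        ∫ x, φ x • (𝓕 (hf2.toLp f) : Lp (α := E) ℂ 2 volume) x := by
      simp [hφg]
    rw [h2, ← h1]
    have h3 : ∫ x, (𝓕 φ) x • (hf2.toLp f) x = ∫ x, (𝓕 φ) x • f x := by
      refine integral_congr_ae ?_
      filter_upwards [hf2.coeFn_toLp] with x hx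
      rw [hx]
    rw [h3]
    have h4 : ∫ ξ, 𝓕 (φ : E → ℂ) ξ • f ξ = ∫ x, φ x • 𝓕 f x := by
      simpa using! VectorFourier.integral_fourierIntegral_smul_eq_flip (L := innerₗ E)
        Real.continuous_fourierChar continuous_inner (φ.integrable (μ := volume)) hf
    rw [SchwartzMap.fourier_coe, h4]
    simp [hφg]
  have hn := Lp.norm_fourier_eq (hf2.toLp f)
  have hn' : eLpNorm (𝓕 (hf2.toLp f) : Lp (α := E) ℂ 2 volume) 2 volume = eLpNorm f 2 volume := by
    rw [← eLpNorm_congr_ae hf2.coeFn_toLp]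
    rw [Lp.norm_def, Lp.norm_def] at hn
    exact (ENNReal.toReal_eq_toReal_iff' (Lp.memLp _).eLpNorm_ne_top
      (Lp.memLp _).eLpNorm_ne_top).1 hn
  rw [eLpNorm_congr_ae hae] at hn'
  rw [← eLpNorm_two_sq, ← eLpNorm_two_sq]
  exact congrArg (· ^ 2) hn'

variable {n : ℕ}

theorem norm_fourierChar_sub_one_le (θ : ℝ) {η : ℝ} (hη : 0 < η) (hη1 : η ≤ 1) :
    ‖((Real.fourierChar θ : Circle) : ℂ) - 1‖ ≤ 2 * Real.pi * |θ| ^ η := by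
  have hpi := Real.two_le_pi
  have h0 : 0 ≤ |θ| := abs_nonneg θ
  rcases le_total |θ| 1 with h | h
  · have h1 : ‖((Real.fourierChar θ : Circle) : ℂ) - 1‖ ≤ 2 * Real.pi * |θ| := by
      have := Real.norm_exp_I_mul_ofReal_sub_one_le (x := 2 * Real.pi * θ)
      rw [Real.fourierChar_apply, mul_comm _ Complex.I]
      refine this.trans (le_of_eq ?_)
      rw [Real.norm_eq_abs, abs_mul, abs_of_pos (by positivity)]
    refine h1.trans ?_
    gcongr
    rcases h0.eq_or_lt with h' | h'
    · rw [← h']; positivity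
    · simpa using Real.rpow_le_rpow_of_exponent_ge h' h hη1
  · have h1 : ‖((Real.fourierChar θ : Circle) : ℂ) - 1‖ ≤ 2 := by
      refine (norm_sub_le _ _).trans ?_
      rw [Circle.norm_coe, norm_one]
      norm_num
    have h2 : 1 ≤ |θ| ^ η := Real.one_le_rpow h hη.le
    nlinarith

/-- Cancellation controls the low frequencies of a regular kernel. -/
theorem IsRegularKernel.exists_enorm_fourier_le {ψ : EuclideanSpace ℝ (Fin n) → ℂ} {c δ : ℝ}
    (hψ : IsRegularKernel ψ c δ) :
    ∃ A : ℝ, 0 ≤ A ∧ ∀ t, 0 < t → ∀ ξ,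
      ‖𝓕 (dilate ψ t) ξ‖ₑ ≤ ENNReal.ofReal (A * (t * ‖ξ‖) ^ (δ / 2)) := by
  have hδ := hψ.exponent_pos
  have hδ1 := hψ.exponent_lt_one
  set I := ∫⁻ x : EuclideanSpace ℝ (Fin n), ENNReal.ofReal ((1 + ‖x‖) ^ (-(n + δ / 2)))
  have hI : I < ∞ := finite_integral_one_add_norm (by simpa using hδ)
  have hmom : ∫⁻ x, ‖ψ x‖ₑ * ENNReal.ofReal (‖x‖ ^ (δ / 2)) ≤ ENNReal.ofReal c * I := by
    rw [← lintegral_const_mul' _ _ ENNReal.ofReal_ne_top]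
    refine lintegral_mono fun x => ?_
    rw [← ofReal_norm, ← ENNReal.ofReal_mul (norm_nonneg _),
      ← ENNReal.ofReal_mul hψ.const_pos.le]
    apply ENNReal.ofReal_le_ofReal
    have h1 : 0 < 1 + ‖x‖ := by positivity
    calc ‖ψ x‖ * ‖x‖ ^ (δ / 2)
        ≤ (c * (1 + ‖x‖) ^ (-(n + δ))) * (1 + ‖x‖) ^ (δ / 2) := by
          have := hψ.size x
          have := hψ.const_pos
          gcongr
          linarith
      _ = _ := by
          rw [mul_assoc, ← Real.rpow_add h1]
          congr 2
          ring
  refine ⟨2 * Real.pi * (c * I.toReal), by have := hψ.const_pos; positivity, fun t ht ξ => ?_⟩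
  have hint : Integrable (dilate ψ t) :=
    ⟨(measurable_dilate hψ.measurable t).aestronglyMeasurable,
      (hψ.lintegral_dilate_le ht).trans_lt ENNReal.ofReal_lt_top⟩
  have hz : ∫ x, dilate ψ t x = 0 := by
    simp only [dilate]
    rw [integral_smul, Measure.integral_comp_inv_smul, hψ.integral_eq_zero]
    simp
  have heq : 𝓕 (dilate ψ t) ξ =
      ∫ x, ((Real.fourierChar (-⟪x, ξ⟫) : Circle) - 1 : ℂ) * dilate ψ t x := by
    have h1 := (Real.fourierIntegral_convergent_iff ξ).2 hint
    simp only [Circle.smul_def, smul_eq_mul] at h1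
    rw [Real.fourier_eq, ← sub_zero (∫ x, _), ← hz, ← integral_sub]
    · simp only [Circle.smul_def, smul_eq_mul, sub_mul, one_mul]
    · simpa only [Circle.smul_def, smul_eq_mul] using h1
    · exact hint
  rw [heq]
  calc ‖∫ x, ((Real.fourierChar (-⟪x, ξ⟫) : Circle) - 1 : ℂ) * dilate ψ t x‖ₑ
      ≤ ∫⁻ x, ‖((Real.fourierChar (-⟪x, ξ⟫) : Circle) - 1 : ℂ) * dilate ψ t x‖ₑ :=
        enorm_integral_le_lintegral_enorm _
    _ ≤ ∫⁻ x, ENNReal.ofReal (2 * Real.pi * (t * ‖ξ‖) ^ (δ / 2) * (t ^ n)⁻¹) *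
          (‖ψ (t⁻¹ • x)‖ₑ * ENNReal.ofReal (‖t⁻¹ • x‖ ^ (δ / 2))) := by
        refine lintegral_mono fun x => ?_
        rw [← ofReal_norm, ← ofReal_norm, ← ENNReal.ofReal_mul (norm_nonneg _),
          ← ENNReal.ofReal_mul (by positivity)]
        apply ENNReal.ofReal_le_ofReal
        rw [norm_mul]
        calc _ ≤ (2 * Real.pi * (‖x‖ * ‖ξ‖) ^ (δ / 2)) * ‖dilate ψ t x‖ := by
              gcongr
              refine (norm_fourierChar_sub_one_le _ (η := δ / 2) (by positivity)
                (by linarith)).trans ?_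
              gcongr
              rw [abs_neg]
              exact abs_real_inner_le_norm x ξ
          _ = _ := by
              rw [dilate, norm_smul, norm_smul, Real.norm_of_nonneg (by positivity),
                Real.norm_of_nonneg (by positivity)]
              have : (‖x‖ * ‖ξ‖) ^ (δ / 2) = (t * ‖ξ‖) ^ (δ / 2) * (t⁻¹ * ‖x‖) ^ (δ / 2) := by
                rw [← Real.mul_rpow (by positivity) (by positivity)]
                congr 1
                field_simp
              rw [this]
              ring
    _ = ENNReal.ofReal (2 * Real.pi * (t * ‖ξ‖) ^ (δ / 2) * (t ^ n)⁻¹) *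
          (ENNReal.ofReal (t ^ n) * ∫⁻ x, ‖ψ x‖ₑ * ENNReal.ofReal (‖x‖ ^ (δ / 2))) := by
        rw [lintegral_const_mul' _ _ ENNReal.ofReal_ne_top,
          lintegral_inv_smul (fun x => ‖ψ x‖ₑ * ENNReal.ofReal (‖x‖ ^ (δ / 2))) ht]
    _ ≤ ENNReal.ofReal (2 * Real.pi * (t * ‖ξ‖) ^ (δ / 2) * (t ^ n)⁻¹) *
          (ENNReal.ofReal (t ^ n) * (ENNReal.ofReal c * ENNReal.ofReal I.toReal)) := by
        rw [ENNReal.ofReal_toReal hI.ne]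
        gcongr
    _ = _ := by
        have := hψ.const_pos
        rw [← ENNReal.ofReal_mul (by positivity), ← ENNReal.ofReal_mul (by positivity),
          ← ENNReal.ofReal_mul (by positivity)]
        congr 1
        field_simp

/-- The `L¹` modulus of continuity controls the high frequencies of a regular kernel: shifting by
half a period changes the sign of the Fourier integral. -/
theorem IsRegularKernel.enorm_fourier_le {ψ : EuclideanSpace ℝ (Fin n) → ℂ} {c δ : ℝ}
    (hψ : IsRegularKernel ψ c δ) {t : ℝ} (ht : 0 < t) {ξ : EuclideanSpace ℝ (Fin n)}
    (hξ : ξ ≠ 0) : ‖𝓕 (dilate ψ t) ξ‖ₑ ≤ ENNReal.ofReal (c * (t * ‖ξ‖) ^ (-δ)) := by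
  have hδ := hψ.exponent_pos
  have hc := hψ.const_pos
  have hint : Integrable (dilate ψ t) :=
    ⟨(measurable_dilate hψ.measurable t).aestronglyMeasurable,
      (hψ.lintegral_dilate_le ht).trans_lt ENNReal.ofReal_lt_top⟩
  have hξ' : 0 < ‖ξ‖ := norm_pos_iff.2 hξ
  rw [Real.fourier_eq, fourierIntegral_eq_half_sub_half_period_translate hξ hint]
  set h : EuclideanSpace ℝ (Fin n) := (1 / (2 * ‖ξ‖ ^ 2) : ℝ) • ξ with hh
  have hnorm : ‖h‖ = 1 / (2 * ‖ξ‖) := by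
    rw [hh, norm_smul, Real.norm_of_nonneg (by positivity)]
    field_simp
  calc _ ≤ ‖∫ v, Real.fourierChar (-⟪v, ξ⟫) • (dilate ψ t v - dilate ψ t (v + h))‖ₑ := by
        rw [enorm_smul]
        refine mul_le_of_le_one_left (by positivity) ?_
        rw [← ofReal_norm, ENNReal.ofReal_le_one]
        norm_num
    _ ≤ ∫⁻ v, ‖dilate ψ t (v + h) - dilate ψ t v‖ₑ := by
        refine (enorm_integral_le_lintegral_enorm _).trans (lintegral_mono fun v => ?_)
        rw [← ofReal_norm, ← ofReal_norm, Circle.norm_smul, norm_sub_rev]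
    _ ≤ ENNReal.ofReal (c * (‖h‖ / t) ^ δ) := hψ.modulus_dilate ht h
    _ ≤ _ := by
        apply ENNReal.ofReal_le_ofReal
        gcongr ?_ * ?_
        rw [Real.rpow_neg (by positivity), ← Real.inv_rpow (by positivity), hnorm]
        gcongr
        rw [div_div, one_div]
        refine inv_anti₀ (by positivity) ?_
        nlinarith [mul_pos hξ' ht]

/-- On the Fourier side the scale integral of the multiplier `|ψ̂(tξ)|²` converges at both ends,
uniformly in `ξ`. -/
theorem IsRegularKernel.exists_lintegral_dilConv_sq_le_complex
    {ψ : EuclideanSpace ℝ (Fin n) → ℂ} {c δ : ℝ} (hψ : IsRegularKernel ψ c δ) :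
    ∃ K : ℝ, 0 < K ∧ ∀ g : EuclideanSpace ℝ (Fin n) → ℂ, Measurable g → Integrable g →
      MemLp g 2 →
      ∫⁻ t in Ioi (0 : ℝ), ENNReal.ofReal t⁻¹ * ∫⁻ y, ‖dilConv ψ g t y‖ₑ ^ 2 ≤
        ENNReal.ofReal K * ∫⁻ x, ‖g x‖ₑ ^ 2 := by
  obtain ⟨A, hA, hlow⟩ := hψ.exists_enorm_fourier_le
  have hδ := hψ.exponent_pos
  have hc := hψ.const_pos
  refine ⟨A ^ 2 / δ + c ^ 2 / (2 * δ), by positivity, fun g hgm hg hg2 => ?_⟩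
  set m : ℝ → EuclideanSpace ℝ (Fin n) → ℝ≥0∞ := fun t ξ =>
    ENNReal.ofReal t⁻¹ * (min (ENNReal.ofReal (A * (t * ‖ξ‖) ^ (δ / 2)))
      (ENNReal.ofReal (c * (t * ‖ξ‖) ^ (-δ)))) ^ 2 with hm
  have hmm : Measurable fun p : ℝ × EuclideanSpace ℝ (Fin n) => m p.1 p.2 := by
    simp only [hm]; fun_prop
  have hFg : Measurable (𝓕 g) :=
    (VectorFourier.fourierIntegral_continuous Real.continuous_fourierChar
      (L := innerₗ (EuclideanSpace ℝ (Fin n))) continuous_inner hg).measurable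
  have hstep : ∀ t, 0 < t → ENNReal.ofReal t⁻¹ * ∫⁻ y, ‖dilConv ψ g t y‖ₑ ^ 2 ≤
      ∫⁻ ξ, m t ξ * ‖𝓕 g ξ‖ₑ ^ 2 := fun t ht => by
    have hint : Integrable (dilate ψ t) :=
      ⟨(measurable_dilate hψ.measurable t).aestronglyMeasurable,
        (hψ.lintegral_dilate_le ht).trans_lt ENNReal.ofReal_lt_top⟩
    have hcm : Measurable (dilConv ψ g t) :=
      (measurable_dilConv hψ.measurable hgm).comp (measurable_prodMk_right (y := t))
    have h1 : Integrable (dilConv ψ g t) := by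
      refine ⟨hcm.aestronglyMeasurable, ?_⟩
      refine (lintegral_mono (enorm_dilConv_le ψ g t)).trans_lt
        ((hψ.lintegral_absConv_le ht hgm).trans_lt ?_)
      exact ENNReal.mul_lt_top ENNReal.ofReal_lt_top hg.2
    have h2 : MemLp (dilConv ψ g t) 2 := by
      refine ⟨hcm.aestronglyMeasurable, ?_⟩
      have : eLpNorm (dilConv ψ g t) 2 volume ^ 2 < ∞ := by
        rw [eLpNorm_two_sq]
        refine (lintegral_mono fun y => pow_le_pow_left' (enorm_dilConv_le ψ g t y) 2).trans_lt
          ((hψ.lintegral_absConv_sq_le ht hgm).trans_lt ?_)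
        exact ENNReal.mul_lt_top ENNReal.ofReal_lt_top (ENNReal.pow_lt_top hg.2)
      exact (ENNReal.pow_lt_top_iff.1 this).resolve_right (by norm_num)
    rw [← lintegral_enorm_fourier_sq h1 h2, ← lintegral_const_mul' _ _ ENNReal.ofReal_ne_top]
    have hne : ∀ᵐ ξ : EuclideanSpace ℝ (Fin n), 𝓕 g ξ = 0 ∨ ‖𝓕 (dilate ψ t) ξ‖ₑ ≤
        min (ENNReal.ofReal (A * (t * ‖ξ‖) ^ (δ / 2))) (ENNReal.ofReal (c * (t * ‖ξ‖) ^ (-δ))) := by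
      -- Half-period translation needs `ξ ≠ 0`; the exceptional point is null unless the dimension
      -- is zero, where the low-frequency bound already gives `0`.
      rcases n with _ | n
      · refine ae_of_all _ fun ξ => Or.inr ?_
        have : ξ = 0 := Subsingleton.elim _ _
        have h0 := hlow t ht ξ
        rw [this, norm_zero, mul_zero, Real.zero_rpow (by positivity), mul_zero] at h0
        rw [this]
        simp only [ENNReal.ofReal_zero, nonpos_iff_eq_zero] at h0
        rw [h0]
        positivity
      · filter_upwards [compl_mem_ae_iff.2 (measure_singleton (0 : EuclideanSpace ℝ (Fin (n + 1))))]
          with ξ hξ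
        exact Or.inr (le_min (hlow t ht ξ) (hψ.enorm_fourier_le ht hξ))
    refine lintegral_mono_ae ?_
    filter_upwards [hne] with ξ hξ
    have hconv : 𝓕 (dilConv ψ g t) ξ = 𝓕 g ξ * 𝓕 (dilate ψ t) ξ :=
      Real.fourier_mul_convolution_eq hg hint ξ
    rw [hconv, enorm_mul]
    rcases hξ with h | h
    · simp [h]
    · simp only [hm]
      rw [mul_pow, mul_comm (‖𝓕 g ξ‖ₑ ^ 2), ← mul_assoc]
      gcongr
  have hscale : ∀ ξ : EuclideanSpace ℝ (Fin n), ξ ≠ 0 →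
      ∫⁻ t in Ioi (0 : ℝ), m t ξ ≤ ENNReal.ofReal (A ^ 2 / δ + c ^ 2 / (2 * δ)) := fun ξ hξ => by
    have hξ' : 0 < ‖ξ‖ := norm_pos_iff.2 hξ
    refine (lintegral_Ioi_le_of_le_rpow (a := δ) (b := 2 * δ) (τ := ‖ξ‖⁻¹)
      (A := A ^ 2 * ‖ξ‖ ^ δ) (B := c ^ 2 * ‖ξ‖ ^ (-(2 * δ))) hδ (by positivity) (by positivity)
      (by positivity) (by positivity) (fun t ht => ?_) (fun t ht => ?_)).trans (le_of_eq ?_)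
    · calc m t ξ ≤ ENNReal.ofReal t⁻¹ * (ENNReal.ofReal (A * (t * ‖ξ‖) ^ (δ / 2))) ^ 2 := by
            simp only [hm]; gcongr; exact min_le_left _ _
        _ = _ := by
            rw [← ENNReal.ofReal_pow (by positivity), ← ENNReal.ofReal_mul (by positivity)]
            congr 1
            rw [mul_pow, ← Real.rpow_mul_natCast (by positivity), Nat.cast_ofNat,
              div_mul_cancel₀ _ two_ne_zero, Real.mul_rpow ht.le hξ'.le, Real.rpow_sub ht,
              Real.rpow_one]
            field_simp
    · calc m t ξ ≤ ENNReal.ofReal t⁻¹ * (ENNReal.ofReal (c * (t * ‖ξ‖) ^ (-δ))) ^ 2 := by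
            simp only [hm]; gcongr; exact min_le_right _ _
        _ = _ := by
            rw [← ENNReal.ofReal_pow (by positivity), ← ENNReal.ofReal_mul (by positivity)]
            congr 1
            rw [mul_pow, ← Real.rpow_mul_natCast (by positivity), Nat.cast_ofNat,
              show -δ * 2 = -(2 * δ) by ring, Real.mul_rpow ht.le hξ'.le, Real.rpow_sub ht,
              Real.rpow_one]
            field_simp
    · congr 1
      rw [Real.inv_rpow hξ'.le, Real.inv_rpow hξ'.le, Real.rpow_neg hξ'.le]
      have := (Real.rpow_pos_of_pos hξ' δ).ne'
      have := (Real.rpow_pos_of_pos hξ' (2 * δ)).ne'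
      field_simp
  calc _ ≤ ∫⁻ t in Ioi (0 : ℝ), ∫⁻ ξ, m t ξ * ‖𝓕 g ξ‖ₑ ^ 2 :=
        setLIntegral_mono' measurableSet_Ioi fun t ht => hstep t ht
    _ = ∫⁻ ξ, ∫⁻ t in Ioi (0 : ℝ), m t ξ * ‖𝓕 g ξ‖ₑ ^ 2 := by
        refine lintegral_lintegral_swap (Measurable.aemeasurable ?_)
        exact hmm.mul ((hFg.comp measurable_snd).enorm.pow_const 2)
    _ ≤ ∫⁻ ξ, ENNReal.ofReal (A ^ 2 / δ + c ^ 2 / (2 * δ)) * ‖𝓕 g ξ‖ₑ ^ 2 := by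
        refine lintegral_mono fun ξ => ?_
        have hmξ : Measurable fun t => m t ξ := hmm.comp (measurable_prodMk_right (y := ξ))
        rw [lintegral_mul_const _ hmξ]
        by_cases hξ : ξ = 0
        · -- At the zero frequency the multiplier bound `m` vanishes, as `0 ^ (δ / 2) = 0`.
          have : ∀ t, m t ξ = 0 := fun t => by
            simp [hm, hξ, Real.zero_rpow (by positivity : δ / 2 ≠ 0)]
          simp [this]
        · gcongr
          exact hscale ξ hξ
    _ = _ := by
        rw [lintegral_const_mul _ (hFg.enorm.pow_const 2), lintegral_enorm_fourier_sq hg hg2]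

variable {𝕜 : Type*} [RCLike 𝕜]

/-- The real-linear map from `ℝ` or `ℂ` to `ℂ` is multiplicative. -/
theorem RCLike.map_complex_mul (a b : 𝕜) :
    RCLike.map 𝕜 ℂ (a * b) = RCLike.map 𝕜 ℂ a * RCLike.map 𝕜 ℂ b := by
  obtain h | h := RCLike.I_eq_zero_or_im_I_eq_one (K := 𝕜)
  · have h' : ∀ z : 𝕜, RCLike.im z = 0 := fun z => by
      have := RCLike.norm_to_complex z
      rw [← RCLike.mul_im_I_ax z, h]
      simp
    simp [h']
  · exact map_mul (RCLike.complexRingEquiv h) a b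

theorem RCLike.norm_map_complex (a : 𝕜) : ‖RCLike.map 𝕜 ℂ a‖ = ‖a‖ := RCLike.norm_to_complex a

/-- The vertical square function is bounded on `L²`. -/
theorem IsRegularKernel.exists_lintegral_dilConv_sq_le
    {ψ : EuclideanSpace ℝ (Fin n) → 𝕜} {c δ : ℝ} (hψ : IsRegularKernel ψ c δ) :
    ∃ K : ℝ, 0 < K ∧ ∀ g : EuclideanSpace ℝ (Fin n) → 𝕜, Measurable g → Integrable g →
      MemLp g 2 →
      ∫⁻ t in Ioi (0 : ℝ), ENNReal.ofReal t⁻¹ * ∫⁻ y, ‖dilConv ψ g t y‖ₑ ^ 2 ≤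
        ENNReal.ofReal K * ∫⁻ x, ‖g x‖ₑ ^ 2 := by
  set J := RCLike.map 𝕜 ℂ with hJ
  have hJn : ∀ a : 𝕜, ‖J a‖ₑ = ‖a‖ₑ := fun a => by
    rw [← ofReal_norm, RCLike.norm_map_complex, ofReal_norm]
  have hψ' : IsRegularKernel (fun x => J (ψ x)) c δ :=
    { measurable := J.continuous.measurable.comp hψ.measurable
      const_pos := hψ.const_pos
      exponent_pos := hψ.exponent_pos
      exponent_lt_one := hψ.exponent_lt_one
      size := fun x => by rw [RCLike.norm_map_complex]; exact hψ.size x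
      lintegral_le := by simp_rw [hJn]; exact hψ.lintegral_le
      modulus := fun h => by simp_rw [← map_sub, hJn]; exact hψ.modulus h
      integral_eq_zero := by
        rw [ContinuousLinearMap.integral_comp_comm J hψ.integrable, hψ.integral_eq_zero, map_zero] }
  obtain ⟨K, hK, H⟩ := hψ'.exists_lintegral_dilConv_sq_le_complex
  refine ⟨K, hK, fun g hgm hg hg2 => ?_⟩
  have h1 := H (fun x => J (g x)) (J.continuous.measurable.comp hgm) (J.integrable_comp hg)
    (J.comp_memLp' hg2)
  simp_rw [hJn] at h1
  refine le_trans (le_of_eq (setLIntegral_congr_fun measurableSet_Ioi fun t ht => ?_)) h1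
  have : ∀ y, dilConv (fun x => J (ψ x)) (fun x => J (g x)) t y = J (dilConv ψ g t y) := fun y => by
    rw [dilConv_apply, dilConv_apply,
      ← ContinuousLinearMap.integral_comp_comm J (hψ.integrable_mul_dilate ht hg y)]
    congr 1
    ext z
    rw [hJ, RCLike.map_complex_mul, dilate, dilate, map_smul]
  simp_rw [this, hJn]

end Fourier

/-! ### The Calderón–Zygmund decomposition -/

section CalderonZygmund

open Filter
open scoped Topology

variable {n : ℕ} {𝕜 : Type*} [RCLike 𝕜]

/-- The index of the half-open dyadic cube of side `L / 2 ^ k` that contains `x`. -/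
noncomputable def dyadicIndex (L : ℝ) (k : ℕ) (x : EuclideanSpace ℝ (Fin n)) : Fin n → ℤ :=
  fun i => ⌊x i * 2 ^ k / L⌋

/-- The half-open dyadic cube of side `L / 2 ^ q.1` with index `q.2`. -/
def dyadicCube (L : ℝ) (q : ℕ × (Fin n → ℤ)) : Set (EuclideanSpace ℝ (Fin n)) :=
  {x | dyadicIndex L q.1 x = q.2}

theorem dyadicIndex_eq_of_le {L : ℝ} {j k : ℕ} (hjk : j ≤ k) {x y : EuclideanSpace ℝ (Fin n)}
    (h : dyadicIndex L k x = dyadicIndex L k y) : dyadicIndex L j x = dyadicIndex L j y := by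
  have key : ∀ w : EuclideanSpace ℝ (Fin n), ∀ i,
      dyadicIndex L j w i = dyadicIndex L k w i / ((2 ^ (k - j) : ℕ) : ℤ) := fun w i => by
    rw [dyadicIndex, dyadicIndex, ← Int.floor_div_natCast]
    congr 1
    rw [← Nat.add_sub_cancel' hjk, pow_add]
    push_cast
    rw [Nat.add_sub_cancel_left]
    field_simp
  funext i
  rw [key, key, h]

theorem dyadicCube_eq_preimage {L : ℝ} (hL : 0 < L) (q : ℕ × (Fin n → ℤ)) :
    dyadicCube L q = (WithLp.ofLp : EuclideanSpace ℝ (Fin n) → Fin n → ℝ) ⁻¹'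
      (univ.pi fun i => Ico (q.2 i * (L / 2 ^ q.1)) ((q.2 i + 1) * (L / 2 ^ q.1))) := by
  ext x
  simp only [dyadicCube, dyadicIndex, Set.mem_ofPred_eq, funext_iff, Set.mem_preimage,
    Set.mem_univ_pi, Set.mem_Ico, Int.floor_eq_iff]
  refine forall_congr' fun i => ?_
  rw [le_div_iff₀ hL, div_lt_iff₀ hL, ← mul_div_assoc, ← mul_div_assoc, div_le_iff₀ (by positivity),
    lt_div_iff₀ (by positivity)]

theorem measurableSet_dyadicCube {L : ℝ} (hL : 0 < L) (q : ℕ × (Fin n → ℤ)) :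
    MeasurableSet (dyadicCube L q) := by
  rw [dyadicCube_eq_preimage hL]
  exact (PiLp.volume_preserving_ofLp (Fin n)).measurable
    (MeasurableSet.univ_pi fun _ => measurableSet_Ico)

theorem volume_dyadicCube {L : ℝ} (hL : 0 < L) (q : ℕ × (Fin n → ℤ)) :
    volume (dyadicCube L q) = ENNReal.ofReal ((L / 2 ^ q.1) ^ n) := by
  rw [dyadicCube_eq_preimage hL, (PiLp.volume_preserving_ofLp (Fin n)).measure_preimage
    (MeasurableSet.univ_pi fun _ => measurableSet_Ico).nullMeasurableSet, Real.volume_pi_Ico]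
  simp [add_mul, ENNReal.ofReal_pow (show 0 ≤ L / 2 ^ q.1 by positivity)]

theorem norm_sub_le_of_mem_dyadicCube {L : ℝ} (hL : 0 < L) {q : ℕ × (Fin n → ℤ)}
    {x y : EuclideanSpace ℝ (Fin n)} (hx : x ∈ dyadicCube L q) (hy : y ∈ dyadicCube L q) :
    ‖x - y‖ ≤ (√n + 1) * (L / 2 ^ q.1) := by
  rw [dyadicCube_eq_preimage hL] at hx hy
  refine (norm_le_sqrt_mul (r := L / 2 ^ q.1) (by positivity) fun i => ?_).trans ?_
  · have h1 := hx i trivial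
    have h2 := hy i trivial
    simp only [Set.mem_Ico] at h1 h2
    rw [PiLp.sub_apply, abs_le]
    constructor <;> nlinarith
  · gcongr
    linarith

theorem mem_dyadicCube_dyadicIndex (L : ℝ) (k : ℕ) (x : EuclideanSpace ℝ (Fin n)) :
    x ∈ dyadicCube L (k, dyadicIndex L k x) := rfl

/-- Lebesgue's differentiation theorem along dyadic cubes: each lies in a ball of comparable
volume. -/
theorem ae_enorm_le_of_lintegral_dyadicCube_le {u : EuclideanSpace ℝ (Fin n) → 𝕜}
    (hu : Integrable u) {L h : ℝ} (hL : 0 < L) :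
    ∀ᵐ x, (∀ k, ∫⁻ y in dyadicCube L (k, dyadicIndex L k x), ‖u y‖ₑ ≤
      ENNReal.ofReal h * volume (dyadicCube L (k, dyadicIndex L k x))) →
        ‖u x‖ₑ ≤ ENNReal.ofReal h := by
  filter_upwards [(Besicovitch.vitaliFamily (volume : Measure (EuclideanSpace ℝ (Fin n))))
    |>.ae_tendsto_lintegral_enorm_sub_div hu.locallyIntegrable] with x hx hk
  set a : ℕ → ℝ := fun k => (√n + 1) * (L / 2 ^ k) with ha
  have ha0 : ∀ k, 0 < a k := fun k => by simp only [ha]; positivity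
  have halim : Tendsto a atTop (𝓝[>] 0) := by
    refine tendsto_nhdsWithin_iff.2 ⟨?_, Eventually.of_forall ha0⟩
    have h1 : Tendsto (fun k : ℕ => (√n + 1) * L * (1 / 2 : ℝ) ^ k) atTop (𝓝 ((√n + 1) * L * 0)) :=
      (tendsto_pow_atTop_nhds_zero_of_lt_one (by norm_num) (by norm_num)).const_mul _
    rw [mul_zero] at h1
    refine h1.congr fun k => ?_
    simp only [ha, one_div, inv_pow]
    ring
  have hlim := hx.comp ((Besicovitch.tendsto_filterAt volume x).comp halim)
  set V := volume (Metric.ball (0 : EuclideanSpace ℝ (Fin n)) 1)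
  have hV : V ≠ ∞ := measure_ball_lt_top.ne
  have hV0 : V ≠ 0 := (Metric.measure_ball_pos volume _ one_pos).ne'
  set ρ := ENNReal.ofReal ((√n + 1) ^ n) * V
  have hρ : ρ ≠ ∞ := ENNReal.mul_ne_top ENNReal.ofReal_ne_top hV
  have hρ0 : ρ ≠ 0 := mul_ne_zero (by simp only [ne_eq, ENNReal.ofReal_eq_zero, not_le]; positivity)
    hV0
  have hlim2 : Tendsto (fun k => ENNReal.ofReal h + (∫⁻ y in Metric.closedBall x (a k),
      ‖u y - u x‖ₑ) / volume (Metric.closedBall x (a k)) * ρ) atTop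
      (𝓝 (ENNReal.ofReal h + 0 * ρ)) :=
    (ENNReal.Tendsto.mul_const hlim (Or.inr hρ)).const_add _
  rw [zero_mul, add_zero] at hlim2
  refine ge_of_tendsto' hlim2 fun k => ?_
  set D := dyadicCube L (k, dyadicIndex L k x) with hD
  have hvD : volume D = ENNReal.ofReal ((L / 2 ^ k) ^ n) := volume_dyadicCube hL _
  have hvD0 : volume D ≠ 0 := by
    rw [hvD]; simp only [ne_eq, ENNReal.ofReal_eq_zero, not_le]; positivity
  have hvDt : volume D ≠ ∞ := by rw [hvD]; exact ENNReal.ofReal_ne_top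
  have hvB : volume (Metric.closedBall x (a k)) = ρ * volume D := by
    rw [Measure.addHaar_closedBall _ _ (ha0 k).le, hvD]
    simp only [ha, finrank_euclideanSpace, Fintype.card_fin, mul_pow]
    rw [ENNReal.ofReal_mul (by positivity)]
    ring
  have hDB : D ⊆ Metric.closedBall x (a k) := fun y hy => by
    rw [Metric.mem_closedBall, dist_eq_norm]
    exact norm_sub_le_of_mem_dyadicCube hL hy (mem_dyadicCube_dyadicIndex L k x)
  have h1 : ‖u x‖ₑ * volume D ≤ ENNReal.ofReal h * volume D +
      ∫⁻ y in Metric.closedBall x (a k), ‖u y - u x‖ₑ := by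
    calc ‖u x‖ₑ * volume D = ∫⁻ _y in D, ‖u x‖ₑ := by simp
      _ ≤ ∫⁻ y in D, (‖u y‖ₑ + ‖u y - u x‖ₑ) := by
          refine lintegral_mono fun y => ?_
          calc ‖u x‖ₑ = ‖u y - (u y - u x)‖ₑ := by rw [sub_sub_cancel]
            _ ≤ _ := enorm_sub_le
      _ = (∫⁻ y in D, ‖u y‖ₑ) + ∫⁻ y in D, ‖u y - u x‖ₑ :=
          lintegral_add_left' hu.aestronglyMeasurable.enorm.restrict _
      _ ≤ _ := by
          gcongr
          exact hk k
  have h2 : ‖u x‖ₑ ≤ (ENNReal.ofReal h * volume D +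
      ∫⁻ y in Metric.closedBall x (a k), ‖u y - u x‖ₑ) / volume D :=
    (ENNReal.le_div_iff_mul_le (Or.inl hvD0) (Or.inl hvDt)).2 h1
  refine h2.trans (le_of_eq ?_)
  rw [ENNReal.add_div, ENNReal.mul_div_cancel_right hvD0 hvDt, hvB, mul_comm ρ,
    ENNReal.div_eq_inv_mul, ENNReal.div_eq_inv_mul, ENNReal.mul_inv (Or.inl hvD0) (Or.inl hvDt)]
  congr 1
  calc _ = ((volume D)⁻¹ * ∫⁻ y in Metric.closedBall x (a k), ‖u y - u x‖ₑ) * (ρ⁻¹ * ρ) := by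
        rw [ENNReal.inv_mul_cancel hρ0 hρ, mul_one]
    _ = _ := by ring

/-- The maximal dyadic cubes on which the mean of `|u|` exceeds `h`. The hypothesis on `L` says
that the mean of `|u|` over each of the largest cubes is at most `h`. -/
theorem exists_maximal_dyadicCubes {u : EuclideanSpace ℝ (Fin n) → 𝕜} (hu : Integrable u)
    {h L : ℝ} (hh : 0 < h) (hL : 0 < L) (hle : ∫⁻ x, ‖u x‖ₑ ≤ ENNReal.ofReal (h * L ^ n)) :
    ∃ B : Set (ℕ × (Fin n → ℤ)), B.PairwiseDisjoint (dyadicCube L) ∧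
      (∀ q ∈ B, ENNReal.ofReal h * volume (dyadicCube L q) < ∫⁻ x in dyadicCube L q, ‖u x‖ₑ) ∧
      (∀ q ∈ B, ∫⁻ x in dyadicCube L q, ‖u x‖ₑ ≤
        ENNReal.ofReal (2 ^ n * h) * volume (dyadicCube L q)) ∧
      ∀ᵐ x, x ∉ ⋃ q ∈ B, dyadicCube L q → ‖u x‖ₑ ≤ ENNReal.ofReal h := by
  set bad : ℕ → EuclideanSpace ℝ (Fin n) → Prop := fun k x =>
    ENNReal.ofReal h * volume (dyadicCube L (k, dyadicIndex L k x)) <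
      ∫⁻ y in dyadicCube L (k, dyadicIndex L k x), ‖u y‖ₑ with hbad
  have hbad0 : ∀ x, ¬ bad 0 x := fun x => by
    simp only [hbad, not_lt]
    refine (setLIntegral_le_lintegral _ _).trans (hle.trans (le_of_eq ?_))
    rw [volume_dyadicCube hL, ← ENNReal.ofReal_mul hh.le]
    simp
  -- Cubes on which the mean is too large, while it is not on any of their dyadic ancestors.
  set B : Set (ℕ × (Fin n → ℤ)) := {q |
    ENNReal.ofReal h * volume (dyadicCube L q) < ∫⁻ x in dyadicCube L q, ‖u x‖ₑ ∧
      ∀ x ∈ dyadicCube L q, ∀ j < q.1, ¬ bad j x} with hB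
  refine ⟨B, ?_, fun q hq => hq.1, fun q hq => ?_, ?_⟩
  · have aux : ∀ q ∈ B, ∀ q' ∈ B, ∀ x ∈ dyadicCube L q, x ∈ dyadicCube L q' → ¬ q.1 < q'.1 := by
      intro q hq q' hq' x hx hx' hlt
      refine hq'.2 x hx' q.1 hlt ?_
      simp only [hbad]
      rw [show dyadicIndex L q.1 x = q.2 from hx]
      exact hq.1
    intro q hq q' hq' hne
    refine Set.disjoint_left.2 fun x hx hx' => hne ?_
    have h1 : q.1 = q'.1 :=
      le_antisymm (not_lt.1 (aux q' hq' q hq x hx' hx)) (not_lt.1 (aux q hq q' hq' x hx hx'))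
    have h2 : q.2 = q'.2 := by
      rw [← (show dyadicIndex L q.1 x = q.2 from hx), ← (show dyadicIndex L q'.1 x = q'.2 from hx'),
        h1]
    exact Prod.ext h1 h2
  · obtain ⟨x, hx⟩ : (dyadicCube L q).Nonempty := by
      rw [Set.nonempty_iff_ne_empty]
      intro he
      have := hq.1
      simp [he] at this
    obtain ⟨k, v⟩ := q
    rcases k with _ | k
    · refine absurd ?_ (hbad0 x)
      simp only [hbad]
      rw [show dyadicIndex L 0 x = v from hx]
      exact hq.1
    · have h1 := hq.2 x hx k (Nat.lt_succ_self k)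
      simp only [hbad, not_lt] at h1
      have hsub : dyadicCube L (k + 1, v) ⊆ dyadicCube L (k, dyadicIndex L k x) := fun y hy =>
        dyadicIndex_eq_of_le (Nat.le_succ k)
          ((show dyadicIndex L (k + 1) y = v from hy).trans (show v = _ from hx.symm))
      refine (lintegral_mono_set hsub).trans (h1.trans (le_of_eq ?_))
      rw [volume_dyadicCube hL, volume_dyadicCube hL, ← ENNReal.ofReal_mul hh.le,
        ← ENNReal.ofReal_mul (by positivity)]
      congr 1
      simp only [pow_succ, div_pow, mul_pow]
      field_simp
  · filter_upwards [ae_enorm_le_of_lintegral_dyadicCube_le hu (h := h) hL] with x hx hxB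
    refine hx fun k => ?_
    by_contra hcon
    rw [not_le] at hcon
    have hex : ∃ k, bad k x := ⟨k, hcon⟩
    classical
    refine hxB (mem_biUnion (x := (Nat.find hex, dyadicIndex L (Nat.find hex) x)) ?_
      (mem_dyadicCube_dyadicIndex L _ x))
    refine ⟨Nat.find_spec hex, fun y hy j hj hbj => Nat.find_min hex hj ?_⟩
    have hyx : dyadicIndex L j y = dyadicIndex L j x := dyadicIndex_eq_of_le hj.le hy
    simp only [hbad] at hbj ⊢
    rwa [hyx] at hbj

/-- The Calderón–Zygmund decomposition `u = g + ∑ b` at height `h`, with each bad function `b q`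
supported in the ball of centre `z q` and radius `r q`. -/
theorem exists_calderonZygmund (hn : 1 ≤ n) {u : EuclideanSpace ℝ (Fin n) → 𝕜} (hum : Measurable u)
    (hu : Integrable u) {h : ℝ} (hh : 0 < h) :
    ∃ (ι : Type) (_ : Countable ι) (g : EuclideanSpace ℝ (Fin n) → 𝕜)
      (b : ι → EuclideanSpace ℝ (Fin n) → 𝕜) (z : ι → EuclideanSpace ℝ (Fin n)) (r : ι → ℝ),
      Measurable g ∧ (∀ q, Measurable (b q)) ∧ (∀ q, 0 < r q) ∧
      (∀ q x, r q < ‖x - z q‖ → b q x = 0) ∧ (∀ q, ∫ x, b q x = 0) ∧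
      (∀ x, HasSum (fun q => b q x) (u x - g x)) ∧
      (∫⁻ x, ‖g x‖ₑ ≤ ∫⁻ x, ‖u x‖ₑ) ∧
      (∀ᵐ x, ‖g x‖ₑ ≤ ENNReal.ofReal (2 ^ n * h)) ∧
      (∑' q, ∫⁻ x, ‖b q x‖ₑ ≤ 2 * ∫⁻ x, ‖u x‖ₑ) ∧
      (∑' q, ENNReal.ofReal (r q ^ n * h) ≤ ENNReal.ofReal ((√n + 1) ^ n) * ∫⁻ x, ‖u x‖ₑ) := by
  -- The largest cubes are taken so big that the mean over them is at most `h`.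
  obtain ⟨L, hL, hle⟩ : ∃ L : ℝ, 0 < L ∧ ∫⁻ x, ‖u x‖ₑ ≤ ENNReal.ofReal (h * L ^ n) := by
    set N := (∫⁻ x, ‖u x‖ₑ).toReal
    have hN : 0 ≤ N / h := by positivity
    refine ⟨N / h + 1, by positivity, ?_⟩
    rw [← ENNReal.ofReal_toReal (show ∫⁻ x, ‖u x‖ₑ ≠ ∞ from hu.2.ne)]
    apply ENNReal.ofReal_le_ofReal
    calc N = h * (N / h) := by field_simp
      _ ≤ h * (N / h + 1) ^ n := by
          gcongr
          have := le_self_pow₀ (show 1 ≤ N / h + 1 by linarith) (show n ≠ 0 by omega)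
          linarith
  obtain ⟨B, hdisj, hgt, hub, hae⟩ := exists_maximal_dyadicCubes hu hh hL hle
  set D : B → Set (EuclideanSpace ℝ (Fin n)) := fun q => dyadicCube L q.1 with hD
  have hDm : ∀ q, MeasurableSet (D q) := fun q => measurableSet_dyadicCube hL _
  have hDd : Pairwise (Function.onFun Disjoint D) := fun q q' hne =>
    hdisj q.2 q'.2 fun h => hne (Subtype.ext h)
  have hDv : ∀ q, volume (D q) = ENNReal.ofReal ((L / 2 ^ q.1.1) ^ n) := fun q =>
    volume_dyadicCube hL _
  have hDt : ∀ q, volume (D q) ≠ ∞ := fun q => by rw [hDv]; exact ENNReal.ofReal_ne_top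
  have hD0 : ∀ q, volume (D q) ≠ 0 := fun q => by
    rw [hDv]; simp only [ne_eq, ENNReal.ofReal_eq_zero, not_le]; positivity
  have hDne : ∀ q : B, (D q).Nonempty := fun q => nonempty_of_measure_ne_zero (hD0 q)
  choose z hz using hDne
  set Ω := ⋃ q, D q with hΩ
  have hΩm : MeasurableSet Ω := MeasurableSet.iUnion hDm
  have hΩB : Ω = ⋃ q ∈ B, dyadicCube L q := by rw [hΩ, iUnion_subtype]
  set m : B → 𝕜 := fun q => ⨍ x in D q, u x with hm
  have hmle : ∀ q, ‖m q‖ₑ * volume (D q) ≤ ∫⁻ x in D q, ‖u x‖ₑ := fun q => by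
    have h1 := measure_smul_setAverage u (hDt q)
    have h2 : ‖m q‖ₑ * volume (D q) = ‖∫ x in D q, u x‖ₑ := by
      rw [← h1, enorm_smul, Real.enorm_eq_ofReal measureReal_nonneg,
        ofReal_measureReal (hDt q), mul_comm]
    rw [h2]
    exact enorm_integral_le_lintegral_enorm _
  obtain ⟨g, hgm, hg⟩ : ∃ g : EuclideanSpace ℝ (Fin n) → 𝕜, Measurable g ∧
      (∀ x ∉ Ω, g x = u x) ∧ ∀ q, ∀ x ∈ D q, g x = m q := by
    obtain ⟨g, hgm, hg⟩ := exists_measurable_piecewise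
      (fun o : Option B => o.elim Ωᶜ D) (by rintro (_ | q); exacts [hΩm.compl, hDm q])
      (fun o : Option B => o.elim u fun q _ => m q)
      (by rintro (_ | q); exacts [hum, measurable_const]) (by
        rintro (_ | q) (_ | q') hne x ⟨hx, hx'⟩
        · rfl
        · exact absurd (mem_iUnion.2 ⟨q', hx'⟩) hx
        · exact absurd (mem_iUnion.2 ⟨q, hx⟩) hx'
        · exact absurd hx' (Set.disjoint_left.1 (hDd fun h => hne (congrArg some h)) hx))
    exact ⟨g, hgm, fun x hx => hg none hx, fun q x hx => hg (some q) hx⟩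
  set b : B → EuclideanSpace ℝ (Fin n) → 𝕜 := fun q => (D q).indicator fun x => u x - m q with hb
  have hbl : ∀ q, ∫⁻ x, ‖b q x‖ₑ ≤ 2 * ∫⁻ x in D q, ‖u x‖ₑ := fun q => by
    calc ∫⁻ x, ‖b q x‖ₑ = ∫⁻ x in D q, ‖u x - m q‖ₑ := by
          simp only [hb, enorm_indicator_eq_indicator_enorm]
          exact lintegral_indicator (hDm q) _
      _ ≤ ∫⁻ x in D q, (‖u x‖ₑ + ‖m q‖ₑ) := lintegral_mono fun x => enorm_sub_le
      _ = (∫⁻ x in D q, ‖u x‖ₑ) + ‖m q‖ₑ * volume (D q) := by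
          rw [lintegral_add_right _ measurable_const]
          simp
      _ ≤ _ := by
          rw [two_mul]
          gcongr
          exact hmle q
  have hsumD : ∑' q, ∫⁻ x in D q, ‖u x‖ₑ ≤ ∫⁻ x, ‖u x‖ₑ := by
    rw [← lintegral_iUnion hDm hDd]
    exact setLIntegral_le_lintegral _ _
  refine ⟨B, inferInstance, g, b, z, fun q => (√n + 1) * (L / 2 ^ q.1.1), hgm,
    fun q => (hum.sub_const _).indicator (hDm q), fun q => by positivity, fun q x hx => ?_,
    fun q => ?_, fun x => ?_, ?_, ?_, ?_, ?_⟩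
  · refine indicator_of_notMem (fun hxD => ?_) _
    exact absurd hx (not_lt.2 (norm_sub_le_of_mem_dyadicCube hL hxD (hz q)))
  · have h1 := measure_smul_setAverage u (hDt q)
    simp only [hb]
    rw [integral_indicator (hDm q), integral_sub hu.integrableOn (integrableOn_const (hDt q)),
      setIntegral_const, ← h1, sub_self]
  · by_cases hx : x ∈ Ω
    · obtain ⟨q, hq⟩ := mem_iUnion.1 hx
      have h1 : u x - g x = b q x := by
        rw [hg.2 q x hq]; simp [hb, hq]
      rw [h1]
      refine hasSum_single q fun q' hne => ?_
      exact indicator_of_notMem (Set.disjoint_left.1 (hDd hne.symm) hq) _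
    · rw [hg.1 x hx, sub_self]
      convert hasSum_zero with q
      exact indicator_of_notMem (fun hq => hx (mem_iUnion.2 ⟨q, hq⟩)) _
  · rw [← lintegral_add_compl _ hΩm, ← lintegral_add_compl (fun x => ‖u x‖ₑ) hΩm, hΩ,
      lintegral_iUnion hDm hDd, lintegral_iUnion hDm hDd]
    refine add_le_add (ENNReal.tsum_le_tsum fun q => ?_) (le_of_eq ?_)
    · rw [setLIntegral_congr_fun (f := fun x => ‖g x‖ₑ) (g := fun _ => ‖m q‖ₑ) (hDm q)
        fun x hx => by simp only [hg.2 q x hx]]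
      simpa using hmle q
    · exact setLIntegral_congr_fun hΩm.compl fun x hx => by simp only [hg.1 x hx]
  · filter_upwards [hae] with x hx
    by_cases hxΩ : x ∈ Ω
    · obtain ⟨q, hq⟩ := mem_iUnion.1 hxΩ
      rw [hg.2 q x hq]
      have := (hmle q).trans (hub q.1 q.2)
      exact (ENNReal.mul_le_mul_iff_left (hD0 q) (hDt q)).1 this
    · rw [hg.1 x hxΩ]
      rw [hΩB] at hxΩ
      refine (hx hxΩ).trans (ENNReal.ofReal_le_ofReal ?_)
      exact le_mul_of_one_le_left hh.le (one_le_pow₀ (by norm_num))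
  · calc _ ≤ ∑' q, 2 * ∫⁻ x in D q, ‖u x‖ₑ := ENNReal.tsum_le_tsum hbl
      _ = 2 * ∑' q, ∫⁻ x in D q, ‖u x‖ₑ := ENNReal.tsum_mul_left
      _ ≤ _ := by gcongr
  · calc _ ≤ ∑' q, ENNReal.ofReal ((√n + 1) ^ n) * ∫⁻ x in D q, ‖u x‖ₑ := by
          refine ENNReal.tsum_le_tsum fun q => ?_
          rw [mul_pow, mul_assoc, ENNReal.ofReal_mul (by positivity)]
          gcongr
          refine le_trans (le_of_eq ?_) (hgt q.1 q.2).le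
          rw [mul_comm, ENNReal.ofReal_mul hh.le]
          exact congrArg _ (hDv q).symm
      _ = ENNReal.ofReal ((√n + 1) ^ n) * ∑' q, ∫⁻ x in D q, ‖u x‖ₑ := ENNReal.tsum_mul_left
      _ ≤ _ := by gcongr

end CalderonZygmund

/-! ### The square function of a function with mean zero supported in a ball -/

section Atom

variable {n : ℕ} {𝕜 : Type*} [RCLike 𝕜]

namespace IsRegularKernel

variable {ψ : EuclideanSpace ℝ (Fin n) → 𝕜} {c δ : ℝ}

/-- For a function of mean zero supported in a ball, the `L¹` modulus of continuity of the kernel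
makes the convolution small in `L¹` at scales larger than the radius: the value of the kernel at
the centre can be subtracted. -/
theorem lintegral_dilConv_atom_le (hψ : IsRegularKernel ψ c δ)
    {b : EuclideanSpace ℝ (Fin n) → 𝕜} (hbm : Measurable b) (hb : Integrable b)
    {z : EuclideanSpace ℝ (Fin n)} {r : ℝ} (hsupp : ∀ x, r < ‖x - z‖ → b x = 0)
    (hmean : ∫ x, b x = 0) {t : ℝ} (ht : 0 < t) :
    ∫⁻ y, ‖dilConv ψ b t y‖ₑ ≤ ENNReal.ofReal (c * (r / t) ^ δ) * ∫⁻ x, ‖b x‖ₑ := by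
  have hc := hψ.const_pos
  have hδ := hψ.exponent_pos
  have hdm := measurable_dilate hψ.measurable t
  have heq : ∀ y, dilConv ψ b t y =
      ∫ x, b x * (dilate ψ t (y - x) - dilate ψ t (y - z)) := fun y => by
    simp only [mul_sub]
    rw [integral_sub (hψ.integrable_mul_dilate ht hb y) (hb.mul_const _), integral_mul_const, hmean,
      zero_mul, sub_zero, dilConv_apply]
  calc ∫⁻ y, ‖dilConv ψ b t y‖ₑ
      ≤ ∫⁻ y, ∫⁻ x, ‖b x‖ₑ * ‖dilate ψ t (y - x) - dilate ψ t (y - z)‖ₑ := by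
        refine lintegral_mono fun y => ?_
        rw [heq]
        refine (enorm_integral_le_lintegral_enorm _).trans (le_of_eq ?_)
        simp only [enorm_mul]
    _ = ∫⁻ x, ∫⁻ y, ‖b x‖ₑ * ‖dilate ψ t (y - x) - dilate ψ t (y - z)‖ₑ := by
        refine lintegral_lintegral_swap (Measurable.aemeasurable ?_)
        fun_prop
    _ ≤ ∫⁻ x, ENNReal.ofReal (c * (r / t) ^ δ) * ‖b x‖ₑ := by
        refine lintegral_mono fun x => ?_
        simp only
        rw [lintegral_const_mul' _ _ enorm_ne_top, mul_comm]
        by_cases hx : r < ‖x - z‖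
        · simp [hsupp x hx]
        · gcongr
          have h1 : ∀ y, dilate ψ t (y - x) - dilate ψ t (y - z) =
              dilate ψ t ((y - z) + (z - x)) - dilate ψ t (y - z) := fun y => by
            congr 2; abel
          simp_rw [h1]
          rw [lintegral_sub_right_eq_self
            (fun y => ‖dilate ψ t (y + (z - x)) - dilate ψ t y‖ₑ) z]
          refine (hψ.modulus_dilate ht _).trans (ENNReal.ofReal_le_ofReal ?_)
          rw [norm_sub_rev]
          gcongr
          exact not_lt.1 hx
    _ = _ := lintegral_const_mul' _ _ ENNReal.ofReal_ne_top

/-- The convolution with a function supported in `B(z, r)` decays away from that ball. The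
quantity `ρ = |y - z| + 2αt` bounds `|x - z|` for the points `x` at which `(y, t)` counts. -/
theorem rpow_mul_enorm_dilConv_atom_le (hψ : IsRegularKernel ψ c δ)
    {b : EuclideanSpace ℝ (Fin n) → 𝕜} {z : EuclideanSpace ℝ (Fin n)} {r : ℝ} (hr : 0 < r)
    (hsupp : ∀ x, r < ‖x - z‖ → b x = 0) {α t : ℝ} (hα : 1 ≤ α) (ht : 0 < t)
    {y : EuclideanSpace ℝ (Fin n)} (hy : 6 * α * r < ‖y - z‖ + 2 * (t * α)) :
    ENNReal.ofReal ((‖y - z‖ + 2 * (t * α)) ^ (n + δ / 2)) * ‖dilConv ψ b t y‖ₑ ≤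
      ENNReal.ofReal (c * 3 ^ (n + δ / 2) * 2 ^ (n + δ) * α ^ (n + δ / 2) * t ^ (δ / 2)) *
        ∫⁻ x, ‖b x‖ₑ := by
  have hc := hψ.const_pos
  have hδ := hψ.exponent_pos
  have hα0 : 0 < α := by linarith
  have hexp : (0 : ℝ) ≤ n + δ / 2 := by positivity
  -- When `ρ` is comparable to `tα` the sup bound on the kernel is enough; otherwise it is comparable
  -- to `|y - z|`, and the decay of the kernel is used.
  rcases le_or_gt ‖y - z‖ (t * α) with h | h
  · calc _ ≤ ENNReal.ofReal ((3 * (t * α)) ^ (n + δ / 2)) *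
          (ENNReal.ofReal (c * (t ^ n)⁻¹) * ∫⁻ x, ‖b x‖ₑ) := by
          gcongr
          · linarith
          · exact (enorm_dilConv_le ψ b t y).trans (hψ.absConv_le ht b y)
      _ ≤ _ := by
          rw [← mul_assoc, ← ENNReal.ofReal_mul (by positivity)]
          gcongr ENNReal.ofReal ?_ * _
          have h1 : (3 * (t * α)) ^ (n + δ / 2) =
              3 ^ (n + δ / 2) * (t ^ n * t ^ (δ / 2)) * α ^ (n + δ / 2) := by
            rw [Real.mul_rpow (by norm_num) (by positivity), Real.mul_rpow ht.le hα0.le,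
              Real.rpow_add ht, Real.rpow_natCast]
            ring
          have h2 : (1 : ℝ) ≤ 2 ^ (n + δ) := Real.one_le_rpow (by norm_num) (by positivity)
          calc (3 * (t * α)) ^ (n + δ / 2) * (c * (t ^ n)⁻¹)
              = c * 3 ^ (n + δ / 2) * 1 * α ^ (n + δ / 2) * t ^ (δ / 2) := by
                rw [h1]; field_simp
            _ ≤ _ := by gcongr
  · set ρ := ‖y - z‖ with hρ
    have hρ0 : 0 < ρ := lt_of_le_of_lt (by positivity) h
    have hr2 : 2 * r ≤ ρ := by
      have : 6 * r ≤ 6 * α * r := by nlinarith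
      linarith
    have hF : ‖dilConv ψ b t y‖ₑ ≤
        ENNReal.ofReal (c * t ^ δ * (ρ / 2) ^ (-(n + δ))) * ∫⁻ x, ‖b x‖ₑ := by
      refine (enorm_dilConv_le ψ b t y).trans ?_
      rw [← lintegral_const_mul' _ _ ENNReal.ofReal_ne_top]
      refine lintegral_mono fun x => ?_
      rw [mul_comm]
      by_cases hx : r < ‖x - z‖
      · simp [hsupp x hx]
      · gcongr
        rw [← ofReal_norm]
        refine ENNReal.ofReal_le_ofReal
          (hψ.norm_dilate_le_of_le_norm ht (by positivity) ?_)
        have h3 : ρ ≤ ‖y - x‖ + ‖x - z‖ := by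
          rw [hρ]; simpa using norm_add_le (y - x) (x - z)
        linarith [not_lt.1 hx]
    calc _ ≤ ENNReal.ofReal ((3 * ρ) ^ (n + δ / 2)) *
          (ENNReal.ofReal (c * t ^ δ * (ρ / 2) ^ (-(n + δ))) * ∫⁻ x, ‖b x‖ₑ) := by
          gcongr
          linarith
      _ ≤ _ := by
          rw [← mul_assoc, ← ENNReal.ofReal_mul (by positivity)]
          gcongr ENNReal.ofReal ?_ * _
          have h1 : (ρ / 2) ^ (-(n + δ)) = 2 ^ (n + δ) * ρ ^ (-(n + δ)) := by
            rw [Real.div_rpow hρ0.le (by norm_num), Real.rpow_neg (by norm_num : (0 : ℝ) ≤ 2)]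
            field_simp
          have h2 : (3 * ρ) ^ (n + δ / 2) * (c * t ^ δ * (ρ / 2) ^ (-(n + δ))) =
              c * 3 ^ (n + δ / 2) * 2 ^ (n + δ) * t ^ δ * ρ ^ (-(δ / 2)) := by
            rw [h1, Real.mul_rpow (by norm_num) hρ0.le]
            have : ρ ^ (-(δ / 2)) = ρ ^ (n + δ / 2) * ρ ^ (-(n + δ)) := by
              rw [← Real.rpow_add hρ0]; congr 1; ring
            rw [this]
            ring
          have h3 : t ^ δ * ρ ^ (-(δ / 2)) ≤ t ^ (δ / 2) := by
            calc t ^ δ * ρ ^ (-(δ / 2)) ≤ t ^ δ * t ^ (-(δ / 2)) := by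
                  gcongr ?_ * ?_
                  exact Real.rpow_le_rpow_of_nonpos ht (by nlinarith) (by linarith)
              _ = _ := by rw [← Real.rpow_add ht]; congr 1; ring
          have h4 : 1 ≤ α ^ (n + δ / 2) := Real.one_le_rpow hα hexp
          rw [h2]
          calc _ = c * 3 ^ (n + δ / 2) * 2 ^ (n + δ) * 1 * (t ^ δ * ρ ^ (-(δ / 2))) := by ring
            _ ≤ _ := by gcongr

variable {Φ : 𝓢(EuclideanSpace ℝ (Fin n), ℝ)}

/-- Weighted `L²` bound for the square function of an atom far from its supporting ball. The
exponent `n + δ / 2` of the weight exceeds `n`, so that its inverse is integrable at infinity, and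
is below the decay exponent `n + δ` of the kernel. -/
theorem exists_lintegral_rpow_mul_squareInt_atom_le (hψ : IsRegularKernel ψ c δ)
    (hΦ : IsCutoff Φ) :
    ∃ C : ℝ, 0 < C ∧ ∀ (b : EuclideanSpace ℝ (Fin n) → 𝕜), Measurable b → Integrable b →
      ∀ (z : EuclideanSpace ℝ (Fin n)) (r : ℝ), 0 < r → (∀ x, r < ‖x - z‖ → b x = 0) →
      ∫ x, b x = 0 → ∀ α : ℝ, 1 ≤ α →
      ∫⁻ x, ({x | 6 * α * r < ‖x - z‖}.indicator
          (fun x => ENNReal.ofReal (‖x - z‖ ^ (n + δ / 2))) x) *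
          squareInt Φ α (fun p => ‖dilConv ψ b p.2 p.1‖ₑ) x ≤
        ENNReal.ofReal (C * α ^ (2 * n + δ / 2) * r ^ (δ / 2)) * (∫⁻ x, ‖b x‖ₑ) ^ 2 := by
  have hc := hψ.const_pos
  have hδ := hψ.exponent_pos
  set V := (volume (Metric.ball (0 : EuclideanSpace ℝ (Fin n)) 1)).toReal with hV
  have hV0 : 0 ≤ V := by positivity
  have hVe : volume (Metric.ball (0 : EuclideanSpace ℝ (Fin n)) 1) = ENNReal.ofReal V :=
    (ENNReal.ofReal_toReal measure_ball_lt_top.ne).symm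
  set C₁ := c * 3 ^ (n + δ / 2) * 2 ^ (n + δ) with hC₁
  have hC₁0 : 0 < C₁ := by positivity
  refine ⟨2 ^ n * (V + 1) * C₁ * c * (4 / δ), by positivity,
    fun b hbm hb z r hr hsupp hmean α hα => ?_⟩
  have hα0 : 0 < α := by linarith
  set N := ∫⁻ x, ‖b x‖ₑ with hN
  set w : EuclideanSpace ℝ (Fin n) → ℝ≥0∞ := {x | 6 * α * r < ‖x - z‖}.indicator
    (fun x => ENNReal.ofReal (‖x - z‖ ^ (n + δ / 2))) with hw
  have hwm : Measurable w :=
    Measurable.indicator (by fun_prop) (measurableSet_lt (by fun_prop) (by fun_prop))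
  have hFm := measurable_dilConv hψ.measurable hbm
  rw [lintegral_mul_squareInt Φ α hFm.enorm hwm]
  -- The pointwise decay of one factor `|b * ψ_t (y)|` absorbs the weight, integrated over the points
  -- `x` whose cones contain `(y, t)`; the other factor is integrated in `y`.
  have hW : ∀ t, 0 < t → ∀ y,
      (∫⁻ x, w x * ENNReal.ofReal (Φ ((t * α)⁻¹ • (x - y)))) * ‖dilConv ψ b t y‖ₑ ≤
        ENNReal.ofReal ((2 * (t * α)) ^ n * V * (C₁ * α ^ (n + δ / 2) * t ^ (δ / 2))) * N :=
    fun t ht y => by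
      have htα : 0 < t * α := by positivity
      by_cases hy : 6 * α * r < ‖y - z‖ + 2 * (t * α)
      · have h1 : ∫⁻ x, w x * ENNReal.ofReal (Φ ((t * α)⁻¹ • (x - y))) ≤
            ENNReal.ofReal ((‖y - z‖ + 2 * (t * α)) ^ (n + δ / 2)) *
              ENNReal.ofReal ((2 * (t * α)) ^ n * V) := by
          calc _ ≤ ∫⁻ x, ENNReal.ofReal ((‖y - z‖ + 2 * (t * α)) ^ (n + δ / 2)) *
                ENNReal.ofReal (Φ ((t * α)⁻¹ • (x - y))) := by
                refine lintegral_mono fun x => ?_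
                by_cases hx : 2 ≤ ‖(t * α)⁻¹ • (x - y)‖
                · rw [hΦ.eq_zero hx]; simp
                · gcongr
                  refine (indicator_le_self _ _ x).trans (ENNReal.ofReal_le_ofReal ?_)
                  rw [norm_smul, Real.norm_of_nonneg (by positivity), inv_mul_eq_div, not_le,
                    div_lt_iff₀ htα] at hx
                  have h3 : ‖x - z‖ ≤ ‖x - y‖ + ‖y - z‖ := by
                    simpa using norm_add_le (x - y) (y - z)
                  gcongr
                  linarith
            _ ≤ _ := by
                rw [lintegral_const_mul' _ _ ENNReal.ofReal_ne_top,
                  ENNReal.ofReal_mul (by positivity), ← hVe]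
                gcongr
                exact hΦ.lintegral_le htα y
        calc _ ≤ ENNReal.ofReal ((2 * (t * α)) ^ n * V) *
              (ENNReal.ofReal ((‖y - z‖ + 2 * (t * α)) ^ (n + δ / 2)) * ‖dilConv ψ b t y‖ₑ) := by
              rw [← mul_assoc, mul_comm (ENNReal.ofReal (_ * V))]
              gcongr
          _ ≤ ENNReal.ofReal ((2 * (t * α)) ^ n * V) *
              (ENNReal.ofReal (C₁ * α ^ (n + δ / 2) * t ^ (δ / 2)) * N) := by
              gcongr _ * ?_
              exact hψ.rpow_mul_enorm_dilConv_atom_le hr hsupp hα ht hy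
          _ = _ := by rw [← mul_assoc, ← ENNReal.ofReal_mul (by positivity)]
      · have h1 : ∀ x, w x * ENNReal.ofReal (Φ ((t * α)⁻¹ • (x - y))) = 0 := fun x => by
          by_cases hx : 2 ≤ ‖(t * α)⁻¹ • (x - y)‖
          · rw [hΦ.eq_zero hx]; simp
          · rw [norm_smul, Real.norm_of_nonneg (by positivity), inv_mul_eq_div, not_le,
              div_lt_iff₀ htα] at hx
            have h3 : ‖x - z‖ ≤ ‖x - y‖ + ‖y - z‖ := by
              simpa using norm_add_le (x - y) (y - z)
            have h4 : w x = 0 := by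
              rw [hw]
              refine indicator_of_notMem ?_ _
              rw [Set.mem_ofPred_eq]
              linarith [not_lt.1 hy]
            simp [h4]
        simp_rw [h1]
        simp
  have hstep : ∀ t, 0 < t → ∫⁻ y, (∫⁻ x, w x * ENNReal.ofReal (Φ ((t * α)⁻¹ • (x - y)))) *
      (‖dilConv ψ b t y‖ₑ ^ 2 / ENNReal.ofReal (t ^ (n + 1))) ≤
      ENNReal.ofReal (2 ^ n * V * C₁ * α ^ (2 * n + δ / 2)) * N *
        (ENNReal.ofReal (t ^ (δ / 2 - 1)) * ∫⁻ y, ‖dilConv ψ b t y‖ₑ) := fun t ht => by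
    have hFt : Measurable fun y => ‖dilConv ψ b t y‖ₑ :=
      hFm.enorm.comp (measurable_prodMk_right (y := t))
    rw [← lintegral_const_mul _ hFt, ← lintegral_const_mul _ (hFt.const_mul _)]
    refine lintegral_mono fun y => ?_
    calc _ = ((∫⁻ x, w x * ENNReal.ofReal (Φ ((t * α)⁻¹ • (x - y)))) * ‖dilConv ψ b t y‖ₑ) *
          ‖dilConv ψ b t y‖ₑ / ENNReal.ofReal (t ^ (n + 1)) := by
          simp only [div_eq_mul_inv]; ring
      _ ≤ (ENNReal.ofReal ((2 * (t * α)) ^ n * V * (C₁ * α ^ (n + δ / 2) * t ^ (δ / 2))) * N) *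
          ‖dilConv ψ b t y‖ₑ / ENNReal.ofReal (t ^ (n + 1)) := by
          gcongr ?_ * _ / _
          exact hW t ht y
      _ = (ENNReal.ofReal ((2 * (t * α)) ^ n * V * (C₁ * α ^ (n + δ / 2) * t ^ (δ / 2))) *
            ENNReal.ofReal (t ^ (n + 1))⁻¹) * N * ‖dilConv ψ b t y‖ₑ := by
          rw [ENNReal.ofReal_inv_of_pos (by positivity), div_eq_mul_inv]; ring
      _ = (ENNReal.ofReal (2 ^ n * V * C₁ * α ^ (2 * n + δ / 2)) *
            ENNReal.ofReal (t ^ (δ / 2 - 1))) * N * ‖dilConv ψ b t y‖ₑ := by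
          rw [← ENNReal.ofReal_mul (by positivity), ← ENNReal.ofReal_mul (by positivity)]
          congr 3
          have h5 : α ^ (2 * n + δ / 2 : ℝ) = α ^ n * α ^ (n + δ / 2 : ℝ) := by
            rw [← Real.rpow_natCast α n, ← Real.rpow_add hα0]; congr 1; ring
          rw [h5, Real.rpow_sub ht, Real.rpow_one, mul_pow, mul_pow, pow_succ]
          generalize α ^ (n + δ / 2 : ℝ) = A
          generalize t ^ (δ / 2 : ℝ) = B
          field_simp
      _ = _ := by ring
  calc _ ≤ ∫⁻ t in Ioi (0 : ℝ), ENNReal.ofReal (2 ^ n * V * C₁ * α ^ (2 * n + δ / 2)) * N *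
        (ENNReal.ofReal (t ^ (δ / 2 - 1)) * ∫⁻ y, ‖dilConv ψ b t y‖ₑ) :=
        setLIntegral_mono' measurableSet_Ioi fun t ht => hstep t ht
    _ ≤ ∫⁻ t in Ioi (0 : ℝ), ENNReal.ofReal (2 ^ n * V * C₁ * α ^ (2 * n + δ / 2)) * N *
        (N * (ENNReal.ofReal (t ^ (δ / 2 - 1)) *
          ENNReal.ofReal (c * min 1 ((r / t) ^ δ)))) := by
        refine setLIntegral_mono' measurableSet_Ioi fun t ht => ?_
        have ht' : 0 < t := ht
        gcongr _ * ?_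
        rw [mul_left_comm]
        gcongr _ * ?_
        rw [mul_comm]
        rcases min_choice 1 ((r / t) ^ δ) with h | h
        · rw [h, mul_one]
          exact (lintegral_mono (enorm_dilConv_le ψ b t)).trans (hψ.lintegral_absConv_le ht hbm)
        · rw [h]
          exact hψ.lintegral_dilConv_atom_le hbm hb hsupp hmean ht
    _ = ENNReal.ofReal (2 ^ n * V * C₁ * α ^ (2 * n + δ / 2)) * N * (N *
        ∫⁻ t in Ioi (0 : ℝ), ENNReal.ofReal (t ^ (δ / 2 - 1)) *
          ENNReal.ofReal (c * min 1 ((r / t) ^ δ))) := by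
        rw [lintegral_const_mul'' _ (by fun_prop), lintegral_const_mul'' _ (by fun_prop)]
    _ ≤ ENNReal.ofReal (2 ^ n * V * C₁ * α ^ (2 * n + δ / 2)) * N * (N *
        ENNReal.ofReal (c * (r ^ (δ / 2) / (δ / 2)) +
          c * r ^ δ * (r ^ (-(δ / 2)) / (δ / 2)))) := by
        gcongr
        refine lintegral_Ioi_le_of_le_rpow (by positivity) (by positivity) hr hc.le
          (by positivity) (fun t ht => ?_) (fun t ht => ?_)
        · rw [← ENNReal.ofReal_mul (by positivity)]
          apply ENNReal.ofReal_le_ofReal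
          rw [mul_comm]
          gcongr
          exact mul_le_of_le_one_right hc.le (min_le_left _ _)
        · rw [← ENNReal.ofReal_mul (by positivity)]
          apply ENNReal.ofReal_le_ofReal
          calc t ^ (δ / 2 - 1) * (c * min 1 ((r / t) ^ δ))
              ≤ t ^ (δ / 2 - 1) * (c * (r / t) ^ δ) := by gcongr; exact min_le_right _ _
            _ = c * r ^ δ * t ^ (-(δ / 2) - 1) := by
                rw [Real.div_rpow hr.le ht.le, show -(δ / 2) - 1 = (δ / 2 - 1) - δ by ring,
                  Real.rpow_sub ht (δ / 2 - 1) δ]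
                ring
    _ ≤ _ := by
        have h1 : c * (r ^ (δ / 2) / (δ / 2)) + c * r ^ δ * (r ^ (-(δ / 2)) / (δ / 2)) =
            c * (4 / δ) * r ^ (δ / 2) := by
          have : r ^ δ * r ^ (-(δ / 2)) = r ^ (δ / 2) := by
            rw [← Real.rpow_add hr]; congr 1; ring
          calc _ = c * (r ^ (δ / 2) / (δ / 2)) + c * ((r ^ δ * r ^ (-(δ / 2))) / (δ / 2)) := by ring
            _ = _ := by rw [this]; field_simp; norm_num
        rw [h1]
        calc _ = ENNReal.ofReal (2 ^ n * V * C₁ * α ^ (2 * n + δ / 2)) *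
              ENNReal.ofReal (c * (4 / δ) * r ^ (δ / 2)) * N ^ 2 := by ring
          _ ≤ _ := by
            rw [← ENNReal.ofReal_mul (by positivity)]
            gcongr ENNReal.ofReal ?_ * _
            calc _ = 2 ^ n * V * C₁ * c * (4 / δ) * α ^ (2 * n + δ / 2) * r ^ (δ / 2) := by ring
              _ ≤ _ := by gcongr; linarith

end IsRegularKernel
end Atom

/-! ### The weak type `(1, 1)` bound -/

section WeakType

variable {n : ℕ} {𝕜 : Type*} [RCLike 𝕜]

/-- Minkowski's inequality in `L²` for countable sums of nonnegative functions. -/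
theorem lintegral_tsum_sq_rpow_le {X ι : Type*} [MeasurableSpace X] [Countable ι] (μ : Measure X)
    {f : ι → X → ℝ≥0∞} (hf : ∀ i, Measurable (f i)) :
    (∫⁻ x, (∑' i, f i x) ^ 2 ∂μ) ^ (1 / 2 : ℝ) ≤ ∑' i, (∫⁻ x, f i x ^ 2 ∂μ) ^ (1 / 2 : ℝ) := by
  classical
  have hfin : ∀ s : Finset ι, (∫⁻ x, (∑ i ∈ s, f i x) ^ 2 ∂μ) ^ (1 / 2 : ℝ) ≤
      ∑ i ∈ s, (∫⁻ x, f i x ^ 2 ∂μ) ^ (1 / 2 : ℝ) := fun s => by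
    induction s using Finset.induction_on with
    | empty => simp
    | insert i s hi ih =>
      simp only [Finset.sum_insert hi]
      have h := ENNReal.lintegral_Lp_add_le (μ := μ) (hf i).aemeasurable
        (Finset.measurable_sum s fun i _ => hf i).aemeasurable (p := 2) (by norm_num)
      simp only [Pi.add_apply, ENNReal.rpow_ofNat] at h
      exact h.trans (by gcongr)
  have hsup : ∫⁻ x, (∑' i, f i x) ^ 2 ∂μ = ⨆ s : Finset ι, ∫⁻ x, (∑ i ∈ s, f i x) ^ 2 ∂μ := by
    rw [← lintegral_iSup_directed]
    · simp_rw [ENNReal.tsum_eq_iSup_sum, ENNReal.iSup_pow]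
    · exact fun s => ((Finset.measurable_fun_sum s fun i _ => hf i).pow_const 2).aemeasurable
    · refine Monotone.directed_le fun s s' hss x => ?_
      exact pow_le_pow_left' (Finset.sum_le_sum_of_subset hss) 2
  rw [← ENNReal.le_rpow_inv_iff (by norm_num)]
  rw [hsup]
  refine iSup_le fun s => ?_
  rw [ENNReal.le_rpow_inv_iff (by norm_num)]
  exact (hfin s).trans (ENNReal.sum_le_tsum s)

theorem squareInt_tsum_rpow_le (Φ : 𝓢(EuclideanSpace ℝ (Fin n), ℝ)) (α : ℝ) {ι : Type*}
    [Countable ι] {F : ι → EuclideanSpace ℝ (Fin n) × ℝ → ℝ≥0∞} (hF : ∀ i, Measurable (F i))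
    (x : EuclideanSpace ℝ (Fin n)) :
    squareInt Φ α (fun p => ∑' i, F i p) x ^ (1 / 2 : ℝ) ≤
      ∑' i, squareInt Φ α (F i) x ^ (1 / 2 : ℝ) := by
  have hK : Measurable fun p : EuclideanSpace ℝ (Fin n) × ℝ =>
      ENNReal.ofReal (Φ ((p.2 * α)⁻¹ • (x - p.1))) / ENNReal.ofReal (p.2 ^ (n + 1)) :=
    ((measurable_cutoff Φ α).comp (measurable_prodMk_left (x := x))).div (by fun_prop)
  have key : ∀ G : EuclideanSpace ℝ (Fin n) × ℝ → ℝ≥0∞, Measurable G → squareInt Φ α G x =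
      ∫⁻ p, G p ^ 2 ∂((volume.restrict (univ ×ˢ Ioi (0 : ℝ))).withDensity fun p =>
        ENNReal.ofReal (Φ ((p.2 * α)⁻¹ • (x - p.1))) / ENNReal.ofReal (p.2 ^ (n + 1))) :=
    fun G hG => by
      rw [lintegral_withDensity_eq_lintegral_mul _ hK (hG.pow_const 2), squareInt]
      refine lintegral_congr fun p => ?_
      simp only [Pi.mul_apply, div_eq_mul_inv]
      ring
  rw [key _ (Measurable.tsum hF)]
  simp_rw [key _ (hF _)]
  exact lintegral_tsum_sq_rpow_le _ hF

namespace IsRegularKernel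

variable {ψ : EuclideanSpace ℝ (Fin n) → 𝕜} {c δ : ℝ} {Φ : 𝓢(EuclideanSpace ℝ (Fin n), ℝ)}

/-- The square function of an atom is integrable away from the `α`-fold dilate of its supporting
ball: the weighted `L²` bound and the Cauchy–Schwarz inequality. -/
theorem exists_lintegral_squareInt_atom_le (hψ : IsRegularKernel ψ c δ) (hΦ : IsCutoff Φ) :
    ∃ C : ℝ, 0 < C ∧ ∀ (b : EuclideanSpace ℝ (Fin n) → 𝕜), Measurable b → Integrable b →
      ∀ (z : EuclideanSpace ℝ (Fin n)) (r : ℝ), 0 < r → (∀ x, r < ‖x - z‖ → b x = 0) →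
      ∫ x, b x = 0 → ∀ α : ℝ, 1 ≤ α →
      ∫⁻ x in {x | 6 * α * r < ‖x - z‖},
          squareInt Φ α (fun p => ‖dilConv ψ b p.2 p.1‖ₑ) x ^ (1 / 2 : ℝ) ≤
        ENNReal.ofReal (C * α ^ n) * ∫⁻ x, ‖b x‖ₑ := by
  have hδ := hψ.exponent_pos
  obtain ⟨C₁, hC₁, H₁⟩ := hψ.exists_lintegral_rpow_mul_squareInt_atom_le hΦ
  obtain ⟨C₂, hC₂, H₂⟩ := lintegral_indicator_norm_rpow_le (n := n) (η := δ / 2) (by positivity)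
  refine ⟨√(C₁ * C₂), by positivity, fun b hbm hb z r hr hsupp hmean α hα => ?_⟩
  have hα0 : 0 < α := by linarith
  have hR : 0 < 6 * α * r := by positivity
  have h₁ := H₁ b hbm hb z r hr hsupp hmean α hα
  have h₂ := H₂ z (6 * α * r) hR
  set A : Set (EuclideanSpace ℝ (Fin n)) := {x | 6 * α * r < ‖x - z‖} with hA
  have hAm : MeasurableSet A := measurableSet_lt (by fun_prop) (by fun_prop)
  set S := squareInt Φ α (fun p => ‖dilConv ψ b p.2 p.1‖ₑ) with hS
  have hSm : Measurable S :=
    measurable_squareInt Φ α (measurable_dilConv hψ.measurable hbm).enorm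
  set N := ∫⁻ x, ‖b x‖ₑ
  have h₁' : ∫⁻ x in A, ENNReal.ofReal (‖x - z‖ ^ (n + δ / 2)) * S x ≤
      ENNReal.ofReal (C₁ * α ^ (2 * n + δ / 2) * r ^ (δ / 2)) * N ^ 2 := by
    refine le_trans (le_of_eq ?_) h₁
    rw [← lintegral_indicator hAm]
    refine lintegral_congr fun x => ?_
    by_cases hx : x ∈ A <;> simp [hx]
  calc ∫⁻ x in A, S x ^ (1 / 2 : ℝ)
      = ∫⁻ x in A, ((fun x => (ENNReal.ofReal (‖x - z‖ ^ (n + δ / 2)) * S x) ^ (1 / 2 : ℝ)) *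
          fun x => ENNReal.ofReal (‖x - z‖ ^ (-(n + δ / 2))) ^ (1 / 2 : ℝ)) x := by
        refine setLIntegral_congr_fun hAm fun x hx => ?_
        have hx0 : 0 < ‖x - z‖ := hR.trans hx
        simp only [Pi.mul_apply]
        rw [← ENNReal.mul_rpow_of_nonneg _ _ (by norm_num), mul_right_comm,
          ← ENNReal.ofReal_mul (by positivity), ← Real.rpow_add hx0]
        simp
    _ ≤ (∫⁻ x in A, ENNReal.ofReal (‖x - z‖ ^ (n + δ / 2)) * S x) ^ (1 / 2 : ℝ) *
          (∫⁻ x in A, ENNReal.ofReal (‖x - z‖ ^ (-(n + δ / 2)))) ^ (1 / 2 : ℝ) := by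
        refine (ENNReal.lintegral_mul_le_Lp_mul_Lq (volume.restrict A)
          Real.HolderConjugate.two_two (by fun_prop) (by fun_prop)).trans (le_of_eq ?_)
        simp_rw [← ENNReal.rpow_mul]
        norm_num
    _ ≤ (ENNReal.ofReal (C₁ * α ^ (2 * n + δ / 2) * r ^ (δ / 2)) * N ^ 2) ^ (1 / 2 : ℝ) *
          ENNReal.ofReal (C₂ * (6 * α * r) ^ (-(δ / 2))) ^ (1 / 2 : ℝ) := by gcongr
    _ ≤ (ENNReal.ofReal (√(C₁ * C₂) * α ^ n) ^ 2 * N ^ 2) ^ (1 / 2 : ℝ) := by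
        rw [← ENNReal.mul_rpow_of_nonneg _ _ (by norm_num), mul_right_comm,
          ← ENNReal.ofReal_mul (by positivity), ← ENNReal.ofReal_pow (by positivity)]
        gcongr (ENNReal.ofReal ?_ * _) ^ _
        rw [mul_pow, Real.sq_sqrt (by positivity), mul_assoc, mul_comm 6 α, mul_assoc α,
          Real.mul_rpow hα0.le (by positivity), Real.mul_rpow (by norm_num) hr.le]
        have h3 : α ^ (2 * n + δ / 2) * α ^ (-(δ / 2)) = (α ^ n) ^ 2 := by
          rw [← Real.rpow_add hα0, ← pow_mul, ← Real.rpow_natCast]; congr 1; push_cast; ring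
        have h4 : r ^ (δ / 2) * r ^ (-(δ / 2)) = 1 := by
          rw [← Real.rpow_add hr]; simp
        have h5 : (6 : ℝ) ^ (-(δ / 2)) ≤ 1 :=
          Real.rpow_le_one_of_one_le_of_nonpos (by norm_num) (by linarith)
        calc _ = C₁ * C₂ * (α ^ (2 * n + δ / 2) * α ^ (-(δ / 2))) *
              (r ^ (δ / 2) * r ^ (-(δ / 2))) * 6 ^ (-(δ / 2)) := by ring
          _ ≤ C₁ * C₂ * (α ^ (2 * n + δ / 2) * α ^ (-(δ / 2))) *
              (r ^ (δ / 2) * r ^ (-(δ / 2))) * 1 := by gcongr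
          _ = _ := by rw [h3, h4]; ring
    _ = _ := by
        rw [← mul_pow, ← ENNReal.rpow_natCast, ← ENNReal.rpow_mul]
        norm_num

/-- The square function is bounded on `L²`, with norm growing like `α ^ (n / 2)`. -/
theorem exists_lintegral_squareInt_le (hψ : IsRegularKernel ψ c δ) (hΦ : IsCutoff Φ) :
    ∃ C : ℝ, 0 < C ∧ ∀ (g : EuclideanSpace ℝ (Fin n) → 𝕜), Measurable g → Integrable g →
      MemLp g 2 → ∀ α : ℝ, 1 ≤ α →
      ∫⁻ x, squareInt Φ α (fun p => ‖dilConv ψ g p.2 p.1‖ₑ) x ≤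
        ENNReal.ofReal (C * α ^ n) * ∫⁻ x, ‖g x‖ₑ ^ 2 := by
  obtain ⟨K, hK, H⟩ := hψ.exists_lintegral_dilConv_sq_le
  set V := (volume (Metric.ball (0 : EuclideanSpace ℝ (Fin n)) 1)).toReal with hV
  have hV0 : 0 ≤ V := by positivity
  have hVe : volume (Metric.ball (0 : EuclideanSpace ℝ (Fin n)) 1) = ENNReal.ofReal V :=
    (ENNReal.ofReal_toReal measure_ball_lt_top.ne).symm
  refine ⟨2 ^ n * (V + 1) * K, by positivity, fun g hgm hg hg2 α hα => ?_⟩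
  have hα0 : 0 < α := by linarith
  have hFm := measurable_dilConv hψ.measurable hgm
  have h1 := lintegral_mul_squareInt Φ α hFm.enorm (w := fun _ => 1) measurable_const
  simp only [one_mul] at h1
  rw [h1]
  calc _ ≤ ∫⁻ t in Ioi (0 : ℝ), ENNReal.ofReal ((2 * α) ^ n * V) *
        (ENNReal.ofReal t⁻¹ * ∫⁻ y, ‖dilConv ψ g t y‖ₑ ^ 2) := by
        refine setLIntegral_mono' measurableSet_Ioi fun t ht => ?_
        have ht' : 0 < t := ht
        have hFt : Measurable fun y => ‖dilConv ψ g t y‖ₑ :=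
          hFm.enorm.comp (measurable_prodMk_right (y := t))
        rw [← mul_assoc, ← lintegral_const_mul _ (hFt.pow_const 2)]
        refine lintegral_mono fun y => ?_
        calc _ ≤ ENNReal.ofReal ((2 * (t * α)) ^ n) * ENNReal.ofReal V *
              (‖dilConv ψ g t y‖ₑ ^ 2 / ENNReal.ofReal (t ^ (n + 1))) := by
              gcongr ?_ * _
              rw [← hVe]
              exact hΦ.lintegral_le (by positivity) y
          _ = ENNReal.ofReal ((2 * (t * α)) ^ n) * ENNReal.ofReal V *
              ENNReal.ofReal (t ^ (n + 1))⁻¹ * ‖dilConv ψ g t y‖ₑ ^ 2 := by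
              rw [ENNReal.ofReal_inv_of_pos (by positivity), div_eq_mul_inv]; ring
          _ = _ := by
              rw [← ENNReal.ofReal_mul (by positivity), ← ENNReal.ofReal_mul (by positivity),
                ← ENNReal.ofReal_mul (by positivity)]
              congr 2
              simp only [mul_pow, pow_succ]
              field_simp
    _ = ENNReal.ofReal ((2 * α) ^ n * V) *
        ∫⁻ t in Ioi (0 : ℝ), ENNReal.ofReal t⁻¹ * ∫⁻ y, ‖dilConv ψ g t y‖ₑ ^ 2 :=
        lintegral_const_mul' _ _ ENNReal.ofReal_ne_top
    _ ≤ ENNReal.ofReal ((2 * α) ^ n * V) * (ENNReal.ofReal K * ∫⁻ x, ‖g x‖ₑ ^ 2) := by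
        gcongr
        exact H g hgm hg hg2
    _ ≤ _ := by
        rw [← mul_assoc, ← ENNReal.ofReal_mul (by positivity)]
        gcongr ENNReal.ofReal ?_ * _
        rw [mul_pow]
        calc _ = 2 ^ n * V * K * α ^ n := by ring
          _ ≤ _ := by gcongr; linarith

end IsRegularKernel
end WeakType

section WeakTypeBound

variable {n : ℕ} {𝕜 : Type*} [RCLike 𝕜]

namespace IsRegularKernel

variable {ψ : EuclideanSpace ℝ (Fin n) → 𝕜} {c δ : ℝ} {Φ : 𝓢(EuclideanSpace ℝ (Fin n), ℝ)}

theorem enorm_dilConv_le_add_tsum (hψ : IsRegularKernel ψ c δ) {ι : Type} [Countable ι]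
    {u g : EuclideanSpace ℝ (Fin n) → 𝕜} {b : ι → EuclideanSpace ℝ (Fin n) → 𝕜}
    (hg : Integrable g) (hb : ∀ i, Measurable (b i)) (hu : Integrable u)
    (hsum : ∀ x, HasSum (fun i => b i x) (u x - g x)) (hfin : ∑' i, ∫⁻ x, ‖b i x‖ₑ ≠ ∞)
    {t : ℝ} (ht : 0 < t) (y : EuclideanSpace ℝ (Fin n)) :
    ‖dilConv ψ u t y‖ₑ ≤ ‖dilConv ψ g t y‖ₑ + ∑' i, ‖dilConv ψ (b i) t y‖ₑ := by
  have h1 : dilConv ψ u t y = dilConv ψ g t y + ∫ z, (u z - g z) * dilate ψ t (y - z) := by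
    simp only [sub_mul]
    rw [integral_sub (hψ.integrable_mul_dilate ht hu y) (hψ.integrable_mul_dilate ht hg y),
      dilConv_apply, dilConv_apply]
    ring
  have hdm : Measurable fun z => dilate ψ t (y - z) :=
    (measurable_dilate hψ.measurable t).comp (by fun_prop)
  have h2 : ∫ z, (u z - g z) * dilate ψ t (y - z) = ∑' i, dilConv ψ (b i) t y := by
    have h3 : ∀ z, (u z - g z) * dilate ψ t (y - z) = ∑' i, b i z * dilate ψ t (y - z) :=
      fun z => ((hsum z).mul_right _).tsum_eq.symm
    simp_rw [h3]
    refine integral_tsum (fun i => ((hb i).mul hdm).aestronglyMeasurable) ?_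
    · refine ne_top_of_le_ne_top (ENNReal.mul_ne_top (a := ENNReal.ofReal (c * (t ^ n)⁻¹))
        ENNReal.ofReal_ne_top hfin) ?_
      rw [← ENNReal.tsum_mul_left]
      refine ENNReal.tsum_le_tsum fun i => ?_
      refine le_trans (le_of_eq ?_) (hψ.absConv_le ht (b i) y)
      simp only [absConv, enorm_mul]
  rw [h1, h2]
  exact (enorm_add_le _ _).trans (by gcongr; exact enorm_tsum_le_tsum_enorm)

/-- The weak type `(1, 1)` bound for the square function, with norm growing like `α ^ n`. With
the Calderón–Zygmund decomposition taken at height `τ`, the good part, the `α`-fold dilates of the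
bad balls and the bad part outside them each cost one factor `α ^ n`. -/
theorem exists_volume_squareInt_gt_le (hn : 1 ≤ n) (hψ : IsRegularKernel ψ c δ)
    (hΦ : IsCutoff Φ) :
    ∃ C : ℝ, 0 < C ∧ ∀ (u : EuclideanSpace ℝ (Fin n) → 𝕜), Measurable u → Integrable u →
      ∀ α : ℝ, 1 ≤ α → ∀ τ : ℝ, 0 < τ →
      volume {x | ENNReal.ofReal (τ ^ 2) < squareInt Φ α (fun p => ‖dilConv ψ u p.2 p.1‖ₑ) x} ≤
        ENNReal.ofReal (C * α ^ n / τ) * ∫⁻ x, ‖u x‖ₑ := by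
  obtain ⟨C₁, hC₁, H₁⟩ := hψ.exists_lintegral_squareInt_le hΦ
  obtain ⟨C₂, hC₂, H₂⟩ := hψ.exists_lintegral_squareInt_atom_le hΦ
  set V := (volume (Metric.ball (0 : EuclideanSpace ℝ (Fin n)) 1)).toReal with hV
  have hV0 : 0 ≤ V := by positivity
  have hVe : volume (Metric.ball (0 : EuclideanSpace ℝ (Fin n)) 1) = ENNReal.ofReal V :=
    (ENNReal.ofReal_toReal measure_ball_lt_top.ne).symm
  refine ⟨4 * C₁ * 2 ^ n + 6 ^ n * V * (√n + 1) ^ n + 4 * C₂, by positivity,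
    fun u hum hu α hα τ hτ => ?_⟩
  have hα0 : 0 < α := by linarith
  obtain ⟨ι, hι, g, b, z, r, hgm, hbm, hr, hsupp, hmean, hsum, hg1, hg2, hb1, hball⟩ :=
    exists_calderonZygmund hn hum hu hτ
  set N := ∫⁻ x, ‖u x‖ₑ with hN
  have hNfin : N < ∞ := hu.2
  have hg : Integrable g := ⟨hgm.aestronglyMeasurable, hg1.trans_lt hNfin⟩
  have hbfin : ∑' q, ∫⁻ x, ‖b q x‖ₑ ≠ ∞ :=
    ne_top_of_le_ne_top (ENNReal.mul_ne_top (by norm_num) hNfin.ne) hb1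
  have hb : ∀ q, Integrable (b q) := fun q =>
    ⟨(hbm q).aestronglyMeasurable, lt_top_iff_ne_top.2 (ENNReal.ne_top_of_tsum_ne_top hbfin q)⟩
  have hgsq : ∫⁻ x, ‖g x‖ₑ ^ 2 ≤ ENNReal.ofReal (2 ^ n * τ) * N := by
    calc ∫⁻ x, ‖g x‖ₑ ^ 2 ≤ ∫⁻ x, ENNReal.ofReal (2 ^ n * τ) * ‖g x‖ₑ := by
          refine lintegral_mono_ae ?_
          filter_upwards [hg2] with x hx
          rw [sq]
          gcongr
      _ = ENNReal.ofReal (2 ^ n * τ) * ∫⁻ x, ‖g x‖ₑ := lintegral_const_mul _ hgm.enorm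
      _ ≤ _ := by gcongr
  have hgL2 : MemLp g 2 := by
    refine ⟨hgm.aestronglyMeasurable, ?_⟩
    have : eLpNorm g 2 volume ^ 2 < ∞ := by
      rw [eLpNorm_two_sq]
      exact hgsq.trans_lt (ENNReal.mul_lt_top ENNReal.ofReal_lt_top hNfin)
    exact (ENNReal.pow_lt_top_iff.1 this).resolve_right (by norm_num)
  set Sg := squareInt Φ α (fun p => ‖dilConv ψ g p.2 p.1‖ₑ) with hSg
  set Sb := fun q => squareInt Φ α (fun p => ‖dilConv ψ (b q) p.2 p.1‖ₑ) with hSb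
  have hFb : ∀ q, Measurable fun p : EuclideanSpace ℝ (Fin n) × ℝ =>
      ‖dilConv ψ (b q) p.2 p.1‖ₑ := fun q => (measurable_dilConv hψ.measurable (hbm q)).enorm
  have hSgm : Measurable Sg :=
    measurable_squareInt Φ α (measurable_dilConv hψ.measurable hgm).enorm
  have hSbm : ∀ q, Measurable (Sb q) := fun q => measurable_squareInt Φ α (hFb q)
  have hdom : ∀ x, squareInt Φ α (fun p => ‖dilConv ψ u p.2 p.1‖ₑ) x ≤
      2 * Sg x + 2 * (∑' q, Sb q x ^ (1 / 2 : ℝ)) ^ 2 := fun x => by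
    calc _ ≤ squareInt Φ α
          (fun p => ‖dilConv ψ g p.2 p.1‖ₑ + ∑' q, ‖dilConv ψ (b q) p.2 p.1‖ₑ) x :=
          squareInt_mono Φ α
            (fun p hp => hψ.enorm_dilConv_le_add_tsum hg hbm hu hsum hbfin hp p.1) x
      _ ≤ 2 * Sg x + 2 * squareInt Φ α (fun p => ∑' q, ‖dilConv ψ (b q) p.2 p.1‖ₑ) x :=
          squareInt_add_le Φ α (measurable_dilConv hψ.measurable hgm).enorm _ x
      _ ≤ _ := by
          gcongr
          have h := pow_le_pow_left' (squareInt_tsum_rpow_le Φ α hFb x) 2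
          rwa [← ENNReal.rpow_natCast (_ ^ (1 / 2 : ℝ)), ← ENNReal.rpow_mul,
            show (1 / 2 : ℝ) * ((2 : ℕ) : ℝ) = 1 by norm_num, ENNReal.rpow_one] at h
  -- The exceptional sets of the good part, of the dilated bad balls, and of the bad part.
  set E₁ := {x | ENNReal.ofReal (τ ^ 2 / 4) ≤ Sg x} with hE₁
  set E₂ := ⋃ q, Metric.closedBall (z q) (6 * α * r q) with hE₂
  set T := fun x => ∑' q, {x | 6 * α * r q < ‖x - z q‖}.indicator
    (fun x => Sb q x ^ (1 / 2 : ℝ)) x with hT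
  have hAm : ∀ q, MeasurableSet {x : EuclideanSpace ℝ (Fin n) | 6 * α * r q < ‖x - z q‖} :=
    fun q => measurableSet_lt (by fun_prop) (by fun_prop)
  have hTqm : ∀ q, Measurable ({x | 6 * α * r q < ‖x - z q‖}.indicator
      (fun x => Sb q x ^ (1 / 2 : ℝ))) := fun q =>
    ((hSbm q).pow_const _).indicator (hAm q)
  set E₃ := {x | ENNReal.ofReal (τ / 2) ≤ T x} with hE₃
  have hcover : {x | ENNReal.ofReal (τ ^ 2) <
      squareInt Φ α (fun p => ‖dilConv ψ u p.2 p.1‖ₑ) x} ⊆ E₁ ∪ (E₂ ∪ E₃) := fun x hx => by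
    by_contra hcon
    simp only [Set.mem_union, not_or] at hcon
    obtain ⟨h1, h2, h3⟩ := hcon
    have h1' : Sg x < ENNReal.ofReal (τ ^ 2 / 4) := not_le.1 h1
    have h3' : T x < ENNReal.ofReal (τ / 2) := not_le.1 h3
    have hTx : T x = ∑' q, Sb q x ^ (1 / 2 : ℝ) := by
      refine tsum_congr fun q => indicator_of_mem ?_ _
      rw [hE₂, Set.mem_iUnion, not_exists] at h2
      have := h2 q
      rwa [Metric.mem_closedBall, not_le, dist_eq_norm] at this
    have : squareInt Φ α (fun p => ‖dilConv ψ u p.2 p.1‖ₑ) x ≤ ENNReal.ofReal (τ ^ 2) := by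
      calc _ ≤ 2 * Sg x + 2 * T x ^ 2 := by rw [hTx]; exact hdom x
        _ ≤ 2 * ENNReal.ofReal (τ ^ 2 / 4) + 2 * ENNReal.ofReal (τ / 2) ^ 2 := by gcongr
        _ = _ := by
          rw [← ENNReal.ofReal_pow (by positivity), ← ENNReal.ofReal_ofNat 2,
            ← ENNReal.ofReal_mul (by positivity), ← ENNReal.ofReal_mul (by positivity),
            ← ENNReal.ofReal_add (by positivity) (by positivity)]
          congr 1
          ring
    exact absurd hx (not_lt.2 this)
  have hm₁ : volume E₁ ≤ ENNReal.ofReal (4 * C₁ * 2 ^ n * α ^ n / τ) * N := by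
    refine (meas_ge_le_lintegral_div hSgm.aemeasurable
      (ENNReal.ofReal_pos.2 (by positivity)).ne' ENNReal.ofReal_ne_top).trans ?_
    rw [div_eq_mul_inv, ← ENNReal.ofReal_inv_of_pos (by positivity)]
    calc _ ≤ ENNReal.ofReal (C₁ * α ^ n) * (ENNReal.ofReal (2 ^ n * τ) * N) *
          ENNReal.ofReal (τ ^ 2 / 4)⁻¹ := by
          gcongr ?_ * _
          exact (H₁ g hgm hg hgL2 α hα).trans (by gcongr)
      _ = ENNReal.ofReal (C₁ * α ^ n) * ENNReal.ofReal (2 ^ n * τ) *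
          ENNReal.ofReal (τ ^ 2 / 4)⁻¹ * N := by ring
      _ = _ := by
          rw [← ENNReal.ofReal_mul (by positivity), ← ENNReal.ofReal_mul (by positivity)]
          congr 2
          field_simp
  have hm₂ : volume E₂ ≤ ENNReal.ofReal (6 ^ n * V * (√n + 1) ^ n * α ^ n / τ) * N := by
    calc volume E₂ ≤ ∑' q, volume (Metric.closedBall (z q) (6 * α * r q)) := measure_iUnion_le _
      _ = ∑' q, ENNReal.ofReal (6 ^ n * α ^ n * V / τ) * ENNReal.ofReal (r q ^ n * τ) := by
          refine tsum_congr fun q => ?_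
          have := hr q
          rw [Measure.addHaar_closedBall _ _ (by positivity), hVe, finrank_euclideanSpace,
            Fintype.card_fin, ← ENNReal.ofReal_mul (by positivity),
            ← ENNReal.ofReal_mul (by positivity), mul_pow, mul_pow]
          congr 1
          field_simp
      _ = ENNReal.ofReal (6 ^ n * α ^ n * V / τ) * ∑' q, ENNReal.ofReal (r q ^ n * τ) :=
          ENNReal.tsum_mul_left
      _ ≤ ENNReal.ofReal (6 ^ n * α ^ n * V / τ) * (ENNReal.ofReal ((√n + 1) ^ n) * N) := by
          gcongr
      _ = _ := by
          rw [← mul_assoc, ← ENNReal.ofReal_mul (by positivity)]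
          congr 2
          ring
  have hm₃ : volume E₃ ≤ ENNReal.ofReal (4 * C₂ * α ^ n / τ) * N := by
    refine (meas_ge_le_lintegral_div (Measurable.tsum hTqm).aemeasurable
      (ENNReal.ofReal_pos.2 (by positivity)).ne' ENNReal.ofReal_ne_top).trans ?_
    rw [div_eq_mul_inv, ← ENNReal.ofReal_inv_of_pos (by positivity),
      lintegral_tsum fun q => (hTqm q).aemeasurable]
    calc _ ≤ (∑' q, ENNReal.ofReal (C₂ * α ^ n) * ∫⁻ x, ‖b q x‖ₑ) *
          ENNReal.ofReal (τ / 2)⁻¹ := by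
          gcongr ?_ * _
          refine ENNReal.tsum_le_tsum fun q => ?_
          rw [lintegral_indicator (hAm q)]
          exact H₂ (b q) (hbm q) (hb q) (z q) (r q) (hr q) (hsupp q) (hmean q) α hα
      _ ≤ ENNReal.ofReal (C₂ * α ^ n) * (2 * N) * ENNReal.ofReal (τ / 2)⁻¹ := by
          rw [ENNReal.tsum_mul_left]
          gcongr
      _ = ENNReal.ofReal (C₂ * α ^ n) * 2 * ENNReal.ofReal (τ / 2)⁻¹ * N := by ring
      _ = _ := by
          rw [← ENNReal.ofReal_ofNat 2, ← ENNReal.ofReal_mul (by positivity),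
            ← ENNReal.ofReal_mul (by positivity)]
          congr 2
          field_simp
          norm_num
  calc _ ≤ volume (E₁ ∪ (E₂ ∪ E₃)) := measure_mono hcover
    _ ≤ volume E₁ + (volume E₂ + volume E₃) :=
        (measure_union_le _ _).trans (by gcongr; exact measure_union_le _ _)
    _ ≤ _ := by
        refine (add_le_add hm₁ (add_le_add hm₂ hm₃)).trans (le_of_eq ?_)
        rw [← add_mul, ← add_mul, ← ENNReal.ofReal_add (by positivity) (by positivity),
          ← ENNReal.ofReal_add (by positivity) (by positivity)]
        congr 2
        ring

end IsRegularKernel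
end WeakTypeBound

/-! ### Functions with controlled averages over dilated cubes -/

section CubeGrowth

variable {n : ℕ} {𝕜 : Type*} [RCLike 𝕜]

theorem cube_mono (z : EuclideanSpace ℝ (Fin n)) {a b : ℝ} (h : a ≤ b) : cube z a ⊆ cube z b :=
  fun _ hx i => (hx i).trans (by linarith)

theorem exists_mem_cube (z : EuclideanSpace ℝ (Fin n)) {ℓ : ℝ} (hℓ : 0 < ℓ)
    (x : EuclideanSpace ℝ (Fin n)) (r : ℝ) :
    ∃ j : ℕ, x ∈ cube z (2 ^ j * ℓ) ∧ r ≤ 2 ^ j * ℓ := by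
  obtain ⟨j, hj⟩ := pow_unbounded_of_one_lt ((2 * ‖x - z‖ + |r|) / ℓ) (one_lt_two (α := ℝ))
  rw [div_lt_iff₀ hℓ] at hj
  have h0 := norm_nonneg (x - z)
  refine ⟨j, fun i => ?_, ?_⟩
  · have := abs_apply_le_norm (x - z) i
    rw [PiLp.sub_apply] at this
    linarith [abs_nonneg r]
  · linarith [le_abs_self r]

/-- Points inside and outside cubes of side lengths in ratio at least two are far apart. -/
theorem le_norm_sub_of_mem_cube {z x y : EuclideanSpace ℝ (Fin n)} {a b : ℝ} (hab : 2 * a ≤ b)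
    (hx : x ∉ cube z b) (hy : y ∈ cube z a) : b / 4 ≤ ‖y - x‖ := by
  simp only [cube, Set.mem_ofPred_eq, not_forall, not_le] at hx
  obtain ⟨i, hi⟩ := hx
  have h1 := hy i
  have h2 := abs_apply_le_norm (y - x) i
  rw [PiLp.sub_apply] at h2
  have h3 := abs_sub_abs_le_abs_sub (x i - z i) (y i - z i)
  rw [show x i - z i - (y i - z i) = -(y i - x i) by ring, abs_neg] at h3
  linarith

theorem norm_sub_le_of_mem_cube {z x y : EuclideanSpace ℝ (Fin n)} {ℓ : ℝ} (hℓ : 0 ≤ ℓ)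
    (hx : x ∈ cube z ℓ) (hy : y ∈ cube z ℓ) : ‖x - y‖ ≤ √n * ℓ := by
  refine norm_le_sqrt_mul hℓ fun i => ?_
  have h1 := hx i
  have h2 := hy i
  rw [PiLp.sub_apply, show x i - y i = (x i - z i) - (y i - z i) by ring]
  linarith [abs_sub (x i - z i) (y i - z i)]

/-- The averages of `|f|` over the cubes `2^j Q` are at most `s θ^j`. -/
def HasCubeGrowth (f : EuclideanSpace ℝ (Fin n) → 𝕜) (z : EuclideanSpace ℝ (Fin n))
    (ℓ s θ : ℝ) : Prop :=
  ∀ j : ℕ, ∫⁻ x in cube z (2 ^ j * ℓ), ‖f x‖ₑ ≤ ENNReal.ofReal (s * (2 ^ j * ℓ) ^ n * θ ^ j)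

theorem absConv_eq_add (ψ : EuclideanSpace ℝ (Fin n) → 𝕜) (f : EuclideanSpace ℝ (Fin n) → 𝕜)
    {A : Set (EuclideanSpace ℝ (Fin n))} (hA : MeasurableSet A) (t : ℝ)
    (y : EuclideanSpace ℝ (Fin n)) :
    absConv ψ f t y = absConv ψ (A.indicator f) t y + absConv ψ (Aᶜ.indicator f) t y := by
  have h : ∀ B : Set (EuclideanSpace ℝ (Fin n)), MeasurableSet B →
      absConv ψ (B.indicator f) t y = ∫⁻ z in B, ‖f z‖ₑ * ‖dilate ψ t (y - z)‖ₑ := by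
    intro B hB
    rw [← lintegral_indicator hB]
    refine lintegral_congr fun z => ?_
    by_cases hz : z ∈ B <;> simp [hz]
  rw [h A hA, h _ hA.compl, lintegral_add_compl _ hA]
  rfl

/-- The constant in the bound for the far part of the convolution. -/
noncomputable def farConst (n : ℕ) (c δ : ℝ) : ℝ :=
  c * 4 ^ (n + δ) * 2 ^ n * 2 ^ (δ / 2) / (2 ^ (δ / 2) - 1)

namespace IsRegularKernel

variable {ψ : EuclideanSpace ℝ (Fin n) → 𝕜} {c δ : ℝ} (hψ : IsRegularKernel ψ c δ)
include hψ

theorem one_lt_two_rpow : (1 : ℝ) < 2 ^ (δ / 2) :=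
  Real.one_lt_rpow one_lt_two (by have := hψ.exponent_pos; positivity)

theorem farConst_pos : 0 < farConst n c δ := by
  have := hψ.const_pos
  have := sub_pos.2 hψ.one_lt_two_rpow
  unfold farConst
  positivity

/-- The part of `f` outside `2^(k+1) Q` contributes little on `2^k Q`: sum over dyadic shells. -/
theorem absConv_compl_cube_le {f : EuclideanSpace ℝ (Fin n) → 𝕜} {z : EuclideanSpace ℝ (Fin n)}
    {ℓ s : ℝ} (hℓ : 0 < ℓ) (hs : 0 < s) (hf : HasCubeGrowth f z ℓ s (2 ^ (δ / 2)))
    (k : ℕ) {t : ℝ} (ht : 0 < t) {y : EuclideanSpace ℝ (Fin n)} (hy : y ∈ cube z (2 ^ k * ℓ)) :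
    absConv ψ ((cube z (2 ^ (k + 1) * ℓ))ᶜ.indicator f) t y ≤
      ENNReal.ofReal (farConst n c δ * s * (t / ℓ) ^ δ * ((2 ^ (δ / 2)) ^ k)⁻¹) := by
  have hc := hψ.const_pos
  have hδ := hψ.exponent_pos
  have hθ1 := hψ.one_lt_two_rpow
  set θ : ℝ := 2 ^ (δ / 2) with hθ
  have hθ0 : 0 < θ := by linarith
  have hθsq : ∀ j : ℕ, ((2 : ℝ) ^ j) ^ δ = θ ^ j * θ ^ j := fun j => by
    rw [← Real.rpow_natCast, ← Real.rpow_mul zero_le_two, ← pow_add, hθ, ← Real.rpow_natCast,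
      ← Real.rpow_mul zero_le_two]
    congr 1
    push_cast
    ring
  -- The dyadic shells outside `2^(k+1) Q`.
  set P : ℕ → Set (EuclideanSpace ℝ (Fin n)) := fun i =>
    cube z (2 ^ (k + 2 + i) * ℓ) \ cube z (2 ^ (k + 1 + i) * ℓ) with hP
  have hcover : (cube z (2 ^ (k + 1) * ℓ))ᶜ ⊆ ⋃ i, P i := by
    intro x hx
    obtain ⟨j, hj, -⟩ := exists_mem_cube z hℓ x 0
    classical
    have hex : ∃ i, x ∈ cube z (2 ^ (k + 1 + i) * ℓ) := by
      refine ⟨j, cube_mono z ?_ hj⟩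
      have : (2 : ℝ) ^ j ≤ 2 ^ (k + 1 + j) := pow_le_pow_right₀ one_le_two (by omega)
      gcongr
    have h0 : Nat.find hex ≠ 0 := fun h => hx (by simpa [h] using Nat.find_spec hex)
    obtain ⟨i, hi⟩ := Nat.exists_eq_succ_of_ne_zero h0
    refine mem_iUnion.2 ⟨i, ?_, Nat.find_min hex (by omega)⟩
    have := Nat.find_spec hex
    rwa [hi, show k + 1 + i.succ = k + 2 + i by omega] at this
  have hshell : ∀ i, ∫⁻ x in P i, ‖f x‖ₑ * ‖dilate ψ t (y - x)‖ₑ ≤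
      ENNReal.ofReal (c * 4 ^ (n + δ) * 2 ^ n * θ * s * (t / ℓ) ^ δ * (θ⁻¹ ^ (k + 1) * θ⁻¹ ^ i)) := by
    intro i
    have hr : 0 < 2 ^ (k + 1 + i) * ℓ / 4 := by positivity
    calc ∫⁻ x in P i, ‖f x‖ₑ * ‖dilate ψ t (y - x)‖ₑ
        ≤ ∫⁻ x in P i, ENNReal.ofReal (c * t ^ δ * (2 ^ (k + 1 + i) * ℓ / 4) ^ (-(n + δ))) *
            ‖f x‖ₑ := by
          refine setLIntegral_mono' ((measurableSet_cube _ _).diff (measurableSet_cube _ _))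
            fun x hx => ?_
          rw [mul_comm]
          gcongr
          rw [← ofReal_norm]
          refine ENNReal.ofReal_le_ofReal (hψ.norm_dilate_le_of_le_norm ht hr ?_)
          refine le_norm_sub_of_mem_cube ?_ hx.2 hy
          rw [← mul_assoc]
          have : 2 * (2 : ℝ) ^ k ≤ 2 ^ (k + 1 + i) := by
            rw [← pow_succ']
            exact pow_le_pow_right₀ one_le_two (by omega)
          gcongr
      _ = ENNReal.ofReal (c * t ^ δ * (2 ^ (k + 1 + i) * ℓ / 4) ^ (-(n + δ))) *
            ∫⁻ x in P i, ‖f x‖ₑ := lintegral_const_mul' _ _ ENNReal.ofReal_ne_top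
      _ ≤ ENNReal.ofReal (c * t ^ δ * (2 ^ (k + 1 + i) * ℓ / 4) ^ (-(n + δ))) *
            ENNReal.ofReal (s * (2 ^ (k + 2 + i) * ℓ) ^ n * θ ^ (k + 2 + i)) := by
          gcongr
          exact (lintegral_mono_set sdiff_subset).trans (hf (k + 2 + i))
      _ = _ := by
          rw [← ENNReal.ofReal_mul (by positivity)]
          congr 1
          rw [Real.rpow_neg hr.le, Real.div_rpow (by positivity) (by positivity),
            Real.rpow_add (x := 2 ^ (k + 1 + i) * ℓ) (by positivity), Real.rpow_natCast,
            Real.mul_rpow (z := δ) (by positivity) hℓ.le, hθsq, Real.div_rpow ht.le hℓ.le,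
            show k + 2 + i = (k + 1 + i) + 1 by omega, ← pow_add θ⁻¹ (k + 1) i, inv_pow,
            pow_succ (2 : ℝ), pow_succ θ, show (2 : ℝ) ^ (k + 1 + i) * 2 * ℓ =
              2 * (2 ^ (k + 1 + i) * ℓ) by ring, mul_pow 2]
          have := (Real.rpow_pos_of_pos hℓ δ).ne'
          field_simp
  have hsum : HasSum (fun i : ℕ => c * 4 ^ (n + δ) * 2 ^ n * θ * s * (t / ℓ) ^ δ *
      (θ⁻¹ ^ (k + 1) * θ⁻¹ ^ i)) (farConst n c δ * s * (t / ℓ) ^ δ * (θ ^ k)⁻¹) := by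
    have h := ((hasSum_geometric_of_lt_one (inv_nonneg.2 hθ0.le)
      (inv_lt_one_of_one_lt₀ hθ1)).mul_left (θ⁻¹ ^ (k + 1))).mul_left
        (c * 4 ^ (n + δ) * 2 ^ n * θ * s * (t / ℓ) ^ δ)
    have h1 : θ - 1 ≠ 0 := by linarith
    have h2 : 1 - θ⁻¹ = (θ - 1) / θ := by field_simp
    rw [h2] at h
    have h3 : farConst n c δ * s * (t / ℓ) ^ δ * (θ ^ k)⁻¹ = c * 4 ^ (n + δ) * 2 ^ n * θ * s *
        (t / ℓ) ^ δ * (θ⁻¹ ^ (k + 1) * ((θ - 1) / θ)⁻¹) := by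
      rw [farConst, ← hθ, inv_pow, pow_succ]
      field_simp
    rwa [h3]
  calc absConv ψ ((cube z (2 ^ (k + 1) * ℓ))ᶜ.indicator f) t y
      = ∫⁻ x in (cube z (2 ^ (k + 1) * ℓ))ᶜ, ‖f x‖ₑ * ‖dilate ψ t (y - x)‖ₑ := by
        rw [← lintegral_indicator (measurableSet_cube _ _).compl]
        refine lintegral_congr fun x => ?_
        by_cases hx : x ∈ cube z (2 ^ (k + 1) * ℓ) <;> simp [hx]
    _ ≤ ∫⁻ x in ⋃ i, P i, ‖f x‖ₑ * ‖dilate ψ t (y - x)‖ₑ := lintegral_mono_set hcover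
    _ ≤ ∑' i, ∫⁻ x in P i, ‖f x‖ₑ * ‖dilate ψ t (y - x)‖ₑ := lintegral_iUnion_le _ _
    _ ≤ ∑' i, ENNReal.ofReal (c * 4 ^ (n + δ) * 2 ^ n * θ * s * (t / ℓ) ^ δ *
          (θ⁻¹ ^ (k + 1) * θ⁻¹ ^ i)) := ENNReal.tsum_le_tsum hshell
    _ = _ := by
        rw [← ENNReal.ofReal_tsum_of_nonneg (fun i => by positivity) hsum.summable, hsum.tsum_eq]

/-- The square integral of `|f| * |ψ_t|` over large scales `t`. -/
theorem lintegral_absConv_sq_Ioi_le (hn : 1 ≤ n) {f : EuclideanSpace ℝ (Fin n) → 𝕜}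
    (hf : Measurable f) {a : ℝ} (ha : 0 < a) :
    ∫⁻ p in univ ×ˢ Ioi a, absConv ψ f p.2 p.1 ^ 2 / ENNReal.ofReal (p.2 ^ (n + 1)) ≤
      ENNReal.ofReal (c ^ 2 * (a ^ n)⁻¹ ^ 2) * (∫⁻ x, ‖f x‖ₑ) ^ 2 := by
  have hc := hψ.const_pos
  have hm : Measurable fun p : EuclideanSpace ℝ (Fin n) × ℝ =>
      absConv ψ f p.2 p.1 ^ 2 / ENNReal.ofReal (p.2 ^ (n + 1)) := by
    have := measurable_absConv hψ.measurable hf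
    fun_prop
  rw [Measure.volume_eq_prod, ← Measure.prod_restrict, Measure.restrict_univ,
    lintegral_prod_symm _ hm.aemeasurable]
  have hn' : (1 : ℝ) ≤ n := by exact_mod_cast hn
  calc ∫⁻ t in Ioi a, ∫⁻ y, absConv ψ f t y ^ 2 / ENNReal.ofReal (t ^ (n + 1))
      ≤ ∫⁻ t in Ioi a, ENNReal.ofReal (c ^ 2) * (∫⁻ x, ‖f x‖ₑ) ^ 2 *
          ENNReal.ofReal (t ^ (-(2 * n : ℝ) - 1)) := by
        refine setLIntegral_mono' measurableSet_Ioi fun t hta => ?_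
        have ht : 0 < t := ha.trans hta
        simp_rw [div_eq_mul_inv]
        rw [lintegral_mul_const' _ _ (ENNReal.inv_ne_top.2
          (ENNReal.ofReal_pos.2 (by positivity)).ne')]
        calc _ ≤ (ENNReal.ofReal (c ^ 2 * (t ^ n)⁻¹) * (∫⁻ x, ‖f x‖ₑ) ^ 2) *
            (ENNReal.ofReal (t ^ (n + 1)))⁻¹ := by
              gcongr ?_ * _
              exact hψ.lintegral_absConv_sq_le ht hf
          _ = _ := by
              rw [← ENNReal.ofReal_inv_of_pos (by positivity), ENNReal.ofReal_mul (by positivity),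
                mul_assoc, mul_assoc, mul_left_comm (ENNReal.ofReal (t ^ n)⁻¹),
                ← ENNReal.ofReal_mul (by positivity), ← mul_assoc]
              congr 2
              rw [Real.rpow_sub ht, Real.rpow_neg ht.le, Real.rpow_one,
                show (2 * n : ℝ) = ((2 * n : ℕ) : ℝ) by push_cast; ring, Real.rpow_natCast]
              field_simp
              ring
    _ = ENNReal.ofReal (c ^ 2) * (∫⁻ x, ‖f x‖ₑ) ^ 2 *
          ENNReal.ofReal (a ^ (-(2 * n : ℝ)) / (2 * n)) := by
        rw [lintegral_const_mul _ (by fun_prop), lintegral_Ioi_rpow_eq ha (by positivity)]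
    _ ≤ ENNReal.ofReal (c ^ 2) * (∫⁻ x, ‖f x‖ₑ) ^ 2 * ENNReal.ofReal ((a ^ n)⁻¹ ^ 2) := by
        gcongr _ * ENNReal.ofReal ?_
        rw [Real.rpow_neg ha.le, show (2 * n : ℝ) = ((n * 2 : ℕ) : ℝ) by push_cast; ring,
          Real.rpow_natCast, pow_mul, inv_pow]
        refine div_le_self (by positivity) ?_
        push_cast
        linarith
    _ = _ := by
        rw [ENNReal.ofReal_mul (by positivity)]
        ring

end IsRegularKernel

end CubeGrowth

/-! ### The oscillation of the part of the square function away from a cube -/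

section FarOscillation

variable {n : ℕ} {𝕜 : Type*} [RCLike 𝕜]

theorem two_pow_rpow_eq_sq (δ : ℝ) (j : ℕ) :
    ((2 : ℝ) ^ j) ^ δ = (((2 : ℝ) ^ (δ / 2)) ^ j) ^ 2 := by
  rw [← Real.rpow_natCast, ← Real.rpow_mul zero_le_two, ← pow_mul, ← Real.rpow_natCast,
    ← Real.rpow_mul zero_le_two]
  congr 1
  push_cast
  ring

theorem lintegral_cube_prod_Ioi_le (hn : 1 ≤ n) (z : EuclideanSpace ℝ (Fin n)) {r a : ℝ}
    (hr : 0 ≤ r) (ha : 0 < a) :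
    ∫⁻ p in cube z r ×ˢ Ioi a, (ENNReal.ofReal (p.2 ^ (n + 1)))⁻¹ ≤
      ENNReal.ofReal ((r / a) ^ n) := by
  have hn' : (1 : ℝ) ≤ n := by exact_mod_cast hn
  have h := lintegral_prod_mul (μ := volume.restrict (cube z r)) (ν := volume.restrict (Ioi a))
    (f := 1) (g := fun t => (ENNReal.ofReal (t ^ (n + 1)))⁻¹)
    aemeasurable_const (by fun_prop)
  simp only [Pi.one_apply, one_mul, lintegral_one, Measure.restrict_apply_univ] at h
  rw [Measure.volume_eq_prod, ← Measure.prod_restrict, h, volume_cube z hr]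
  calc ENNReal.ofReal (r ^ n) * ∫⁻ t in Ioi a, (ENNReal.ofReal (t ^ (n + 1)))⁻¹
      = ENNReal.ofReal (r ^ n) * ∫⁻ t in Ioi a, ENNReal.ofReal (t ^ (-(n : ℝ) - 1)) := by
        congr 1
        refine setLIntegral_congr_fun measurableSet_Ioi fun t hta => ?_
        have ht : 0 < t := ha.trans hta
        rw [← ENNReal.ofReal_inv_of_pos (by positivity), Real.rpow_sub ht, Real.rpow_neg ht.le,
          Real.rpow_one, Real.rpow_natCast]
        congr 1
        field_simp
        ring
    _ = ENNReal.ofReal (r ^ n * (a ^ (-(n : ℝ)) / n)) := by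
        rw [lintegral_Ioi_rpow_eq ha (by positivity), ENNReal.ofReal_mul (by positivity)]
    _ ≤ _ := by
        refine ENNReal.ofReal_le_ofReal ?_
        rw [Real.rpow_neg ha.le, Real.rpow_natCast, div_pow, div_eq_mul_inv (r ^ n)]
        gcongr
        exact div_le_self (by positivity) hn'

/-- The points `(y, t)` with `y ∈ 2^m Q` and `2^m ℓ / (16 α) < t ≤ 2^m ℓ`. Cones of aperture `α`
with vertex in `Q`, away from the box over `2Q`, are covered by these sets. -/
def scaleShell (z : EuclideanSpace ℝ (Fin n)) (ℓ α : ℝ) (m : ℕ) :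
    Set (EuclideanSpace ℝ (Fin n) × ℝ) :=
  cube z (2 ^ m * ℓ) ×ˢ Ioc (2 ^ m * ℓ / (16 * α)) (2 ^ m * ℓ)

theorem measurableSet_scaleShell (z : EuclideanSpace ℝ (Fin n)) (ℓ α : ℝ) (m : ℕ) :
    MeasurableSet (scaleShell z ℓ α m) :=
  (measurableSet_cube _ _).prod measurableSet_Ioc

namespace IsRegularKernel

variable {ψ : EuclideanSpace ℝ (Fin n) → 𝕜} {c δ : ℝ} (hψ : IsRegularKernel ψ c δ)
include hψ

/-- On a shell, the part of `f` in `2^(m+1) Q` is controlled by its `L¹` norm, the rest by the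
pointwise bound. -/
theorem lintegral_scaleShell_le (hn : 1 ≤ n) {f : EuclideanSpace ℝ (Fin n) → 𝕜}
    (hfm : Measurable f) {z : EuclideanSpace ℝ (Fin n)} {ℓ s α : ℝ} (hℓ : 0 < ℓ) (hs : 0 < s)
    (hα : 1 ≤ α) (hf : HasCubeGrowth f z ℓ s (2 ^ (δ / 2))) (m : ℕ) :
    ∫⁻ p in scaleShell z ℓ α m, ‖dilConv ψ f p.2 p.1‖ₑ ^ 2 / ENNReal.ofReal (p.2 ^ (n + 1)) ≤
      ENNReal.ofReal ((2 * (c * 32 ^ n * 2 ^ (δ / 2)) ^ 2 + 2 * (farConst n c δ * 16 ^ n) ^ 2) *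
        α ^ (2 * n) * s ^ 2 * ((2 ^ (δ / 2)) ^ m) ^ 2) := by
  have hc := hψ.const_pos
  have hδ := hψ.exponent_pos
  have hF := hψ.farConst_pos (n := n)
  have hθ1 := hψ.one_lt_two_rpow
  have hpow := two_pow_rpow_eq_sq δ m
  set θ : ℝ := 2 ^ (δ / 2) with hθ
  have hθ0 : 0 < θ := by linarith
  have hα0 : 0 < α := by linarith
  set r : ℝ := 2 ^ m * ℓ with hr
  have hr0 : 0 < r := by positivity
  set a : ℝ := r / (16 * α) with ha
  have ha0 : 0 < a := by positivity
  set Y := cube z (2 ^ (m + 1) * ℓ) with hY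
  set u := Y.indicator f with hu
  have hum : Measurable u := hfm.indicator (measurableSet_cube _ _)
  set κ : ℝ≥0∞ := ENNReal.ofReal (farConst n c δ * s * θ ^ m) with hκ
  have hGm : Measurable fun p : EuclideanSpace ℝ (Fin n) × ℝ =>
      absConv ψ u p.2 p.1 ^ 2 / ENNReal.ofReal (p.2 ^ (n + 1)) := by
    have := measurable_absConv hψ.measurable hum
    fun_prop
  have hpt : ∀ p ∈ scaleShell z ℓ α m,
      ‖dilConv ψ f p.2 p.1‖ₑ ^ 2 / ENNReal.ofReal (p.2 ^ (n + 1)) ≤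
        2 * (absConv ψ u p.2 p.1 ^ 2 / ENNReal.ofReal (p.2 ^ (n + 1))) +
          2 * κ ^ 2 * (ENNReal.ofReal (p.2 ^ (n + 1)))⁻¹ := by
    rintro ⟨y, t⟩ ⟨hy, ht1, ht2⟩
    simp only at hy ht1 ht2 ⊢
    have ht : 0 < t := ha0.trans ht1
    have hfar : absConv ψ (Yᶜ.indicator f) t y ≤ κ := by
      refine (hψ.absConv_compl_cube_le hℓ hs hf m ht hy).trans (ENNReal.ofReal_le_ofReal ?_)
      have h1 : (t / ℓ) ^ δ ≤ (θ ^ m) ^ 2 := by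
        rw [← hpow]
        refine Real.rpow_le_rpow (by positivity) ?_ hδ.le
        rwa [div_le_iff₀ hℓ]
      calc farConst n c δ * s * (t / ℓ) ^ δ * (θ ^ m)⁻¹
          ≤ farConst n c δ * s * (θ ^ m) ^ 2 * (θ ^ m)⁻¹ := by gcongr
        _ = _ := by field_simp
    have h2 : ‖dilConv ψ f t y‖ₑ ≤ absConv ψ u t y + κ := by
      refine (enorm_dilConv_le ψ f t y).trans ?_
      rw [absConv_eq_add ψ f (measurableSet_cube z (2 ^ (m + 1) * ℓ)) t y]
      gcongr
    calc _ ≤ (2 * absConv ψ u t y ^ 2 + 2 * κ ^ 2) / ENNReal.ofReal (t ^ (n + 1)) := by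
          gcongr
          exact (pow_le_pow_left₀ zero_le h2 2).trans (ENNReal.add_sq_le _ _)
      _ = _ := by
          simp only [div_eq_mul_inv]
          ring
  have hN : ∫⁻ x, ‖u x‖ₑ ≤ ENNReal.ofReal (s * (2 ^ (m + 1) * ℓ) ^ n * θ ^ (m + 1)) := by
    refine le_trans (le_of_eq ?_) (hf (m + 1))
    rw [← lintegral_indicator (measurableSet_cube _ _)]
    refine lintegral_congr fun x => ?_
    rw [hu, enorm_indicator_eq_indicator_enorm]
  have hn0 : ∀ b : ℝ, (b ^ n) ^ 2 = b ^ (2 * n) := fun b => by rw [← pow_mul, mul_comm]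
  calc _ ≤ ∫⁻ p in scaleShell z ℓ α m,
        (2 * (absConv ψ u p.2 p.1 ^ 2 / ENNReal.ofReal (p.2 ^ (n + 1))) +
          2 * κ ^ 2 * (ENNReal.ofReal (p.2 ^ (n + 1)))⁻¹) :=
        setLIntegral_mono' (measurableSet_scaleShell z ℓ α m) hpt
    _ = 2 * (∫⁻ p in scaleShell z ℓ α m,
          absConv ψ u p.2 p.1 ^ 2 / ENNReal.ofReal (p.2 ^ (n + 1))) +
        2 * κ ^ 2 * ∫⁻ p in scaleShell z ℓ α m, (ENNReal.ofReal (p.2 ^ (n + 1)))⁻¹ := by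
        rw [lintegral_add_left (hGm.const_mul 2), lintegral_const_mul _ hGm,
          lintegral_const_mul _ (by fun_prop)]
    _ ≤ 2 * (ENNReal.ofReal (c ^ 2 * (a ^ n)⁻¹ ^ 2) *
          ENNReal.ofReal (s * (2 ^ (m + 1) * ℓ) ^ n * θ ^ (m + 1)) ^ 2) +
        2 * κ ^ 2 * ENNReal.ofReal ((r / a) ^ n) := by
        gcongr
        · refine (lintegral_mono_set (prod_mono (subset_univ _) Ioc_subset_Ioi_self)).trans ?_
          refine (hψ.lintegral_absConv_sq_Ioi_le hn hum ha0).trans ?_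
          gcongr
        · exact (lintegral_mono_set (prod_mono subset_rfl Ioc_subset_Ioi_self)).trans
            (lintegral_cube_prod_Ioi_le hn z hr0.le ha0)
    _ = ENNReal.ofReal (2 * (c ^ 2 * (a ^ n)⁻¹ ^ 2 *
          (s * (2 ^ (m + 1) * ℓ) ^ n * θ ^ (m + 1)) ^ 2) +
        2 * (farConst n c δ * s * θ ^ m) ^ 2 * (r / a) ^ n) := by
        rw [ENNReal.ofReal_add (by positivity) (by positivity),
          ENNReal.ofReal_mul (p := 2) (by positivity),
          ENNReal.ofReal_mul (p := c ^ 2 * (a ^ n)⁻¹ ^ 2) (by positivity),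
          ENNReal.ofReal_mul (q := (r / a) ^ n) (by positivity),
          ENNReal.ofReal_mul (p := 2) (by positivity),
          ENNReal.ofReal_pow (p := s * (2 ^ (m + 1) * ℓ) ^ n * θ ^ (m + 1)) (by positivity),
          ENNReal.ofReal_pow (p := farConst n c δ * s * θ ^ m) (by positivity)]
        norm_num [hκ]
    _ ≤ _ := by
        refine ENNReal.ofReal_le_ofReal ?_
        have hra : r / a = 16 * α := by rw [ha]; field_simp
        have h1 : c ^ 2 * (a ^ n)⁻¹ ^ 2 * (s * (2 ^ (m + 1) * ℓ) ^ n * θ ^ (m + 1)) ^ 2 =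
            (c * 32 ^ n * θ) ^ 2 * α ^ (2 * n) * s ^ 2 * (θ ^ m) ^ 2 := by
          rw [pow_succ 2, pow_succ θ, show (2 : ℝ) ^ m * 2 * ℓ = 2 * r by rw [hr]; ring,
            show (32 : ℝ) = 2 * 16 by norm_num, ← hn0 α, ha, div_pow, mul_pow 2 r, mul_pow 16 α,
            mul_pow 2 16]
          field_simp
        have h2 : (16 * α) ^ n ≤ (16 ^ n) ^ 2 * α ^ (2 * n) := by
          rw [hn0, ← mul_pow]
          exact pow_le_pow_right₀ (by linarith) (by omega)
        rw [h1, hra]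
        calc _ ≤ 2 * ((c * 32 ^ n * θ) ^ 2 * α ^ (2 * n) * s ^ 2 * (θ ^ m) ^ 2) +
              2 * (farConst n c δ * s * θ ^ m) ^ 2 * ((16 ^ n) ^ 2 * α ^ (2 * n)) := by gcongr
          _ = _ := by ring

end IsRegularKernel

/-- A Schwartz function is Lipschitz. -/
theorem SchwartzMap.exists_abs_sub_le (Φ : 𝓢(EuclideanSpace ℝ (Fin n), ℝ)) :
    ∃ K : ℝ, 0 < K ∧ ∀ x y, |Φ x - Φ y| ≤ K * ‖x - y‖ := by
  obtain ⟨K, hK0, hK⟩ := Φ.decay 0 1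
  refine ⟨K, hK0, fun x y => ?_⟩
  rw [← Real.norm_eq_abs]
  refine Convex.norm_image_sub_le_of_norm_fderiv_le (𝕜 := ℝ) (s := univ)
    (fun w _ => Φ.differentiableAt) (fun w _ => ?_) convex_univ (mem_univ y) (mem_univ x)
  have h := hK w
  rwa [pow_zero, one_mul, norm_iteratedFDeriv_one] at h

/-- A cone with vertex in `Q` meets the complement of the box over `2^m Q` only at large scales. -/
theorem IsCutoff.lt_of_ne_zero {Φ : 𝓢(EuclideanSpace ℝ (Fin n), ℝ)} (hΦ : IsCutoff Φ)
    {z : EuclideanSpace ℝ (Fin n)} {ℓ α : ℝ} (hℓ : 0 < ℓ) (hα : 1 ≤ α) {m : ℕ} (hm : 1 ≤ m)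
    {x y : EuclideanSpace ℝ (Fin n)} {t : ℝ} (ht : 0 < t) (hx : x ∈ cube z ℓ)
    (hp : (y, t) ∉ cube z (2 ^ m * ℓ) ×ˢ Iic (2 ^ m * ℓ))
    (hne : Φ ((t * α)⁻¹ • (x - y)) ≠ 0) : 2 ^ m * ℓ / 8 < t * α := by
  by_cases htm : t ≤ 2 ^ m * ℓ
  · have hy : y ∉ cube z (2 ^ m * ℓ) := fun hy => hp ⟨hy, htm⟩
    have h2 : (2 : ℝ) ≤ 2 ^ m := le_self_pow₀ one_le_two (by omega)
    have h1 := le_norm_sub_of_mem_cube (by gcongr) hy hx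
    by_contra! h
    refine hne (hΦ.eq_zero ?_)
    rw [norm_smul, Real.norm_of_nonneg (by positivity), inv_mul_eq_div, le_div_iff₀ (by positivity)]
    linarith
  · have : 0 < 2 ^ m * ℓ := by positivity
    push Not at htm
    nlinarith

/-- Away from the box over `2Q`, the difference of two cut-offs with vertices in `Q` decays
geometrically over the dyadic shells. -/
theorem IsCutoff.exists_abs_sub_le {Φ : 𝓢(EuclideanSpace ℝ (Fin n), ℝ)} (hΦ : IsCutoff Φ) :
    ∃ K : ℝ, 0 < K ∧ ∀ (z : EuclideanSpace ℝ (Fin n)) (ℓ α : ℝ), 0 < ℓ → 1 ≤ α →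
      ∀ x ∈ cube z ℓ, ∀ x₁ ∈ cube z ℓ, ∀ p : EuclideanSpace ℝ (Fin n) × ℝ, 0 < p.2 →
        p ∉ cube z (2 * ℓ) ×ˢ Iic (2 * ℓ) →
        ENNReal.ofReal |Φ ((p.2 * α)⁻¹ • (x - p.1)) - Φ ((p.2 * α)⁻¹ • (x₁ - p.1))| ≤
          ∑' m : ℕ, (scaleShell z ℓ α m).indicator (fun _ => ENNReal.ofReal (K * 2⁻¹ ^ m)) p := by
  obtain ⟨K, hK, hlip⟩ := Φ.exists_abs_sub_le
  refine ⟨K * (16 * (√n + 1)), by positivity, ?_⟩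
  rintro z ℓ α hℓ hα x hx x₁ hx₁ ⟨y, t⟩ ht hp
  simp only at ht ⊢
  by_cases hzero : Φ ((t * α)⁻¹ • (x - y)) = 0 ∧ Φ ((t * α)⁻¹ • (x₁ - y)) = 0
  · rw [hzero.1, hzero.2]
    simp
  classical
  have hex : ∃ m, (y, t) ∈ cube z (2 ^ m * ℓ) ×ˢ Iic (2 ^ m * ℓ) := by
    obtain ⟨j, hj, hjt⟩ := exists_mem_cube z hℓ y t
    exact ⟨j, hj, hjt⟩
  have hmono : ∀ i j : ℕ, i ≤ j → (y, t) ∈ cube z (2 ^ i * ℓ) ×ˢ Iic (2 ^ i * ℓ) →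
      (y, t) ∈ cube z (2 ^ j * ℓ) ×ˢ Iic (2 ^ j * ℓ) := by
    rintro i j hij ⟨h1, h2⟩
    have : 2 ^ i * ℓ ≤ 2 ^ j * ℓ := by
      have : (2 : ℝ) ^ i ≤ 2 ^ j := pow_le_pow_right₀ one_le_two hij
      gcongr
    exact ⟨cube_mono z this h1, h2.trans this⟩
  have h2 : 2 ≤ Nat.find hex := by
    by_contra! h
    exact hp (by simpa using hmono _ 1 (by omega) (Nat.find_spec hex))
  -- `m + 1` is the first index for which `(y, t)` lies in the box over `2^(m+1) Q`.
  obtain ⟨m, hm⟩ : ∃ m, Nat.find hex = m + 1 := ⟨Nat.find hex - 1, by omega⟩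
  have hin := Nat.find_spec hex
  rw [hm] at hin
  have hout : (y, t) ∉ cube z (2 ^ m * ℓ) ×ˢ Iic (2 ^ m * ℓ) := Nat.find_min hex (by omega)
  have hα0 : 0 < α := by linarith
  have hscale : 2 ^ m * ℓ / 8 < t * α := by
    by_cases h : Φ ((t * α)⁻¹ • (x - y)) = 0
    · exact hΦ.lt_of_ne_zero hℓ hα (by omega) ht hx₁ hout fun h' => hzero ⟨h, h'⟩
    · exact hΦ.lt_of_ne_zero hℓ hα (by omega) ht hx hout h
  have hmem : (y, t) ∈ scaleShell z ℓ α (m + 1) := by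
    refine ⟨hin.1, ?_, hin.2⟩
    change 2 ^ (m + 1) * ℓ / (16 * α) < t
    rw [div_lt_iff₀ (by positivity), pow_succ]
    linarith
  refine le_trans ?_ (ENNReal.le_tsum (m + 1))
  rw [indicator_of_mem hmem]
  refine ENNReal.ofReal_le_ofReal ((hlip _ _).trans ?_)
  rw [← smul_sub, norm_smul, Real.norm_of_nonneg (by positivity), sub_sub_sub_cancel_right]
  have hxx := norm_sub_le_of_mem_cube hℓ.le hx hx₁
  calc K * ((t * α)⁻¹ * ‖x - x₁‖) ≤ K * ((2 ^ m * ℓ / 8)⁻¹ * (√n * ℓ)) := by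
        gcongr
    _ = K * (16 * √n) * 2⁻¹ ^ (m + 1) := by
        rw [inv_pow, pow_succ]
        field_simp
        ring
    _ ≤ _ := by
        gcongr
        linarith

end FarOscillation

/-! ### Oscillation bound for measurable functions and regular kernels -/

section Oscillation

variable {n : ℕ} {𝕜 : Type*} [RCLike 𝕜]

/-- The box `2Q × (-∞, 2ℓ]` separating the local part of the square function from the rest. -/
def localBox (z : EuclideanSpace ℝ (Fin n)) (ℓ : ℝ) : Set (EuclideanSpace ℝ (Fin n) × ℝ) :=
  cube z (2 * ℓ) ×ˢ Iic (2 * ℓ)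

theorem measurableSet_localBox (z : EuclideanSpace ℝ (Fin n)) (ℓ : ℝ) :
    MeasurableSet (localBox z ℓ) :=
  (measurableSet_cube _ _).prod measurableSet_Iic

theorem squareInt_eq_add (Φ : 𝓢(EuclideanSpace ℝ (Fin n), ℝ)) (α : ℝ)
    {F : EuclideanSpace ℝ (Fin n) × ℝ → ℝ≥0∞} (hF : Measurable F)
    {T : Set (EuclideanSpace ℝ (Fin n) × ℝ)} (hT : MeasurableSet T)
    (x : EuclideanSpace ℝ (Fin n)) :
    squareInt Φ α F x = squareInt Φ α (T.indicator F) x + squareInt Φ α (Tᶜ.indicator F) x := by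
  have hK : Measurable fun p : EuclideanSpace ℝ (Fin n) × ℝ =>
      ENNReal.ofReal (Φ ((p.2 * α)⁻¹ • (x - p.1))) :=
    (measurable_cutoff Φ α).comp (measurable_prodMk_left (x := x))
  have hm : Measurable fun p : EuclideanSpace ℝ (Fin n) × ℝ =>
      ENNReal.ofReal (Φ ((p.2 * α)⁻¹ • (x - p.1))) * T.indicator F p ^ 2 /
        ENNReal.ofReal (p.2 ^ (n + 1)) :=
    (hK.mul ((hF.indicator hT).pow_const 2)).div (by fun_prop)
  unfold squareInt
  rw [← lintegral_add_left hm]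
  refine lintegral_congr fun p => ?_
  by_cases hp : p ∈ T <;> simp [hp]

theorem lintegral_enorm_indicator_cube_le {f : EuclideanSpace ℝ (Fin n) → 𝕜}
    {z : EuclideanSpace ℝ (Fin n)} {ℓ s θ : ℝ} (hf : HasCubeGrowth f z ℓ s θ) (j : ℕ) :
    ∫⁻ x, ‖(cube z (2 ^ j * ℓ)).indicator f x‖ₑ ≤
      ENNReal.ofReal (s * (2 ^ j * ℓ) ^ n * θ ^ j) := by
  refine le_trans (le_of_eq ?_) (hf j)
  rw [← lintegral_indicator (measurableSet_cube _ _)]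
  refine lintegral_congr fun x => ?_
  rw [enorm_indicator_eq_indicator_enorm]

namespace IsRegularKernel

variable {ψ : EuclideanSpace ℝ (Fin n) → 𝕜} {c δ : ℝ} (hψ : IsRegularKernel ψ c δ)
  {Φ : 𝓢(EuclideanSpace ℝ (Fin n), ℝ)} (hΦ : IsCutoff Φ)
include hψ hΦ

/-- The non-local part of the square function oscillates little on `Q`. -/
theorem exists_squareInt_compl_localBox_le (hn : 1 ≤ n) :
    ∃ C : ℝ, 0 < C ∧ ∀ f : EuclideanSpace ℝ (Fin n) → 𝕜, Measurable f →
      ∀ (z : EuclideanSpace ℝ (Fin n)) (ℓ s α : ℝ), 0 < ℓ → 0 < s → 1 ≤ α →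
      HasCubeGrowth f z ℓ s (2 ^ (δ / 2)) → ∀ x ∈ cube z ℓ, ∀ x₁ ∈ cube z ℓ,
      squareInt Φ α ((localBox z ℓ)ᶜ.indicator fun p => ‖dilConv ψ f p.2 p.1‖ₑ) x ≤
        squareInt Φ α ((localBox z ℓ)ᶜ.indicator fun p => ‖dilConv ψ f p.2 p.1‖ₑ) x₁ +
          ENNReal.ofReal (C * α ^ (2 * n) * s ^ 2) := by
  obtain ⟨K, hK, hosc⟩ := hΦ.exists_abs_sub_le
  have hc := hψ.const_pos
  have hF := hψ.farConst_pos (n := n)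
  have hθ1 := hψ.one_lt_two_rpow
  have hθ2 : ((2 : ℝ) ^ (δ / 2)) ^ 2 < 2 := by
    rw [← Real.rpow_natCast, ← Real.rpow_mul zero_le_two]
    refine (Real.rpow_lt_rpow_of_exponent_lt one_lt_two (z := 1) ?_).trans_eq (Real.rpow_one 2)
    push_cast
    linarith [hψ.exponent_lt_one]
  -- `A` is the constant of `lintegral_scaleShell_le`.
  set A : ℝ := 2 * (c * 32 ^ n * 2 ^ (δ / 2)) ^ 2 + 2 * (farConst n c δ * 16 ^ n) ^ 2 with hA
  have hshell := fun (f : EuclideanSpace ℝ (Fin n) → 𝕜) hfm z ℓ s α hℓ hs hα hf m =>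
    hψ.lintegral_scaleShell_le hn (f := f) hfm (z := z) (ℓ := ℓ) (s := s) (α := α) hℓ hs hα hf m
  set θ : ℝ := 2 ^ (δ / 2) with hθ
  have hθ0 : 0 < θ := by linarith
  have hgap : 0 < 1 - 2⁻¹ * θ ^ 2 := by linarith
  refine ⟨K * A * (1 - 2⁻¹ * θ ^ 2)⁻¹, by positivity, ?_⟩
  intro f hfm z ℓ s α hℓ hs hα hf x hx x₁ hx₁
  set F : EuclideanSpace ℝ (Fin n) × ℝ → ℝ≥0∞ := fun p => ‖dilConv ψ f p.2 p.1‖ₑ with hFdef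
  have hFm : Measurable F := (measurable_dilConv hψ.measurable hfm).enorm
  set H : EuclideanSpace ℝ (Fin n) × ℝ → ℝ≥0∞ :=
    fun p => F p ^ 2 / ENNReal.ofReal (p.2 ^ (n + 1)) with hH
  have hHm : Measurable H := by fun_prop
  have hT := (measurableSet_localBox z ℓ).compl
  have hα0 : 0 < α := by linarith
  set J : ℕ → EuclideanSpace ℝ (Fin n) × ℝ → ℝ≥0∞ := fun m p =>
    (scaleShell z ℓ α m).indicator (fun _ => ENNReal.ofReal (K * 2⁻¹ ^ m)) p * H p with hJ
  have hJm : ∀ m, Measurable (J m) := fun m =>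
    (measurable_const.indicator (measurableSet_scaleShell z ℓ α m)).mul hHm
  have hpt : ∀ p ∈ univ ×ˢ Ioi (0 : ℝ),
      ENNReal.ofReal (Φ ((p.2 * α)⁻¹ • (x - p.1))) * (localBox z ℓ)ᶜ.indicator F p ^ 2 /
          ENNReal.ofReal (p.2 ^ (n + 1)) ≤
        ENNReal.ofReal (Φ ((p.2 * α)⁻¹ • (x₁ - p.1))) * (localBox z ℓ)ᶜ.indicator F p ^ 2 /
          ENNReal.ofReal (p.2 ^ (n + 1)) + ∑' m, J m p := by
    rintro p ⟨-, hp⟩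
    by_cases hpT : p ∈ localBox z ℓ
    · simp [hpT]
    rw [indicator_of_mem hpT, ENNReal.tsum_mul_right, mul_div_assoc, mul_div_assoc, ← add_mul]
    gcongr ?_ * _
    refine le_trans ?_ (add_le_add_right (hosc z ℓ α hℓ hα x hx x₁ hx₁ p hp hpT) _)
    refine le_trans (ENNReal.ofReal_le_ofReal ?_) ENNReal.ofReal_add_le
    linarith [le_abs_self (Φ ((p.2 * α)⁻¹ • (x - p.1)) - Φ ((p.2 * α)⁻¹ • (x₁ - p.1)))]
  have hJint : ∀ m, ∫⁻ p, J m p ≤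
      ENNReal.ofReal (K * A * α ^ (2 * n) * s ^ 2 * (2⁻¹ * θ ^ 2) ^ m) := by
    intro m
    have h : ∀ p, J m p = (scaleShell z ℓ α m).indicator
        (fun p => ENNReal.ofReal (K * 2⁻¹ ^ m) * H p) p := fun p => by
      by_cases hp : p ∈ scaleShell z ℓ α m <;> simp [hJ, hp]
    rw [lintegral_congr h, lintegral_indicator (measurableSet_scaleShell z ℓ α m),
      lintegral_const_mul _ hHm]
    calc _ ≤ ENNReal.ofReal (K * 2⁻¹ ^ m) *
          ENNReal.ofReal (A * α ^ (2 * n) * s ^ 2 * (θ ^ m) ^ 2) := by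
          gcongr
          exact hshell f hfm z ℓ s α hℓ hs hα hf m
      _ = _ := by
          rw [← ENNReal.ofReal_mul (by positivity)]
          congr 1
          rw [mul_pow, ← pow_mul θ 2, mul_comm 2 m, pow_mul]
          ring
  have hsum : HasSum (fun m : ℕ => K * A * α ^ (2 * n) * s ^ 2 * (2⁻¹ * θ ^ 2) ^ m)
      (K * A * α ^ (2 * n) * s ^ 2 * (1 - 2⁻¹ * θ ^ 2)⁻¹) :=
    (hasSum_geometric_of_lt_one (by positivity) (by linarith)).mul_left _
  calc squareInt Φ α ((localBox z ℓ)ᶜ.indicator F) x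
      ≤ ∫⁻ p in univ ×ˢ Ioi (0 : ℝ),
          (ENNReal.ofReal (Φ ((p.2 * α)⁻¹ • (x₁ - p.1))) * (localBox z ℓ)ᶜ.indicator F p ^ 2 /
            ENNReal.ofReal (p.2 ^ (n + 1)) + ∑' m, J m p) :=
        setLIntegral_mono' (MeasurableSet.univ.prod measurableSet_Ioi) hpt
    _ = squareInt Φ α ((localBox z ℓ)ᶜ.indicator F) x₁ +
          ∫⁻ p in univ ×ˢ Ioi (0 : ℝ), ∑' m, J m p :=
        lintegral_add_left ((measurable_squareInt_integrand Φ α (hFm.indicator hT)).comp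
          (measurable_prodMk_left (x := x₁))) _
    _ ≤ squareInt Φ α ((localBox z ℓ)ᶜ.indicator F) x₁ + ∑' m, ∫⁻ p, J m p := by
        rw [lintegral_tsum fun m => (hJm m).aemeasurable]
        gcongr with m
        exact Measure.restrict_le_self
    _ ≤ squareInt Φ α ((localBox z ℓ)ᶜ.indicator F) x₁ +
          ∑' m : ℕ, ENNReal.ofReal (K * A * α ^ (2 * n) * s ^ 2 * (2⁻¹ * θ ^ 2) ^ m) := by
        gcongr with m
        exact hJint m
    _ = _ := by
        rw [← ENNReal.ofReal_tsum_of_nonneg (fun m => by positivity) hsum.summable, hsum.tsum_eq]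
        congr 2
        ring

/-- For integrable `f` the non-local part of the square function is finite on `Q`. -/
theorem squareInt_compl_localBox_lt_top (hn : 1 ≤ n) {f : EuclideanSpace ℝ (Fin n) → 𝕜}
    (hfm : Measurable f) (hfi : Integrable f) {z x : EuclideanSpace ℝ (Fin n)} {ℓ α : ℝ}
    (hℓ : 0 < ℓ) (hα : 1 ≤ α) (hx : x ∈ cube z ℓ) :
    squareInt Φ α ((localBox z ℓ)ᶜ.indicator fun p => ‖dilConv ψ f p.2 p.1‖ₑ) x < ∞ := by
  have hα0 : 0 < α := by linarith
  have ha : 0 < 2 ^ 1 * ℓ / 8 / α := by positivity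
  refine lt_of_le_of_lt (b := ∫⁻ p in univ ×ˢ Ioi (2 ^ 1 * ℓ / 8 / α),
    absConv ψ f p.2 p.1 ^ 2 / ENNReal.ofReal (p.2 ^ (n + 1))) ?_ ?_
  · have hS : MeasurableSet ((univ : Set (EuclideanSpace ℝ (Fin n))) ×ˢ
        Ioi (2 ^ 1 * ℓ / 8 / α)) := MeasurableSet.univ.prod measurableSet_Ioi
    rw [squareInt, ← lintegral_indicator hS]
    refine le_trans (setLIntegral_mono' (MeasurableSet.univ.prod measurableSet_Ioi) ?_)
      (lintegral_mono' Measure.restrict_le_self le_rfl)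
    rintro ⟨y, t⟩ ⟨-, ht⟩
    by_cases hpT : (y, t) ∈ localBox z ℓ
    · simp [hpT]
    by_cases hzero : Φ ((t * α)⁻¹ • (x - y)) = 0
    · simp only [hzero]
      simp
    have hlt := hΦ.lt_of_ne_zero hℓ hα le_rfl ht hx (by simpa [localBox] using hpT) hzero
    have hmem : (y, t) ∈ univ (α := EuclideanSpace ℝ (Fin n)) ×ˢ Ioi (2 ^ 1 * ℓ / 8 / α) :=
      ⟨mem_univ _, (div_lt_iff₀ hα0).2 hlt⟩
    rw [indicator_of_mem hmem, indicator_of_mem hpT]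
    simp only
    gcongr ?_ / _
    refine (mul_le_of_le_one_left zero_le (ENNReal.ofReal_le_one.2 (hΦ.le_one _))).trans ?_
    gcongr
    exact enorm_dilConv_le ψ f t y
  · refine (hψ.lintegral_absConv_sq_Ioi_le hn hfm ha).trans_lt ?_
    exact ENNReal.mul_lt_top ENNReal.ofReal_lt_top (ENNReal.pow_lt_top hfi.2)

/-- The local part of the square function is controlled by the square function of
`f` restricted to `4Q`, up to an error bounded pointwise. -/
theorem exists_squareInt_localBox_le :
    ∃ C : ℝ, 0 < C ∧ ∀ f : EuclideanSpace ℝ (Fin n) → 𝕜, Measurable f →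
      ∀ (z : EuclideanSpace ℝ (Fin n)) (ℓ s α : ℝ), 0 < ℓ → 0 < s → 1 ≤ α →
      HasCubeGrowth f z ℓ s (2 ^ (δ / 2)) → ∀ x,
      squareInt Φ α ((localBox z ℓ).indicator fun p => ‖dilConv ψ f p.2 p.1‖ₑ) x ≤
        2 * squareInt Φ α
            (fun p => ‖dilConv ψ ((cube z (2 ^ 2 * ℓ)).indicator f) p.2 p.1‖ₑ) x +
          ENNReal.ofReal (C * α ^ n * s ^ 2) := by
  have hc := hψ.const_pos
  have hδ := hψ.exponent_pos
  have hF := hψ.farConst_pos (n := n)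
  have hθ1 := hψ.one_lt_two_rpow
  set V := volume (Metric.ball (0 : EuclideanSpace ℝ (Fin n)) 1) with hV
  have hVtop : V ≠ ∞ := measure_ball_lt_top.ne
  have hVpos : 0 < V.toReal :=
    ENNReal.toReal_pos (Metric.measure_ball_pos _ _ one_pos).ne' hVtop
  refine ⟨2 * (V.toReal * 2 ^ n * farConst n c δ ^ 2 * (2 ^ (2 * δ) / (2 * δ))), by positivity, ?_⟩
  intro f hfm z ℓ s α hℓ hs hα hf x
  have hα0 : 0 < α := by linarith
  have hfar := fun t ht y hy => hψ.absConv_compl_cube_le hℓ hs hf 1 (t := t) ht (y := y) hy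
  set θ : ℝ := 2 ^ (δ / 2) with hθ
  set Y := cube z (2 ^ 2 * ℓ) with hY
  have hYm : MeasurableSet Y := measurableSet_cube _ _
  set u := Y.indicator f with hu
  have hum : Measurable u := hfm.indicator hYm
  have hui : Integrable u := ⟨hum.aestronglyMeasurable,
    (lintegral_enorm_indicator_cube_le hf 2).trans_lt ENNReal.ofReal_lt_top⟩
  set G : EuclideanSpace ℝ (Fin n) × ℝ → ℝ≥0∞ := fun p =>
    (Iic (2 * ℓ)).indicator (fun t => ENNReal.ofReal (farConst n c δ * s * (t / ℓ) ^ δ)) p.2 with hG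
  have hGm : Measurable G := by
    refine Measurable.comp (g := (Iic (2 * ℓ)).indicator
      (fun t => ENNReal.ofReal (farConst n c δ * s * (t / ℓ) ^ δ))) ?_ measurable_snd
    exact Measurable.indicator (by fun_prop) measurableSet_Iic
  have hle : ∀ p : EuclideanSpace ℝ (Fin n) × ℝ, 0 < p.2 →
      (localBox z ℓ).indicator (fun p => ‖dilConv ψ f p.2 p.1‖ₑ) p ≤
        ‖dilConv ψ u p.2 p.1‖ₑ + G p := by
    rintro ⟨y, t⟩ ht
    simp only at ht
    by_cases hp : (y, t) ∈ localBox z ℓ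
    · rw [indicator_of_mem hp]
      simp only [hG]
      rw [indicator_of_mem (show t ∈ Iic (2 * ℓ) from hp.2)]
      have h1 := hψ.enorm_dilConv_add_le ht hui (hfm.indicator hYm.compl) y
      rw [hu, indicator_self_add_compl] at h1
      refine h1.trans ?_
      gcongr
      refine (hfar t ht y (by simpa using hp.1)).trans (ENNReal.ofReal_le_ofReal ?_)
      refine mul_le_of_le_one_right (by positivity) ?_
      rw [pow_one]
      exact inv_le_one_of_one_le₀ hθ1.le
    · simp [hp]
  have hGint : squareInt Φ α G x ≤
      ENNReal.ofReal (V.toReal * 2 ^ n * farConst n c δ ^ 2 * (2 ^ (2 * δ) / (2 * δ)) *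
        α ^ n * s ^ 2) := by
    have hm := (measurable_squareInt_integrand Φ α hGm).comp (measurable_prodMk_left (x := x))
    rw [squareInt]
    refine (setLIntegral_univ_prod_Ioi hm).trans_le ?_
    set B : ℝ := V.toReal * (2 * α) ^ n * (farConst n c δ * s) ^ 2 * (ℓ ^ (2 * δ))⁻¹ with hB
    have hB0 : 0 ≤ B := by positivity
    calc _ ≤ ∫⁻ t in Ioi (0 : ℝ), (Ioc 0 (2 * ℓ)).indicator
          (fun t => ENNReal.ofReal B * ENNReal.ofReal (t ^ (2 * δ - 1))) t := by
          refine setLIntegral_mono' measurableSet_Ioi fun t ht => ?_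
          have ht0 : 0 < t := ht
          simp only [Function.comp_def, hG]
          by_cases htℓ : t ≤ 2 * ℓ
          · rw [indicator_of_mem (show t ∈ Iic (2 * ℓ) from htℓ),
              indicator_of_mem (show t ∈ Ioc 0 (2 * ℓ) from ⟨ht, htℓ⟩)]
            simp_rw [mul_div_assoc]
            have hK : Measurable fun y : EuclideanSpace ℝ (Fin n) =>
                ENNReal.ofReal (Φ ((t * α)⁻¹ • (x - y))) :=
              ENNReal.measurable_ofReal.comp (Φ.continuous.measurable.comp (by fun_prop))
            rw [lintegral_mul_const _ hK]
            calc _ ≤ ENNReal.ofReal ((2 * (t * α)) ^ n) * V *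
                (ENNReal.ofReal (farConst n c δ * s * (t / ℓ) ^ δ) ^ 2 /
                  ENNReal.ofReal (t ^ (n + 1))) := by
                  gcongr ?_ * _
                  exact hΦ.lintegral_le' (by positivity) x
              _ = ENNReal.ofReal ((2 * (t * α)) ^ n * V.toReal *
                  ((farConst n c δ * s * (t / ℓ) ^ δ) ^ 2 / t ^ (n + 1))) := by
                  rw [ENNReal.ofReal_mul (p := (2 * (t * α)) ^ n * V.toReal) (by positivity),
                    ENNReal.ofReal_mul (p := (2 * (t * α)) ^ n) (by positivity),
                    ENNReal.ofReal_toReal hVtop, ENNReal.ofReal_div_of_pos (by positivity),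
                    ENNReal.ofReal_pow (p := farConst n c δ * s * (t / ℓ) ^ δ) (by positivity)]
              _ ≤ _ := by
                  rw [← ENNReal.ofReal_mul hB0]
                  refine le_of_eq (congrArg _ ?_)
                  have h2 : ∀ b : ℝ, 0 < b → (b ^ δ) ^ 2 = b ^ (2 * δ) := fun b hb => by
                    rw [← Real.rpow_natCast, ← Real.rpow_mul hb.le]
                    congr 1
                    push_cast
                    ring
                  rw [hB, Real.rpow_sub ht0, Real.rpow_one, Real.div_rpow ht0.le hℓ.le, ← h2 t ht0,
                    ← h2 ℓ hℓ, pow_succ t, mul_pow 2 (t * α), mul_pow t α, mul_pow 2 α]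
                  have h3 := Real.rpow_pos_of_pos hℓ δ
                  field_simp
          · rw [indicator_of_notMem (show t ∉ Iic (2 * ℓ) from htℓ)]
            simp
      _ ≤ ∫⁻ t in Ioc 0 (2 * ℓ), ENNReal.ofReal B * ENNReal.ofReal (t ^ (2 * δ - 1)) := by
          rw [← lintegral_indicator measurableSet_Ioc]
          exact lintegral_mono' Measure.restrict_le_self le_rfl
      _ = ENNReal.ofReal (B * ((2 * ℓ) ^ (2 * δ) / (2 * δ))) := by
          rw [lintegral_const_mul' _ _ ENNReal.ofReal_ne_top,
            lintegral_Ioc_rpow_eq (by positivity) (by positivity), ENNReal.ofReal_mul hB0]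
      _ = _ := by
          congr 1
          have := Real.rpow_pos_of_pos hℓ (2 * δ)
          rw [hB, Real.mul_rpow zero_le_two hℓ.le, mul_pow 2]
          field_simp
  calc _ ≤ squareInt Φ α (fun p => ‖dilConv ψ u p.2 p.1‖ₑ + G p) x := squareInt_mono Φ α hle x
    _ ≤ 2 * squareInt Φ α (fun p => ‖dilConv ψ u p.2 p.1‖ₑ) x + 2 * squareInt Φ α G x :=
        squareInt_add_le Φ α (measurable_dilConv hψ.measurable hum).enorm G x
    _ ≤ 2 * squareInt Φ α (fun p => ‖dilConv ψ u p.2 p.1‖ₑ) x +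
          2 * ENNReal.ofReal (V.toReal * 2 ^ n * farConst n c δ ^ 2 * (2 ^ (2 * δ) / (2 * δ)) *
            α ^ n * s ^ 2) := by gcongr
    _ = _ := by
        rw [← ENNReal.ofReal_ofNat 2, ← ENNReal.ofReal_mul (p := 2) (by norm_num)]
        congr 2
        ring

end IsRegularKernel

/-- The case `A = ∞` is allowed, as it forces `X = ∞`. -/
theorem EReal.abs_coe_sub_le {A B X : ℝ≥0∞} (hB : B ≠ ∞) (h1 : A ≤ B + X) (h2 : B ≤ A + X) :
    ((A : EReal) - (B.toReal : EReal)).abs ≤ X := by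
  by_cases hX : X = ∞
  · simp [hX]
  have hA : A ≠ ∞ := (h1.trans_lt (ENNReal.add_lt_top.2
    ⟨lt_top_iff_ne_top.2 hB, lt_top_iff_ne_top.2 hX⟩)).ne
  lift A to NNReal using hA
  lift B to NNReal using hB
  lift X to NNReal using hX
  norm_cast at h1 h2
  have h1' : (A : ℝ) ≤ B + X := by exact_mod_cast h1
  have h2' : (B : ℝ) ≤ A + X := by exact_mod_cast h2
  have : (((A : ℝ≥0∞) : EReal) - (((B : ℝ≥0∞).toReal : ℝ) : EReal)) = ((A - B : ℝ) : EReal) := by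
    rw [EReal.coe_sub]
    rfl
  rw [this, EReal.abs_def]
  refine ENNReal.ofReal_le_of_le_toReal ?_
  simp only [ENNReal.coe_toReal]
  rw [abs_le]
  constructor <;> linarith

/-- The oscillation of the squared square function on `Q` under a growth condition on the averages
of `|f|`; the reference constant is the non-local part of the squared square function at a point
of `Q`. -/
theorem IsRegularKernel.exists_localMeanOscillation_le (hn : 1 ≤ n)
    {ψ : EuclideanSpace ℝ (Fin n) → 𝕜} {c δ : ℝ} (hψ : IsRegularKernel ψ c δ)
    {Φ : 𝓢(EuclideanSpace ℝ (Fin n), ℝ)} (hΦ : IsCutoff Φ) {lam : ℝ} (hlam : 0 < lam) :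
    ∃ C : ℝ, 0 < C ∧ ∀ f : EuclideanSpace ℝ (Fin n) → 𝕜, Measurable f →
      ∀ (z : EuclideanSpace ℝ (Fin n)) (ℓ s α : ℝ), 0 < ℓ → 0 < s → 1 ≤ α →
      HasCubeGrowth f z ℓ s (2 ^ (δ / 2)) →
      (Integrable f ∨ ∃ x ∈ cube z ℓ, smoothSquareFunction Φ α ψ f x < ∞) →
      localMeanOscillation lam
        (fun x => ((smoothSquareFunction Φ α ψ f x ^ 2 : ℝ≥0∞) : EReal)) (cube z ℓ) ≤
      ENNReal.ofReal (C * α ^ (2 * n) * s ^ 2) := by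
  obtain ⟨CW, hCW, hweak⟩ := hψ.exists_volume_squareInt_gt_le hn hΦ
  obtain ⟨CD, hCD, hosc⟩ := hψ.exists_squareInt_compl_localBox_le hΦ hn
  obtain ⟨CB, hCB, hloc⟩ := hψ.exists_squareInt_localBox_le hΦ
  have hθ1 := hψ.one_lt_two_rpow
  set θ : ℝ := 2 ^ (δ / 2) with hθ
  have hθ0 : 0 < θ := by linarith
  refine ⟨2 * (2 * CW * 4 ^ n * θ ^ 2 / lam) ^ 2 + CB + CD, by positivity, ?_⟩
  intro f hfm z ℓ s α hℓ hs hα hf hfin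
  have hα0 : 0 < α := by linarith
  set F : EuclideanSpace ℝ (Fin n) × ℝ → ℝ≥0∞ := fun p => ‖dilConv ψ f p.2 p.1‖ₑ with hF
  have hFm : Measurable F := (measurable_dilConv hψ.measurable hfm).enorm
  set u := (cube z (2 ^ 2 * ℓ)).indicator f with hu
  have hum : Measurable u := hfm.indicator (measurableSet_cube _ _)
  have huN := lintegral_enorm_indicator_cube_le hf 2
  have hui : Integrable u := ⟨hum.aestronglyMeasurable, huN.trans_lt ENNReal.ofReal_lt_top⟩
  have hsplit : ∀ x, smoothSquareFunction Φ α ψ f x ^ 2 =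
      squareInt Φ α ((localBox z ℓ).indicator F) x +
        squareInt Φ α ((localBox z ℓ)ᶜ.indicator F) x := fun x => by
    rw [smoothSquareFunction_sq, ← squareInt_eq_add Φ α hFm (measurableSet_localBox z ℓ)]
  obtain ⟨x₁, hx₁, htop⟩ : ∃ x₁ ∈ cube z ℓ,
      squareInt Φ α ((localBox z ℓ)ᶜ.indicator F) x₁ ≠ ∞ := by
    rcases hfin with hfi | ⟨x₁, hx₁, h⟩
    · have hz : z ∈ cube z ℓ := fun i => by simpa using by positivity
      exact ⟨z, hz, (hψ.squareInt_compl_localBox_lt_top hΦ hn hfm hfi hℓ hα hz).ne⟩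
    · refine ⟨x₁, hx₁, ne_top_of_le_ne_top (ENNReal.pow_lt_top h (n := 2)).ne ?_⟩
      rw [hsplit]
      exact le_add_self
  -- The height at which the weak type bound gives measure at most `lam |Q| / 2`.
  set τ : ℝ := 2 * CW * 4 ^ n * θ ^ 2 / lam * α ^ n * s with hτ
  have hτ0 : 0 < τ := by positivity
  refine (iInf_le _ (squareInt Φ α ((localBox z ℓ)ᶜ.indicator F) x₁).toReal).trans ?_
  refine sInf_le ⟨ENNReal.ofReal_pos.2 (by positivity), ?_⟩
  have hsub : {x | ENNReal.ofReal ((2 * (2 * CW * 4 ^ n * θ ^ 2 / lam) ^ 2 + CB + CD) *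
      α ^ (2 * n) * s ^ 2) < ((cube z ℓ).indicator (fun x =>
        ((smoothSquareFunction Φ α ψ f x ^ 2 : ℝ≥0∞) : EReal) -
          ((squareInt Φ α ((localBox z ℓ)ᶜ.indicator F) x₁).toReal : EReal)) x).abs} ⊆
      {x | ENNReal.ofReal (τ ^ 2) < squareInt Φ α (fun p => ‖dilConv ψ u p.2 p.1‖ₑ) x} := by
    intro x hx
    simp only [Set.mem_ofPred_eq] at hx ⊢
    by_cases hxQ : x ∈ cube z ℓ
    swap
    · simp [hxQ] at hx
    rw [indicator_of_mem hxQ] at hx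
    by_contra! hle
    refine absurd hx (not_lt.2 ?_)
    have hD1 := hosc f hfm z ℓ s α hℓ hs hα hf x hxQ x₁ hx₁
    have hD2 := hosc f hfm z ℓ s α hℓ hs hα hf x₁ hx₁ x hxQ
    have hI := hloc f hfm z ℓ s α hℓ hs hα hf x
    set D := ENNReal.ofReal (CD * α ^ (2 * n) * s ^ 2) with hD
    set I₁ := squareInt Φ α ((localBox z ℓ).indicator F) x with hI₁
    refine (EReal.abs_coe_sub_le (X := I₁ + D) htop ?_ ?_).trans ?_
    · rw [hsplit x, add_left_comm]
      gcongr
    · rw [hsplit x]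
      refine hD2.trans (add_le_add le_add_self le_add_self)
    · calc I₁ + D ≤ 2 * ENNReal.ofReal (τ ^ 2) + ENNReal.ofReal (CB * α ^ n * s ^ 2) + D := by
            gcongr
            refine hI.trans ?_
            gcongr
        _ = ENNReal.ofReal (2 * τ ^ 2 + CB * α ^ n * s ^ 2 + CD * α ^ (2 * n) * s ^ 2) := by
            rw [ENNReal.ofReal_add (by positivity) (by positivity),
              ENNReal.ofReal_add (by positivity) (by positivity),
              ENNReal.ofReal_mul (p := 2) (by norm_num), ENNReal.ofReal_ofNat]
        _ ≤ _ := by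
            refine ENNReal.ofReal_le_ofReal ?_
            have h1 : α ^ n ≤ α ^ (2 * n) := pow_le_pow_right₀ hα (by omega)
            calc _ ≤ 2 * τ ^ 2 + CB * α ^ (2 * n) * s ^ 2 + CD * α ^ (2 * n) * s ^ 2 := by gcongr
              _ = _ := by rw [hτ, mul_comm 2 n, pow_mul]; ring
  have hvol : volume.real (cube z ℓ) = ℓ ^ n := by
    rw [Measure.real, volume_cube z hℓ.le, ENNReal.toReal_ofReal (by positivity)]
  rw [hvol]
  calc _ ≤ volume {x | ENNReal.ofReal (τ ^ 2) <
        squareInt Φ α (fun p => ‖dilConv ψ u p.2 p.1‖ₑ) x} := measure_mono hsub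
    _ ≤ ENNReal.ofReal (CW * α ^ n / τ) * ∫⁻ x, ‖u x‖ₑ := hweak u hum hui α hα τ hτ0
    _ ≤ ENNReal.ofReal (CW * α ^ n / τ) * ENNReal.ofReal (s * (2 ^ 2 * ℓ) ^ n * θ ^ 2) := by
        gcongr
    _ = ENNReal.ofReal (lam * ℓ ^ n / 2) := by
        rw [← ENNReal.ofReal_mul (by positivity)]
        congr 1
        rw [hτ, mul_pow _ ℓ]
        norm_num
        field_simp
    _ < _ := by
        refine (ENNReal.ofReal_lt_ofReal_iff (by positivity)).2 ?_
        have : 0 < lam * ℓ ^ n := by positivity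
        linarith

end Oscillation

/-! ### Reduction to measurable functions and regular kernels -/

section Reduction

variable {n : ℕ} {𝕜 : Type*} [RCLike 𝕜]

/-- A standard kernel agrees almost everywhere with a regular one, of any smaller exponent. The
size bound is recovered everywhere by cutting a measurable representative off where it fails. -/
theorem IsStandardKernel.exists_isRegularKernel {ψ : EuclideanSpace ℝ (Fin n) → 𝕜} {ε δ : ℝ}
    (hψ : IsStandardKernel ψ ε) (hδ0 : 0 < δ) (hδ1 : δ < 1) (hδε : δ ≤ ε) :
    ∃ (ψ₁ : EuclideanSpace ℝ (Fin n) → 𝕜) (c : ℝ), ψ =ᵐ[volume] ψ₁ ∧ IsRegularKernel ψ₁ c δ := by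
  obtain ⟨c₀, hsize, hmod⟩ := hψ.bounds
  have hε := hψ.eps_pos
  have hint := hψ.integrable
  have hc₀ : 0 ≤ c₀ := by
    have := (norm_nonneg _).trans (hsize 0)
    simpa using this
  set N : ℝ := ∫ x, ‖ψ x‖ with hN
  have hN0 : 0 ≤ N := integral_nonneg fun _ => norm_nonneg _
  set ψ₀ := hint.1.mk ψ with hψ₀
  have hm₀ : Measurable ψ₀ := hint.1.stronglyMeasurable_mk.measurable
  have hae₀ : ψ =ᵐ[volume] ψ₀ := hint.1.ae_eq_mk
  set A : Set (EuclideanSpace ℝ (Fin n)) := {x | ‖ψ₀ x‖ ≤ c₀ / (1 + ‖x‖) ^ ((n : ℝ) + ε)} with hA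
  have hAm : MeasurableSet A := measurableSet_le hm₀.norm (by fun_prop)
  have hae : ψ =ᵐ[volume] A.indicator ψ₀ := by
    filter_upwards [hae₀] with x hx
    have hxA : x ∈ A := by
      change ‖ψ₀ x‖ ≤ _
      rw [← hx]
      exact hsize x
    rw [indicator_of_mem hxA, hx]
  have hbase : ∀ x : EuclideanSpace ℝ (Fin n), 1 ≤ 1 + ‖x‖ := fun x => by
    linarith [norm_nonneg x]
  refine ⟨A.indicator ψ₀, c₀ + 2 * N + 1, hae, hm₀.indicator hAm, by positivity, hδ0, hδ1,
    fun x => ?_, ?_, fun h => ?_, ?_⟩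
  · have hpos : 0 < 1 + ‖x‖ := by linarith [hbase x]
    by_cases hx : x ∈ A
    · rw [indicator_of_mem hx]
      refine (show ‖ψ₀ x‖ ≤ _ from hx).trans ?_
      rw [div_eq_mul_inv, ← Real.rpow_neg hpos.le]
      gcongr
      · linarith
      · exact hbase x
    · rw [indicator_of_notMem hx, norm_zero]
      positivity
  · rw [lintegral_congr_ae (g := fun x => ‖ψ x‖ₑ) (by
      filter_upwards [hae] with x hx
      rw [hx]), ← ofReal_integral_norm_eq_lintegral_enorm hint]
    exact ENNReal.ofReal_le_ofReal (by linarith)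
  · have hshift : Integrable fun x => ψ (x + h) := hint.comp_add_right h
    have hdiff : Integrable fun x => ψ (x + h) - ψ x := hshift.sub hint
    have hae' : ∀ᵐ x, ψ (x + h) = A.indicator ψ₀ (x + h) :=
      (measurePreserving_add_right volume h).quasiMeasurePreserving.ae hae
    rw [lintegral_congr_ae (g := fun x => ‖ψ (x + h) - ψ x‖ₑ) (by
      filter_upwards [hae, hae'] with x hx hx'
      rw [hx, hx']), ← ofReal_integral_norm_eq_lintegral_enorm hdiff]
    refine ENNReal.ofReal_le_ofReal ?_
    -- For `|h| > 1` the modulus bound with exponent `ε` is too weak; the `L¹` norm is used instead.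
    rcases le_or_gt ‖h‖ 1 with h1 | h1
    · refine (hmod h).trans ?_
      have h2 : ‖h‖ ^ ε ≤ ‖h‖ ^ δ := by
        rcases (norm_nonneg h).eq_or_lt with h0 | h0
        · rw [← h0, Real.zero_rpow hε.ne', Real.zero_rpow hδ0.ne']
        · exact Real.rpow_le_rpow_of_exponent_ge h0 h1 hδε
      calc c₀ * ‖h‖ ^ ε ≤ c₀ * ‖h‖ ^ δ := by gcongr
        _ ≤ _ := by
          gcongr
          linarith
    · have h2 : ∫ x, ‖ψ (x + h) - ψ x‖ ≤ 2 * N := by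
        calc ∫ x, ‖ψ (x + h) - ψ x‖ ≤ ∫ x, (‖ψ (x + h)‖ + ‖ψ x‖) :=
              integral_mono hdiff.norm (hshift.norm.add hint.norm)
                fun x => norm_sub_le _ _
          _ = 2 * N := by
              rw [integral_add hshift.norm hint.norm,
                integral_add_right_eq_self (fun x => ‖ψ x‖) h]
              ring
      have h3 : 1 ≤ ‖h‖ ^ δ := Real.one_le_rpow h1.le hδ0.le
      calc _ ≤ (c₀ + 2 * N + 1) * 1 := by linarith
        _ ≤ _ := by gcongr
  · rw [← integral_congr_ae hae, hψ.integral_eq_zero]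

theorem dilConv_congr_ae {ψ ψ₁ f f₁ : EuclideanSpace ℝ (Fin n) → 𝕜} (hψ : ψ =ᵐ[volume] ψ₁)
    (hf : f =ᵐ[volume] f₁) {t : ℝ} (ht : 0 < t) (y : EuclideanSpace ℝ (Fin n)) :
    dilConv ψ f t y = dilConv ψ₁ f₁ t y := by
  have hsmul : Measure.QuasiMeasurePreserving (fun x : EuclideanSpace ℝ (Fin n) => t⁻¹ • x) :=
    Measure.quasiMeasurePreserving_smul volume (inv_ne_zero ht.ne')
  have hsub : Measure.QuasiMeasurePreserving (fun x : EuclideanSpace ℝ (Fin n) => y - x) :=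
    (Measure.measurePreserving_sub_left volume y).quasiMeasurePreserving
  have h := (hsmul.comp hsub).ae hψ
  rw [dilConv_apply, dilConv_apply]
  refine integral_congr_ae ?_
  filter_upwards [hf, h] with x hx hx'
  simp only [Function.comp_apply] at hx'
  rw [hx, dilate, dilate, hx']

/-- The square function depends only on the almost everywhere classes of `ψ` and `f`. -/
theorem smoothSquareFunction_congr_ae (Φ : 𝓢(EuclideanSpace ℝ (Fin n), ℝ)) (α : ℝ)
    {ψ ψ₁ f f₁ : EuclideanSpace ℝ (Fin n) → 𝕜} (hψ : ψ =ᵐ[volume] ψ₁) (hf : f =ᵐ[volume] f₁) :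
    smoothSquareFunction Φ α ψ f = smoothSquareFunction Φ α ψ₁ f₁ := by
  ext x
  rw [smoothSquareFunction, smoothSquareFunction]
  congr 1
  refine setLIntegral_congr_fun (MeasurableSet.univ.prod measurableSet_Ioi) fun p hp => ?_
  have h := dilConv_congr_ae hψ hf hp.2 p.1
  unfold dilConv at h
  simp only [h]

/-- Each term of the weighted square sum of the averages is bounded by the whole sum. -/
theorem hasCubeGrowth_of_tsum_lt {f : EuclideanSpace ℝ (Fin n) → 𝕜}
    {z : EuclideanSpace ℝ (Fin n)} {ℓ s δ : ℝ} (hℓ : 0 < ℓ) (hs : 0 < s)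
    (h : ∑' k : ℕ, ENNReal.ofReal ((2 : ℝ) ^ (-((k : ℝ) * δ))) *
      ((∫⁻ x in cube z (2 ^ k * ℓ), ‖f x‖ₑ) / volume (cube z (2 ^ k * ℓ))) ^ 2 ≤
        ENNReal.ofReal (s ^ 2)) :
    HasCubeGrowth f z ℓ s (2 ^ (δ / 2)) := by
  intro j
  have hj := (ENNReal.le_tsum j).trans h
  rw [volume_cube z (by positivity)] at hj
  set I := ∫⁻ x in cube z (2 ^ j * ℓ), ‖f x‖ₑ with hI
  have hw : (0 : ℝ) < 2 ^ (-((j : ℝ) * δ)) := by positivity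
  have hpow : ((2 : ℝ) ^ (-((j : ℝ) * δ)))⁻¹ = (((2 : ℝ) ^ (δ / 2)) ^ j) ^ 2 := by
    rw [← two_pow_rpow_eq_sq, ← Real.rpow_neg zero_le_two, neg_neg, Real.rpow_mul zero_le_two,
      Real.rpow_natCast]
  have hsq : (I / ENNReal.ofReal ((2 ^ j * ℓ) ^ n)) ^ 2 ≤
      ENNReal.ofReal (s * (2 ^ (δ / 2)) ^ j) ^ 2 := by
    rw [mul_comm, ← ENNReal.le_div_iff_mul_le (Or.inl (ENNReal.ofReal_pos.2 hw).ne')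
      (Or.inl ENNReal.ofReal_ne_top), ← ENNReal.ofReal_div_of_pos hw] at hj
    refine hj.trans (le_of_eq ?_)
    rw [← ENNReal.ofReal_pow (by positivity), div_eq_mul_inv, hpow, mul_pow]
  have hle := (ENNReal.pow_le_pow_left_iff two_ne_zero).1 hsq
  rw [ENNReal.div_le_iff (ENNReal.ofReal_pos.2 (by positivity)).ne' ENNReal.ofReal_ne_top,
    ← ENNReal.ofReal_mul (by positivity)] at hle
  refine hle.trans_eq (congrArg _ ?_)
  ring

end Reduction

theorem lemma3p1 {n : ℕ} (hn : 1 ≤ n) {𝕜 : Type*} [RCLike 𝕜]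
    (ψ : EuclideanSpace ℝ (Fin n) → 𝕜) (ε δ lam : ℝ)
    (hψ : IsStandardKernel ψ ε)
    (hδ : (ε < 1 ∧ δ = ε) ∨ (ε = 1 ∧ δ < 1))
    (hlam₀ : 0 < lam) (hlam₁ : lam < 1)
    (Φ : 𝓢(EuclideanSpace ℝ (Fin n), ℝ)) (hΦ : IsCutoff Φ) :
    ∃ C : ℝ, 0 < C ∧
      ∀ (α : ℝ), 1 ≤ α →
      ∀ (z : EuclideanSpace ℝ (Fin n)) (ℓ : ℝ), 0 < ℓ →
      ∀ f : EuclideanSpace ℝ (Fin n) → 𝕜, LocallyIntegrable f volume →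
        (Integrable f volume ∨ ∃ x ∈ cube z ℓ, smoothSquareFunction Φ α ψ f x < ∞) →
        localMeanOscillation lam
            (fun x => ((smoothSquareFunction Φ α ψ f x ^ 2 : ℝ≥0∞) : EReal)) (cube z ℓ) ≤
          ENNReal.ofReal (C * α ^ (2 * n)) *
            ∑' k : ℕ, ENNReal.ofReal ((2 : ℝ) ^ (-((k : ℝ) * δ))) *
              ((∫⁻ x in cube z (2 ^ k * ℓ), ‖f x‖ₑ) / volume (cube z (2 ^ k * ℓ))) ^ 2 := by
  have hε := hψ.eps_pos
  -- The exponent `δ` may be non-positive when `ε = 1`; a larger one gives a smaller sum.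
  obtain ⟨δ', hδ0, hδ1, hδε, hδδ⟩ : ∃ δ' : ℝ, 0 < δ' ∧ δ' < 1 ∧ δ' ≤ ε ∧ δ ≤ δ' := by
    rcases hδ with ⟨h1, rfl⟩ | ⟨rfl, h⟩
    · exact ⟨δ, hε, h1, le_rfl, le_rfl⟩
    · exact ⟨max δ (1 / 2), by positivity, max_lt h (by norm_num),
        (max_lt h (by norm_num)).le, le_max_left _ _⟩
  obtain ⟨ψ₁, c, hae, hreg⟩ := hψ.exists_isRegularKernel hδ0 hδ1 hδε
  obtain ⟨C, hC, hmain⟩ := hreg.exists_localMeanOscillation_le hn hΦ hlam₀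
  refine ⟨C, hC, fun α hα z ℓ hℓ f hf hfin => ?_⟩
  have hα0 : 0 < α := by linarith
  have hfm := hf.aestronglyMeasurable
  set f₁ := hfm.mk f with hf₁
  have hf₁m : Measurable f₁ := hfm.stronglyMeasurable_mk.measurable
  have hff : f =ᵐ[volume] f₁ := hfm.ae_eq_mk
  rw [smoothSquareFunction_congr_ae Φ α hae hff] at hfin ⊢
  have hfin₁ : Integrable f₁ ∨ ∃ x ∈ cube z ℓ, smoothSquareFunction Φ α ψ₁ f₁ x < ∞ :=
    hfin.imp_left fun h => h.congr hff
  have hcubes : ∀ k : ℕ, ∫⁻ x in cube z (2 ^ k * ℓ), ‖f x‖ₑ =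
      ∫⁻ x in cube z (2 ^ k * ℓ), ‖f₁ x‖ₑ := fun k =>
    lintegral_congr_ae (ae_restrict_of_ae (by filter_upwards [hff] with x hx; rw [hx]))
  simp_rw [hcubes]
  set S := ∑' k : ℕ, ENNReal.ofReal ((2 : ℝ) ^ (-((k : ℝ) * δ))) *
    ((∫⁻ x in cube z (2 ^ k * ℓ), ‖f₁ x‖ₑ) / volume (cube z (2 ^ k * ℓ))) ^ 2 with hS
  by_cases hStop : S = ∞
  · rw [hStop, ENNReal.mul_top (ENNReal.ofReal_pos.2 (by positivity)).ne']
    exact le_top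
  refine ENNReal.le_of_forall_pos_le_add fun η hη _ => ?_
  have hη' : (0 : ℝ) < η := hη
  -- The sum itself may vanish, and the growth bound needs `s > 0`.
  set e : ℝ := η / (C * α ^ (2 * n)) with he
  have he0 : 0 < e := by positivity
  have hsq : √(S.toReal + e) ^ 2 = S.toReal + e := Real.sq_sqrt (by positivity)
  have hgrow : HasCubeGrowth f₁ z ℓ √(S.toReal + e) (2 ^ (δ' / 2)) := by
    refine hasCubeGrowth_of_tsum_lt hℓ (by positivity) ?_
    rw [hsq]
    calc _ ≤ S := by
          refine ENNReal.tsum_le_tsum fun k => ?_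
          gcongr
          norm_num
      _ = ENNReal.ofReal S.toReal := (ENNReal.ofReal_toReal hStop).symm
      _ ≤ _ := ENNReal.ofReal_le_ofReal (by linarith)
  refine (hmain f₁ hf₁m z ℓ _ α hℓ (by positivity) hα hgrow hfin₁).trans (le_of_eq ?_)
  rw [hsq, mul_add, ENNReal.ofReal_add (by positivity) (by positivity),
    ENNReal.ofReal_mul (by positivity), ENNReal.ofReal_toReal hStop, he,
    mul_div_cancel₀ _ (by positivity), ENNReal.ofReal_coe_nnreal]
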